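/- A deterministic linear-update counter program (CP) has counters $c_1,\dots,c_n$ ranging over $\mathbb{Z}$ and instructions numbered $1,\dots,m$. Each instruction $p<m$ has the form $c_i\leftarrow c_j+c_k$, or $c_i\leftarrow c_j-c_k$, or $\mathtt{if}\ c_i\ge c_j\ \mathtt{goto}\ t$ with $1\le t\le m$; execution continues at $p+1$ unless a test succeeds, in which case it continues at $t$. Instruction $m$ is $\mathtt{halt}$, which loops to itself. A configuration is a tuple $(p,v_1,\dots,v_n)\in\{1,\dots,m\}\times\mathbb{Z}^n$, and a CP comes with a fixed initial configuration in $\{1\}\times\mathbb{N}^n$. A CP is *simple* if - in all reachable configurations all counter values are non-negative; - every test instruction $\mathtt{if}\ c_i\ge c_j\ \mathtt{goto}\ t$ uses only the counters $c_1$ and $c_2$, that is, $i,j\in\{1,2\}$, both of which exist; and - for every test instruction $q$ there are counters $c_{\bar q_1},c_{\bar q_2}$ and constants $a_1,a_2\in\{64,\,64\cdot 10,\,64\cdot 12\}$ such that every reachable configuration $(q,v_1,\dots,v_n)$ satisfies $v_1=a_1v_{\bar q_1}$, $v_2=a_2v_{\bar q_2}$, and $|v_1-v_2|\ge v_k$ for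 all $3\le k\le n$. The *bounded termination problem* for simple CPs asks: given a simple CP (with its initial configuration) and $N\in\mathbb{N}$, all numbers being encoded in binary, is the $\mathtt{halt}$ instruction reached from the initial configuration within $N$ steps? **Proposition.** The bounded termination problem for simple CPs is $\mathsf{EXP}$-complete. That is: 1. (membership) there is a language in $\mathsf{EXP}=\bigcup_k\mathsf{DTIME}(2^{n^k})$ that contains the encoding of an instance whose program is simple if and only if the answer for that instance is yes (nothing is required on words that do not encode such an instance); 2. (hardness) every language $L\in\mathsf{EXP}$ over a finite alphabet has a polynomial-time many-one reduction to the problem: a polynomial-time computable map $f$ such that, for every word $w$, $f(w)$ is an instance whose program is simple, and $w\in L$ if and only if the answer for $f(w)$ is yes. -/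

import Mathlib

/-! ## Exponential time and completeness -/

/-- `L ∈ EXP`: some (multi-stack) Turing machine decides `L`, answering one bit on every word of
length `n` after at most `2 ^ p(n)` steps, for a fixed polynomial `p`. -/
def InEXP {Γ : Type} (L : Set (List Γ)) : Prop :=
  ∃ (f : List Γ → Bool)
    (M : Turing.TM2ComputableInTime (id : List Γ → List Γ) Computability.encodeBool f)
    (p : Polynomial ℕ),
    (∀ w, w ∈ L ↔ f w = true) ∧ ∀ n, M.time n ≤ 2 ^ p.eval n

/-- A decision problem on a type of admissible instances, each presented to a machine as a word
over a finite alphabet. Words that do not encode an admissible instance are outside the promise. -/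
structure EncodedProblem where
  /-- the admissible instances -/
  Inst : Type
  /-- the alphabet -/
  Alph : Type
  [alphFintype : Fintype Alph]
  encode : Inst → List Alph
  encode_injective : Function.Injective encode
  /-- the positive instances -/
  Yes : Inst → Prop

namespace EncodedProblem

/-- Some language in EXP gives the right answer on every admissible instance. -/
def MemEXP (Q : EncodedProblem) : Prop :=
  ∃ L : Set (List Q.Alph), InEXP L ∧ ∀ a : Q.Inst, Q.encode a ∈ L ↔ Q.Yes a

/-- Every language in EXP, over any finite alphabet, has a polynomial-time many-one reduction to
the problem; the reduction outputs admissible instances only. -/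
def EXPHard (Q : EncodedProblem) : Prop :=
  ∀ (Γ : Type) [Fintype Γ] (L : Set (List Γ)), InEXP L →
    ∃ f : List Γ → Q.Inst,
      Nonempty (Turing.TM2ComputableInPolyTime (id : List Γ → List Γ) Q.encode f) ∧
        ∀ w, w ∈ L ↔ Q.Yes (f w)

def EXPComplete (Q : EncodedProblem) : Prop :=
  Q.MemEXP ∧ Q.EXPHard

end EncodedProblem

/-! ## Deterministic linear-update counter programs -/

/-- The instructions, other than `halt`, of a program with `n` counters and `m` instructions. -/
inductive CPInstr (n m : ℕ)
  /-- `add i j k` is `c_i ← c_j + c_k` -/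
  | add (i j k : Fin n)
  /-- `sub i j k` is `c_i ← c_j - c_k` -/
  | sub (i j k : Fin n)
  /-- `test i j t` is `if c_i ≥ c_j goto t` -/
  | test (i j : Fin n) (t : Fin m)

/-- A counter program with `n` counters, the instructions `0, …, len - 1`, the final instruction
`len`, which is `halt`, and initial counter values `init`. Counters and instructions are numbered
from `0`. -/
structure CounterProgram where
  n : ℕ
  len : ℕ
  instr : Fin len → CPInstr n (len + 1)
  init : Fin n → ℕ

namespace CounterProgram

@[ext]
structure Cfg (P : CounterProgram) where
  pc : Fin (P.len + 1)
  val : Fin P.n → ℤ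

variable (P : CounterProgram)

def initCfg : P.Cfg where
  pc := 0
  val i := (P.init i : ℤ)

/-- Execute one instruction; `halt` loops to itself. -/
def step (c : P.Cfg) : P.Cfg :=
  if h : (c.pc : ℕ) < P.len then
    let p : Fin P.len := ⟨c.pc, h⟩
    match P.instr p with
    | .add i j k => ⟨p.succ, Function.update c.val i (c.val j + c.val k)⟩
    | .sub i j k => ⟨p.succ, Function.update c.val i (c.val j - c.val k)⟩
    | .test i j t => ⟨if c.val i ≥ c.val j then t else p.succ, c.val⟩
  else c

def Reachable (c : P.Cfg) : Prop :=
  ∃ k : ℕ, P.step^[k] P.initCfg = c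

/-- The `halt` instruction is reached within `N` steps. -/
def HaltsWithin (N : ℕ) : Prop :=
  ∃ k ≤ N, (P.step^[k] P.initCfg).pc = Fin.last P.len

/-- Simple counter programs. The counters called `c₁`, `c₂` in the text are those with index
`0`, `1` here. -/
def IsSimple : Prop :=
  (∀ c : P.Cfg, P.Reachable c → ∀ i, 0 ≤ c.val i) ∧
  ∀ (q : Fin P.len) (i j : Fin P.n) (t : Fin (P.len + 1)), P.instr q = .test i j t →
    ∃ c₁ c₂ : Fin P.n, (c₁ : ℕ) = 0 ∧ (c₂ : ℕ) = 1 ∧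
      (i = c₁ ∨ i = c₂) ∧ (j = c₁ ∨ j = c₂) ∧
      ∃ (q₁ q₂ : Fin P.n) (a₁ a₂ : ℤ),
        a₁ ∈ ({64, 64 * 10, 64 * 12} : Set ℤ) ∧ a₂ ∈ ({64, 64 * 10, 64 * 12} : Set ℤ) ∧
        ∀ c : P.Cfg, P.Reachable c → c.pc = q.castSucc →
          c.val c₁ = a₁ * c.val q₁ ∧ c.val c₂ = a₂ * c.val q₂ ∧
          ∀ k : Fin P.n, 2 ≤ (k : ℕ) → c.val k ≤ |c.val c₁ - c.val c₂|

end CounterProgram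

/-! ## Instances of the bounded termination problem, written as words -/

/-- The alphabet in which instances are written. -/
inductive CPSym
  | bit (b : Bool)
  | comma
  | add
  | sub
  | test
  deriving DecidableEq, Fintype

/-- A natural number in binary, followed by a comma. -/
def encodeNatSym (k : ℕ) : List CPSym :=
  (Computability.encodeNat k).map CPSym.bit ++ [CPSym.comma]

def CPInstr.encode {n m : ℕ} : CPInstr n m → List CPSym
  | .add i j k => .add :: (encodeNatSym i ++ encodeNatSym j ++ encodeNatSym k)
  | .sub i j k => .sub :: (encodeNatSym i ++ encodeNatSym j ++ encodeNatSym k)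
  | .test i j t => .test :: (encodeNatSym i ++ encodeNatSym j ++ encodeNatSym t)

/-- A counter program together with a step bound `N`. -/
structure BTInstance where
  prog : CounterProgram
  N : ℕ

/-- The word of an instance: the bound `N`, the number of counters, the number of instructions
(including `halt`), the initial values, and the instructions before `halt`; all numbers are in
binary. -/
def BTInstance.encode (I : BTInstance) : List CPSym :=
  encodeNatSym I.N ++ (encodeNatSym I.prog.n ++ (encodeNatSym (I.prog.len + 1) ++
    ((List.ofFn I.prog.init).flatMap encodeNatSym ++
      (List.ofFn I.prog.instr).flatMap CPInstr.encode)))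

theorem encodeNatSym_append_inj {a b : ℕ} {x y : List CPSym}
    (h : encodeNatSym a ++ x = encodeNatSym b ++ y) : a = b ∧ x = y := by
  have aux : ∀ (u v : List Bool) (x y : List CPSym),
      u.map CPSym.bit ++ CPSym.comma :: x = v.map CPSym.bit ++ CPSym.comma :: y →
        u = v ∧ x = y := by
    intro u
    induction u with
    | nil => intro v x y h; cases v <;> simp_all
    | cons s u ih =>
      intro v x y h
      cases v with
      | nil => simp at h
      | cons r v =>
        simp only [List.map_cons, List.cons_append, List.cons.injEq, CPSym.bit.injEq] at h
        obtain ⟨h1, h2⟩ := ih v x y h.2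
        exact ⟨by rw [h.1, h1], h2⟩
  have := aux _ _ x y (by simpa [encodeNatSym] using h)
  exact ⟨Computability.encodingNatBool.encode_injective this.1, this.2⟩

theorem CPInstr.encode_append_inj {n m : ℕ} {a b : CPInstr n m} {x y : List CPSym}
    (h : a.encode ++ x = b.encode ++ y) : a = b ∧ x = y := by
  cases a <;> cases b <;>
    simp only [CPInstr.encode, List.cons_append, List.append_assoc, List.cons.injEq, reduceCtorEq,
      false_and, true_and] at h <;>
    · obtain ⟨h1, h⟩ := encodeNatSym_append_inj h
      obtain ⟨h2, h⟩ := encodeNatSym_append_inj h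
      obtain ⟨h3, h⟩ := encodeNatSym_append_inj h
      simp [Fin.ext h1, Fin.ext h2, Fin.ext h3, h]

theorem flatMap_append_inj_of_prefix {α β : Type} {e : α → List β}
    (he : ∀ {a b : α} {x y : List β}, e a ++ x = e b ++ y → a = b ∧ x = y) :
    ∀ {u v : List α} {x y : List β}, u.length = v.length →
      u.flatMap e ++ x = v.flatMap e ++ y → u = v ∧ x = y
  | [], [], _, _, _, h => by simpa using h
  | a :: u, b :: v, x, y, hl, h => by
    simp only [List.flatMap_cons, List.append_assoc] at h
    obtain ⟨h1, h⟩ := he h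
    obtain ⟨h2, h⟩ := flatMap_append_inj_of_prefix he (by simpa using hl) h
    exact ⟨by rw [h1, h2], h⟩

theorem BTInstance.encode_injective : Function.Injective BTInstance.encode := by
  rintro ⟨⟨n, len, instr, init⟩, N⟩ ⟨⟨n', len', instr', init'⟩, N'⟩ h
  simp only [BTInstance.encode] at h
  obtain ⟨hN, hr⟩ := encodeNatSym_append_inj h
  obtain ⟨hn, hs⟩ := encodeNatSym_append_inj hr
  obtain ⟨hl, ht⟩ := encodeNatSym_append_inj hs
  clear h hr hs
  obtain rfl : len = len' := by omega
  subst hN hn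
  obtain ⟨h1, hu⟩ := flatMap_append_inj_of_prefix encodeNatSym_append_inj (by simp) ht
  obtain ⟨h2, -⟩ := flatMap_append_inj_of_prefix (u := List.ofFn instr)
    (v := List.ofFn instr') (x := []) (y := [])
    CPInstr.encode_append_inj (by rw [List.length_ofFn, List.length_ofFn]) (by rw [hu])
  rw [List.ofFn_injective h1, List.ofFn_injective h2]

/-- The bounded termination problem for simple counter programs. -/
def simpleBoundedTermination : EncodedProblem where
  Inst := {I : BTInstance // I.prog.IsSimple}
  Alph := CPSym
  encode I := I.1.encode
  encode_injective := BTInstance.encode_injective.comp Subtype.val_injective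
  Yes I := I.1.prog.HaltsWithin I.1.N

/-! Membership. All values of a simple program are non-negative, so a difference never exceeds its
minuend and one step at most doubles the largest value. Within `N` steps from initial values written
in a word `w`, every value therefore has at most `N + |w|` bits. Since `N < 2 ^ |w|`, a direct
simulation takes exponential time: the instance is parsed with all numbers in unary, which costs
exponential time, and everything afterwards is polynomial in the size of that parse. Only
non-negativity is used here, not the conditions on tests.

Hardness. A machine deciding a language in EXP is turned into a machine on finitely many stacks of
bits that halts when the answer is yes and runs forever when it is no. A counter program simulates
this machine with one counter per stack and a common scale `m > 0`. A stack with bits `b₀, b₁, …`,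
top first, is stored as `x = m · Σ bᵢ · 4 / 8^(i+1)`, that is, as a fraction of `m` with base-8
digits `0` and `4`. Counters cannot be divided, so a push multiplies the scale and all other stacks
by `8` and adds `4m` (for the old `m`) to the pushed stack if the bit is `true`. A pop replaces `x`
by `8x` or `8x - 4m`.

Digits `0` and `4` leave a gap: `x ≤ m / 14` if the top bit is `false` or the stack is empty, and `x
≥ m / 2` if it is `true`. Comparing `640 x` with `64 m` thus reads the top bit, and the two sides
differ by at least `18 m`, while all counters other than the two compared ones are at most `m`. An
unconditional jump compares `64 m` with `64 · 0`. So every test meets the requirements of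
simplicity, with the factors `64` and `640` alone. One bit operation costs a bounded number of
steps, hence a bound `N = 2 ^ q(n)` suffices; its binary numeral has polynomial length. Because a
rejecting run never halts, `N` only has to be large enough.

Both directions need explicit Turing machines. They come from `Code`, a small language of total
functions on binary trees, compiled to stack programs and then to `TM2`. The membership algorithm is
`Code.decideHalt`, correct by `eval_decideHalt_encode` and within time by `ExpTime.decideHalt`. The
reduction is `Code.exists_computes_instance`. The simulation is carried by
`StackSim.exists_bitMachine`, `BitMachine.exists_path_step`, `BitMachine.isSimple_toCP` and the two
statements on `HaltsWithin` that follow it. -/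

/-! ## Structured programs on stacks and their compilation to `TM2` -/

/-- Structured programs acting on finitely many stacks. `loop k isEnd f` repeatedly pops `k` and
runs `f` on the popped symbol, until `isEnd` holds of the popped symbol. -/
inductive StackProg {K : Type} (Γ : K → Type) : Type
  | nop
  | push (k : K) (a : Γ k)
  | pop (k : K) (f : Option (Γ k) → StackProg Γ)
  | seq (p q : StackProg Γ)
  | loop (k : K) (isEnd : Option (Γ k) → Bool) (f : Option (Γ k) → StackProg Γ)

namespace StackProg

variable {K : Type} [DecidableEq K] {Γ : K → Type}

/-- `Exec p S t S'`: started on the stacks `S`, the program `p` ends after `t` steps with the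
stacks `S'`. -/
inductive Exec : StackProg Γ → (∀ k, List (Γ k)) → ℕ → (∀ k, List (Γ k)) → Prop
  | nop (S) : Exec nop S 1 S
  | push (k a S) : Exec (push k a) S 1 (Function.update S k (a :: S k))
  | pop {k f S t S'} :
      Exec (f (S k).head?) (Function.update S k (S k).tail) t S' → Exec (pop k f) S (t + 1) S'
  | seq {p q S t S' t' S''} : Exec p S t S' → Exec q S' t' S'' → Exec (seq p q) S (t + t') S''
  | loop_exit {k isEnd f S} : isEnd (S k).head? = true →
      Exec (loop k isEnd f) S 1 (Function.update S k (S k).tail)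
  | loop_step {k isEnd f S t S' t' S''} : isEnd (S k).head? = false →
      Exec (f (S k).head?) (Function.update S k (S k).tail) t S' →
      Exec (loop k isEnd f) S' t' S'' → Exec (loop k isEnd f) S (t + 1 + t') S''

/-- The control points of a program. -/
def Lab : StackProg Γ → Type
  | nop => Unit
  | push _ _ => Unit
  | pop _ f => Option (Σ x, Lab (f x))
  | seq p q => Lab p ⊕ Lab q
  | loop _ _ f => Option (Σ x, Lab (f x))

noncomputable instance labFintype [∀ k, Fintype (Γ k)] : ∀ p : StackProg Γ, Fintype (Lab p)
  | nop => inferInstanceAs (Fintype Unit)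
  | push _ _ => inferInstanceAs (Fintype Unit)
  | pop _ f => by
      haveI := fun x => labFintype (f x)
      exact inferInstanceAs (Fintype (Option (Σ x, Lab (f x))))
  | seq p q => by
      haveI := labFintype p
      haveI := labFintype q
      exact inferInstanceAs (Fintype (Lab p ⊕ Lab q))
  | loop _ _ f => by
      haveI := fun x => labFintype (f x)
      exact inferInstanceAs (Fintype (Option (Σ x, Lab (f x))))

def entry : ∀ p : StackProg Γ, Lab p
  | nop => ()
  | push _ _ => ()
  | pop _ _ => none
  | seq p _ => Sum.inl (entry p)
  | loop _ _ _ => none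

/-- The statements of a program whose control points are placed at `at'` and which continues at
`exit`. The internal state remembers the symbol popped last from each stack. -/
def code {Λ : Type} : ∀ p : StackProg Γ, (Lab p → Λ) → Λ → Lab p →
    Turing.TM2.Stmt Γ Λ (∀ k, Option (Γ k))
  | nop, _, exit, _ => .goto fun _ => exit
  | push k a, _, exit, _ => .push k (fun _ => a) (.goto fun _ => exit)
  | pop k f, place, _, none => .pop k (fun s x => Function.update s k x)
      (.goto fun s => place (some ⟨s k, entry (f (s k))⟩))
  | pop _ f, place, exit, some ⟨x, l⟩ => code (f x) (fun l => place (some ⟨x, l⟩)) exit l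
  | seq p q, place, _, Sum.inl l => code p (fun l => place (Sum.inl l)) (place (Sum.inr (entry q))) l
  | seq _ q, place, exit, Sum.inr l => code q (fun l => place (Sum.inr l)) exit l
  | loop k isEnd f, place, exit, none => .pop k (fun s x => Function.update s k x)
      (.goto fun s => if isEnd (s k) then exit else place (some ⟨s k, entry (f (s k))⟩))
  | loop _ _ f, place, _, some ⟨x, l⟩ =>
      code (f x) (fun l => place (some ⟨x, l⟩)) (place none) l

/-- `n` steps of a `TM2` machine. -/
def Steps {Λ σ : Type} (M : Λ → Turing.TM2.Stmt Γ Λ σ) (n : ℕ) (c c' : Turing.TM2.Cfg Γ Λ σ) :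
    Prop :=
  (flip bind (Turing.TM2.step M))^[n] (some c) = some c'

theorem Steps.one {Λ σ : Type} {M : Λ → Turing.TM2.Stmt Γ Λ σ} {c c'}
    (h : Turing.TM2.step M c = some c') : Steps M 1 c c' := h

theorem Steps.trans {Λ σ : Type} {M : Λ → Turing.TM2.Stmt Γ Λ σ} {m n c c' c''}
    (h : Steps M m c c') (h' : Steps M n c' c'') : Steps M (m + n) c c'' := by
  unfold Steps at *
  rw [add_comm, Function.iterate_add_apply, h, h']

/-- The placement and the exit are arbitrary, so that the induction hypothesis applies to a
subprogram wherever it is embedded. The internal state at the start is arbitrary too, because a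
branch only looks at a symbol stored by the pop just executed. -/
theorem Exec.steps {Λ : Type} {M : Λ → Turing.TM2.Stmt Γ Λ (∀ k, Option (Γ k))}
    {p : StackProg Γ} {S t S'} (h : Exec p S t S') :
    ∀ (place : Lab p → Λ) (exit : Λ), (∀ l, M (place l) = code p place exit l) →
      ∀ v, ∃ v', Steps M t ⟨some (place (entry p)), v, S⟩ ⟨some exit, v', S'⟩ := by
  induction h with
  | nop S =>
    intro place exit hM v
    exact ⟨v, Steps.one (by rw [Turing.TM2.step, hM]; rfl)⟩
  | push k a S =>
    intro place exit hM v
    exact ⟨v, Steps.one (by rw [Turing.TM2.step, hM]; rfl)⟩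
  | @pop k f S t S' _ ih =>
    intro place exit hM v
    obtain ⟨v', h'⟩ := ih (fun l => place (some ⟨(S k).head?, l⟩)) exit
      (fun l => hM (some ⟨_, l⟩))
      (Function.update v k (S k).head?)
    refine ⟨v', ?_⟩
    rw [add_comm]
    refine Steps.trans (Steps.one ?_) h'
    refine (congrArg (fun q => some (Turing.TM2.stepAux q v S)) (hM none)).trans ?_
    have h2 : Function.update v k (S k).head? k = (S k).head? := by simp
    simp only [code, Turing.TM2.stepAux]
    rw [h2]
  | @seq p q S t S' t' S'' _ _ ih₁ ih₂ =>
    intro place exit hM v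
    obtain ⟨v', h'⟩ := ih₁ (fun l => place (Sum.inl l)) (place (Sum.inr (entry q)))
      (fun l => hM (Sum.inl l)) v
    obtain ⟨v'', h''⟩ := ih₂ (fun l => place (Sum.inr l)) exit
      (fun l => hM (Sum.inr l)) v'
    exact ⟨v'', h'.trans h''⟩
  | @loop_exit k isEnd f S hs =>
    intro place exit hM v
    refine ⟨Function.update v k (S k).head?, Steps.one ?_⟩
    refine (congrArg (fun q => some (Turing.TM2.stepAux q v S)) (hM none)).trans ?_
    simp [code, Turing.TM2.stepAux, hs]
  | @loop_step k isEnd f S t S' t' S'' hs _ _ ih₁ ih₂ =>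
    intro place exit hM v
    obtain ⟨v', h'⟩ := ih₁ (fun l => place (some ⟨(S k).head?, l⟩)) (place none)
      (fun l => hM (some ⟨_, l⟩)) (Function.update v k (S k).head?)
    obtain ⟨v'', h''⟩ := ih₂ place exit hM v'
    refine ⟨v'', ?_⟩
    rw [add_comm t 1]
    refine Steps.trans (Steps.trans (Steps.one ?_) h') h''
    refine (congrArg (fun q => some (Turing.TM2.stepAux q v S)) (hM none)).trans ?_
    have h2 : Function.update v k (S k).head? k = (S k).head? := by simp
    simp only [code, Turing.TM2.stepAux]
    rw [h2, hs]
    rfl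

/-- The machine that runs a program and halts. -/
noncomputable def toTM2 [Fintype K] [∀ k, Fintype (Γ k)] (p : StackProg Γ) (k₀ k₁ : K) :
    Turing.FinTM2 where
  K := K
  k₀ := k₀
  k₁ := k₁
  Γ := Γ
  Λ := Option (Lab p)
  main := some (entry p)
  σ := ∀ k, Option (Γ k)
  initialState := fun _ => none
  m
    -- `Turing.haltList` requires the initial internal state, so the remembered symbols are erased
    -- before halting. This is the extra step in `Exec.outputs`.
    | none => .load (fun _ _ => none) .halt
    | some l => code p some none l

theorem Exec.outputs [Fintype K] [∀ k, Fintype (Γ k)] {p : StackProg Γ} {k₀ k₁ : K}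
    {x : List (Γ k₀)} {y : List (Γ k₁)} {t : ℕ}
    (h : Exec p (Function.update (fun _ => []) k₀ x) t (Function.update (fun _ => []) k₁ y)) :
    (flip bind (toTM2 p k₀ k₁).step)^[t + 1] (some (Turing.initList (toTM2 p k₀ k₁) x)) =
      some (Turing.haltList (toTM2 p k₀ k₁) y) := by
  obtain ⟨v, h'⟩ := h.steps (M := (toTM2 p k₀ k₁).m) some none (fun _ => rfl) (fun _ => none)
  have h2 := h'.trans (Steps.one (c' := ⟨none, fun _ => none, Function.update (fun _ => []) k₁ y⟩) rfl)
  have e : ∀ (k : K) (z : List (Γ k)), (fun k' => @dite (List (Γ k')) (k' = k) (inferInstance)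
      (fun h => by rw [h]; exact z) fun _ => []) = Function.update (fun _ => []) k z := by
    intro k z
    funext k'
    by_cases hk : k' = k
    · subst hk; simp
    · simp [hk]
  have e0 : Turing.initList (toTM2 p k₀ k₁) x =
      (⟨some (some (entry p)), fun _ => none, Function.update (fun _ => []) k₀ x⟩ :
        Turing.TM2.Cfg Γ (Option (Lab p)) (∀ k, Option (Γ k))) := by
    rw [← e]; rfl
  have e1 : Turing.haltList (toTM2 p k₀ k₁) y =
      (⟨none, fun _ => none, Function.update (fun _ => []) k₁ y⟩ :
        Turing.TM2.Cfg Γ (Option (Lab p)) (∀ k, Option (Γ k))) := by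
    rw [← e]; rfl
  rw [e0, e1]
  exact h2

end StackProg

/-! ## Expressions and a language of total functions on them -/

/-- Binary trees with leaves in `A`. Lists are right spines ending in any leaf. -/
inductive SExp (A : Type)
  | atom (a : A)
  | node (x y : SExp A)

namespace SExp

variable {A : Type}

/-- Prefix notation with the right child first. A word, seen from the top of a stack, then consists
of all its `node` marks, the end leaf and its letters in reverse order, so plain loops can read it
in and write it out. -/
def ser : SExp A → List (Option A)
  | atom a => [some a]
  | node x y => none :: (ser y ++ ser x)

def size : SExp A → ℕ
  | atom _ => 1
  | node x y => 1 + size x + size y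

def hd : SExp A → SExp A
  | atom a => atom a
  | node x _ => x

def tl : SExp A → SExp A
  | atom a => atom a
  | node _ y => y

/-- Length of the right spine. -/
def len : SExp A → ℕ
  | atom _ => 0
  | node _ y => len y + 1

/-- Does `p` hold of this leaf? -/
def test (p : A → Bool) : SExp A → Bool
  | atom a => p a
  | node _ _ => false

theorem length_ser (x : SExp A) : x.ser.length = x.size := by
  induction x with
  | atom a => rfl
  | node x y ihx ihy => simp [ser, size, ihx, ihy]; omega

theorem size_pos (x : SExp A) : 0 < x.size := by
  cases x <;> simp only [size] <;> omega

end SExp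

open SExp

/-- A language of total functions on expressions. `iter f` maps `node l a` to `f^[len l] a`. -/
inductive Code (A : Type)
  | id
  | const (a : A)
  | hd
  | tl
  | pair (f g : Code A)
  | comp (f g : Code A)
  | cond (p : A → Bool) (f g h : Code A)
  | iter (f : Code A)

namespace Code

variable {A : Type}

def eval : Code A → SExp A → SExp A
  | id, x => x
  | const a, _ => atom a
  | hd, x => x.hd
  | tl, x => x.tl
  | pair f g, x => node (eval f x) (eval g x)
  | comp f g, x => eval f (eval g x)
  | cond p f g h, x => if (eval f x).test p then eval g x else eval h x
  | iter _, atom a => atom a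
  | iter f, node l a => (eval f)^[l.len] a

/-- A bound for the running time of the compiled code. -/
def cost : Code A → SExp A → ℕ
  | id, _ => 1
  | const _, x => 6 * x.size + 3
  | hd, x => 6 * x.size + 3
  | tl, x => 20 * x.size + 20
  | pair f g, x => cost f x + cost g x + 30 * (x.size + (eval f x).size + 1)
  | comp f g, x => cost g x + cost f (eval g x)
  | cond _ f g h, x => cost f x + cost g x + cost h x + 30 * (x.size + (eval f x).size + 1)
  | iter _, atom _ => 2
  | iter f, node l a => 30 * (l.size + a.size + 1) + ∑ i ∈ Finset.range l.len,
      (cost f ((eval f)^[i] a) +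
        60 * (l.size + ((eval f)^[i] a).size + ((eval f)^[i + 1] a).size + 1))

end Code

/-! ## Compilation to stack programs -/

/-- The stk of a compiled code. -/
inductive StackId
  | inp | out | main | t1 | t2 | cnt
  deriving DecidableEq

namespace StackId

instance : Fintype StackId := ⟨{inp, out, main, t1, t2, cnt}, by rintro ⟨⟩ <;> simp⟩

/-- The alphabets of the stacks. -/
def Alph (Γ Δ A : Type) : StackId → Type
  | inp => Γ
  | out => Δ
  | main => Option A
  | t1 => Option A
  | t2 => Option A
  | cnt => Unit

noncomputable instance {Γ Δ A : Type} [Fintype Γ] [Fintype Δ] [Fintype A] :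
    ∀ k, Fintype (Alph Γ Δ A k)
  | inp => inferInstanceAs (Fintype Γ)
  | out => inferInstanceAs (Fintype Δ)
  | main => inferInstanceAs (Fintype (Option A))
  | t1 => inferInstanceAs (Fintype (Option A))
  | t2 => inferInstanceAs (Fintype (Option A))
  | cnt => inferInstanceAs (Fintype Unit)

variable {Γ Δ A : Type}

def stk (i : List Γ) (o : List Δ) (m a b : List (Option A)) (c : List Unit) :
    ∀ k, List (Alph Γ Δ A k)
  | inp => i
  | out => o
  | main => m
  | t1 => a
  | t2 => b
  | cnt => c

section
variable (i : List Γ) (o : List Δ) (m a b : List (Option A)) (c : List Unit)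

@[simp] theorem update_inp (x : List Γ) :
    Function.update (stk i o m a b c) inp x = stk x o m a b c := by
  funext k; cases k <;> rfl
@[simp] theorem update_out (x : List Δ) :
    Function.update (stk i o m a b c) out x = stk i x m a b c := by
  funext k; cases k <;> rfl
@[simp] theorem update_main (x : List (Option A)) :
    Function.update (stk i o m a b c) main x = stk i o x a b c := by
  funext k; cases k <;> rfl
@[simp] theorem update_t1 (x : List (Option A)) :
    Function.update (stk i o m a b c) t1 x = stk i o m x b c := by
  funext k; cases k <;> rfl
@[simp] theorem update_t2 (x : List (Option A)) :
    Function.update (stk i o m a b c) t2 x = stk i o m a x c := by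
  funext k; cases k <;> rfl
@[simp] theorem update_cnt (x : List Unit) :
    Function.update (stk i o m a b c) cnt x = stk i o m a b x := by
  funext k; cases k <;> rfl

end

end StackId

/-! ### Upper bounds for the running time of stack programs -/

namespace StackProg

variable {K : Type} [DecidableEq K] {Γ : K → Type}

/-- `Exec` with an upper bound on the time. -/
def Runs (p : StackProg Γ) (S : ∀ k, List (Γ k)) (t : ℕ) (S' : ∀ k, List (Γ k)) : Prop :=
  ∃ t' ≤ t, Exec p S t' S'

variable {p q : StackProg Γ} {S S' S'' : ∀ k, List (Γ k)} {t t' : ℕ} {k : K}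

theorem Runs.mono (h : Runs p S t S') (ht : t ≤ t') : Runs p S t' S' :=
  let ⟨u, hu, hr⟩ := h
  ⟨u, hu.trans ht, hr⟩

theorem Runs.nop : Runs StackProg.nop S 1 S := ⟨1, le_rfl, .nop S⟩

theorem Runs.push (a : Γ k) (h : Function.update S k (a :: S k) = S') :
    Runs (StackProg.push k a) S 1 S' := ⟨1, le_rfl, h ▸ .push k a S⟩

theorem Runs.seq (h : Runs p S t S') (h' : Runs q S' t' S'') :
    Runs (StackProg.seq p q) S (t + t') S'' :=
  let ⟨_, hu, hr⟩ := h
  let ⟨_, hu', hr'⟩ := h'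
  ⟨_, add_le_add hu hu', .seq hr hr'⟩

theorem Runs.pop {f : Option (Γ k) → StackProg Γ} {z : List (Γ k)} (hz : S k = z)
    {S₁ : ∀ k, List (Γ k)} (hu : Function.update S k z.tail = S₁) (h : Runs (f z.head?) S₁ t S') :
    Runs (StackProg.pop k f) S (t + 1) S' := by
  subst hz hu
  obtain ⟨_, hu, hr⟩ := h
  exact ⟨_, Nat.add_le_add_right hu 1, .pop hr⟩

theorem Runs.loop_exit {f : Option (Γ k) → StackProg Γ} {isEnd : Option (Γ k) → Bool}
    {z : List (Γ k)} (hz : S k = z) {S₁ : ∀ k, List (Γ k)} (hu : Function.update S k z.tail = S₁)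
    (h : isEnd z.head? = true) : Runs (StackProg.loop k isEnd f) S 1 S₁ := by
  subst hz hu
  exact ⟨1, le_rfl, .loop_exit h⟩

theorem Runs.loop_step {f : Option (Γ k) → StackProg Γ} {isEnd : Option (Γ k) → Bool}
    {z : List (Γ k)} (hz : S k = z) {S₁ : ∀ k, List (Γ k)} (hu : Function.update S k z.tail = S₁)
    (h : isEnd z.head? = false) (h1 : Runs (f z.head?) S₁ t S')
    (h2 : Runs (StackProg.loop k isEnd f) S' t' S'') :
    Runs (StackProg.loop k isEnd f) S (t + 1 + t') S'' := by
  subst hz hu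
  obtain ⟨_, hu, hr⟩ := h1
  obtain ⟨_, hu', hr'⟩ := h2
  exact ⟨_, by omega, .loop_step h hr hr'⟩

/-- Empty the stack `k`, running `emit` on each of its symbols. -/
def drain (k : K) (emit : Γ k → StackProg Γ) : StackProg Γ :=
  loop k Option.isNone fun
    | none => nop
    | some s => emit s

/-- `F w d` describes the stacks when `w` remains on `k` and `d` is what has been treated, latest
symbol first; `G w d` describes them just after a pop, before `emit` has acted. -/
theorem runs_drain {k : K} {emit : Γ k → StackProg Γ} {c : ℕ}
    {F G : List (Γ k) → List (Γ k) → ∀ k', List (Γ k')} (hF : ∀ w d, F w d k = w)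
    (hu : ∀ s w d, Function.update (F (s :: w) d) k w = G w d)
    (he : ∀ s w d, Runs (emit s) (G w d) c (F w (s :: d))) (w d : List (Γ k)) :
    Runs (drain k emit) (F w d) ((c + 1) * w.length + 1) (F [] (w.reverse ++ d)) := by
  induction w generalizing d with
  | nil =>
    have h : Runs (drain k emit) (F [] d) 1 (F [] d) := by
      refine Runs.loop_exit (hF [] d) ?_ rfl
      have := Function.update_eq_self k (F [] d)
      rwa [hF] at this
    simpa using h
  | cons s w ih =>
    have h : Runs (drain k emit) (F (s :: w) d) (c + 1 + ((c + 1) * w.length + 1))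
        (F [] (w.reverse ++ s :: d)) :=
      Runs.loop_step (hF _ d) (hu s w d) rfl (he s w d) (ih (s :: d))
    simp only [List.reverse_cons, List.append_assoc, List.singleton_append, List.length_cons]
    exact h.mono (by ring_nf; omega)

end StackProg

/-! ### Elementary runs on the six stacks -/

namespace StackProg

open StackId

variable {Γ Δ A : Type} {i : List Γ} {o : List Δ} {m a b : List (Option A)} {c : List Unit}
  {t t' : ℕ} {S' S'' : ∀ k, List (Alph Γ Δ A k)}

theorem runs_push_out (s : Δ) :
    Runs (.push out s : StackProg (Alph Γ Δ A)) (stk i o m a b c) 1 (stk i (s :: o) m a b c) :=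
  Runs.push _ (update_out i o m a b c (s :: o))

theorem runs_push_main (s : Option A) :
    Runs (.push main s : StackProg (Alph Γ Δ A)) (stk i o m a b c) 1 (stk i o (s :: m) a b c) :=
  Runs.push _ (update_main i o m a b c (s :: m))

theorem runs_push_t1 (s : Option A) :
    Runs (.push t1 s : StackProg (Alph Γ Δ A)) (stk i o m a b c) 1 (stk i o m (s :: a) b c) :=
  Runs.push _ (update_t1 i o m a b c (s :: a))

theorem runs_push_t2 (s : Option A) :
    Runs (.push t2 s : StackProg (Alph Γ Δ A)) (stk i o m a b c) 1 (stk i o m a (s :: b) c) :=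
  Runs.push _ (update_t2 i o m a b c (s :: b))

theorem runs_push_cnt :
    Runs (.push cnt () : StackProg (Alph Γ Δ A)) (stk i o m a b c) 1 (stk i o m a b (() :: c)) :=
  Runs.push _ (update_cnt i o m a b c (() :: c))

theorem runs_pop_main {f : Option (Option A) → StackProg (Alph Γ Δ A)} {s : Option A}
    (h : Runs (f (some s)) (stk i o m a b c) t S') :
    Runs (.pop main f) (stk i o (s :: m) a b c) (t + 1) S' :=
  Runs.pop rfl (update_main i o (s :: m) a b c m) h

theorem runs_loop_main_stop {f : Option (Option A) → StackProg (Alph Γ Δ A)}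
    {isEnd : Option (Option A) → Bool} {s : Option A} (h : isEnd (some s) = true) :
    Runs (.loop main isEnd f) (stk i o (s :: m) a b c) 1 (stk i o m a b c) :=
  Runs.loop_exit rfl (update_main i o (s :: m) a b c m) h

theorem runs_loop_main_step {f : Option (Option A) → StackProg (Alph Γ Δ A)}
    {isEnd : Option (Option A) → Bool} {s : Option A} (h : isEnd (some s) = false)
    (h1 : Runs (f (some s)) (stk i o m a b c) t S') (h2 : Runs (.loop main isEnd f) S' t' S'') :
    Runs (.loop main isEnd f) (stk i o (s :: m) a b c) (t + 1 + t') S'' :=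
  Runs.loop_step rfl (update_main i o (s :: m) a b c m) h h1 h2

theorem runs_loop_cnt_stop {f : Option Unit → StackProg (Alph Γ Δ A)}
    {isEnd : Option Unit → Bool} (h : isEnd none = true) :
    Runs (.loop cnt isEnd f) (stk i o m a b []) 1 (stk i o m a b []) :=
  Runs.loop_exit rfl (update_cnt i o m a b [] []) h

theorem runs_loop_cnt_step {f : Option Unit → StackProg (Alph Γ Δ A)}
    {isEnd : Option Unit → Bool} (h : isEnd (some ()) = false)
    (h1 : Runs (f (some ())) (stk i o m a b c) t S') (h2 : Runs (.loop cnt isEnd f) S' t' S'') :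
    Runs (.loop cnt isEnd f) (stk i o m a b (() :: c)) (t + 1 + t') S'' :=
  Runs.loop_step rfl (update_cnt i o m a b (() :: c) c) h h1 h2

theorem runs_drain_inp {emit : Γ → StackProg (Alph Γ Δ A)} {n : ℕ}
    (M : List Γ → List (Option A)) (C : List Γ → List Unit)
    (he : ∀ s w d, Runs (emit s) (stk w o (M d) a b (C d)) n
      (stk w o (M (s :: d)) a b (C (s :: d)))) (w d : List Γ) :
    Runs (drain inp emit) (stk w o (M d) a b (C d)) ((n + 1) * w.length + 1)
      (stk [] o (M (w.reverse ++ d)) a b (C (w.reverse ++ d))) :=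
  runs_drain (Γ := Alph Γ Δ A) (k := inp) (F := fun w d => stk w o (M d) a b (C d))
    (fun _ _ => rfl) (fun s w d => update_inp (s :: w) o (M d) a b (C d) w) he w d

theorem runs_drain_cnt {emit : Unit → StackProg (Alph Γ Δ A)} {n : ℕ}
    (M : List Unit → List (Option A))
    (he : ∀ s w d, Runs (emit s) (stk i o (M d) a b w) n (stk i o (M (s :: d)) a b w))
    (w d : List Unit) :
    Runs (drain cnt emit) (stk i o (M d) a b w) ((n + 1) * w.length + 1)
      (stk i o (M (w.reverse ++ d)) a b []) :=
  runs_drain (Γ := Alph Γ Δ A) (k := cnt) (F := fun w d => stk i o (M d) a b w)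
    (fun _ _ => rfl) (fun s w d => update_cnt i o (M d) a b (s :: w) w) he w d

theorem runs_drain_main {emit : Option A → StackProg (Alph Γ Δ A)} {n : ℕ}
    (O : List (Option A) → List Δ)
    (he : ∀ s w d, Runs (emit s) (stk [] (O d) w [] [] []) n (stk [] (O (s :: d)) w [] [] []))
    (w d : List (Option A)) :
    Runs (drain main emit) (stk [] (O d) w [] [] []) ((n + 1) * w.length + 1)
      (stk [] (O (w.reverse ++ d)) [] [] [] []) :=
  runs_drain (Γ := Alph Γ Δ A) (k := main) (F := fun w d => stk [] (O d) w [] [] [])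
    (fun _ _ => rfl) (fun s w d => update_main [] (O d) (s :: w) [] [] [] w) he w d

theorem runs_drain_t1 {emit : Option A → StackProg (Alph Γ Δ A)} {n : ℕ}
    (M B : List (Option A) → List (Option A))
    (he : ∀ s w d, Runs (emit s) (stk i o (M d) w (B d) c) n (stk i o (M (s :: d)) w (B (s :: d)) c))
    (w d : List (Option A)) :
    Runs (drain t1 emit) (stk i o (M d) w (B d) c) ((n + 1) * w.length + 1)
      (stk i o (M (w.reverse ++ d)) [] (B (w.reverse ++ d)) c) :=
  runs_drain (Γ := Alph Γ Δ A) (k := t1) (F := fun w d => stk i o (M d) w (B d) c)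
    (fun _ _ => rfl) (fun s w d => update_t1 i o (M d) (s :: w) (B d) c w) he w d

theorem runs_drain_t2 {emit : Option A → StackProg (Alph Γ Δ A)} {n : ℕ}
    (M B : List (Option A) → List (Option A))
    (he : ∀ s w d, Runs (emit s) (stk i o (M d) (B d) w c) n (stk i o (M (s :: d)) (B (s :: d)) w c))
    (w d : List (Option A)) :
    Runs (drain t2 emit) (stk i o (M d) (B d) w c) ((n + 1) * w.length + 1)
      (stk i o (M (w.reverse ++ d)) (B (w.reverse ++ d)) [] c) :=
  runs_drain (Γ := Alph Γ Δ A) (k := t2) (F := fun w d => stk i o (M d) (B d) w c)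
    (fun _ _ => rfl) (fun s w d => update_t2 i o (M d) (B d) (s :: w) c w) he w d

end StackProg

/-! ### The compiler and the time taken by compiled code -/

namespace Code

open StackId StackProg

variable {Γ Δ A : Type}

/-- One step of `skip`: read a symbol, announcing two subexpressions after a `node`. -/
def skipStep (emit : Option A → StackProg (Alph Γ Δ A)) : StackProg (Alph Γ Δ A) :=
  .pop main fun
    | none => .nop
    | some none => .seq (emit none) (.seq (.push cnt ()) (.push cnt ()))
    | some (some a) => emit (some a)

/-- Remove a serialised expression from the main stack, running `emit` on its symbols. -/
def skip (emit : Option A → StackProg (Alph Γ Δ A)) : StackProg (Alph Γ Δ A) :=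
  .seq (.push cnt ()) <| .loop cnt Option.isNone fun _ => skipStep emit

/-- The stack `cnt` holds one mark for every subexpression still to be read. A leaf consumes a mark
and a `node` exchanges one for two, so the marks run out exactly at the end of the expression. The
functions `f` and `g` give the contents of `t1` and `t2` in terms of the symbols emitted. -/
theorem runs_skip {i : List Γ} {o : List Δ} {emit : Option A → StackProg (Alph Γ Δ A)}
    {f g : List (Option A) → List (Option A)}
    (he : ∀ s m w c, Runs (emit s) (stk i o m (f w) (g w) c) 1
      (stk i o m (f (s :: w)) (g (s :: w)) c)) (x : SExp A) (r w : List (Option A)) :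
    Runs (skip emit) (stk i o (x.ser ++ r) (f w) (g w) []) (6 * x.size + 2)
      (stk i o r (f (x.ser.reverse ++ w)) (g (x.ser.reverse ++ w)) []) := by
  -- Stated for the loop with further marks `c` pending and an arbitrary continuation, so that the
  -- two children of a `node` can be read one after the other.
  have key : ∀ (x : SExp A) (r w : List (Option A)) (c : List Unit) (t : ℕ) (S),
      Runs (.loop cnt Option.isNone fun _ => skipStep emit)
        (stk i o r (f (x.ser.reverse ++ w)) (g (x.ser.reverse ++ w)) c) t S →
      Runs (.loop cnt Option.isNone fun _ => skipStep emit)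
        (stk i o (x.ser ++ r) (f w) (g w) (() :: c)) (6 * x.size + t) S := by
    intro x
    induction x with
    | atom a =>
      intro r w c t S h
      exact (runs_loop_cnt_step rfl (runs_pop_main (he _ _ _ _)) h).mono
        (by simp only [SExp.size]; omega)
    | node x y ihx ihy =>
      intro r w c t S h
      have h1 := ihy (x.ser ++ r) (none :: w) (() :: c) _ _ (ihx r (y.ser.reverse ++ none :: w) c t S
        (by simpa [ser] using h))
      rw [← List.append_assoc] at h1
      exact (runs_loop_cnt_step rfl (runs_pop_main
        ((he _ _ _ _).seq (runs_push_cnt.seq runs_push_cnt))) h1).mono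
          (by simp only [SExp.size]; omega)
  exact (runs_push_cnt.seq (key x r w [] 1 _ (runs_loop_cnt_stop rfl))).mono (by omega)

/-- Drop the expression on top of the main stack. -/
def drop : StackProg (Alph Γ Δ A) := skip fun _ => .nop

theorem runs_drop (i : List Γ) (o : List Δ) (x : SExp A) (r a b : List (Option A)) :
    Runs drop (stk i o (x.ser ++ r) a b []) (6 * x.size + 2) (stk i o r a b []) :=
  runs_skip (f := fun _ => a) (g := fun _ => b) (fun _ _ _ _ => Runs.nop) x r []

theorem runs_skip_t1 (i : List Γ) (o : List Δ) (x : SExp A) (r b : List (Option A)) :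
    Runs (skip fun s => .push t1 s) (stk i o (x.ser ++ r) [] b []) (6 * x.size + 2)
      (stk i o r x.ser.reverse b []) := by
  have := runs_skip (i := i) (o := o) (f := fun w => w) (g := fun _ => b)
    (fun s _ _ _ => runs_push_t1 s) x r []
  rwa [List.append_nil] at this

theorem runs_skip_t2 (i : List Γ) (o : List Δ) (x : SExp A) (r a : List (Option A)) :
    Runs (skip fun s => .push t2 s) (stk i o (x.ser ++ r) a [] []) (6 * x.size + 2)
      (stk i o r a x.ser.reverse []) := by
  have := runs_skip (i := i) (o := o) (f := fun _ => a) (g := fun w => w)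
    (fun s _ _ _ => runs_push_t2 s) x r []
  rwa [List.append_nil] at this

/-- Put the expression saved on `t1` back. -/
theorem runs_restore_t1 (i : List Γ) (o : List Δ) (x : SExp A) (r b : List (Option A)) :
    Runs (drain t1 fun s => .push main s) (stk i o r x.ser.reverse b []) (2 * x.size + 1)
      (stk i o (x.ser ++ r) [] b []) := by
  have := runs_drain_t1 (i := i) (o := o) (c := []) (fun w => w) (fun _ => b)
    (fun s _ _ => runs_push_main s) x.ser.reverse r
  rwa [List.reverse_reverse, List.length_reverse, length_ser] at this

/-- Put the expression saved on `t2` back. -/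
theorem runs_restore_t2 (i : List Γ) (o : List Δ) (x : SExp A) (r a : List (Option A)) :
    Runs (drain t2 fun s => .push main s) (stk i o r a x.ser.reverse []) (2 * x.size + 1)
      (stk i o (x.ser ++ r) a [] []) := by
  have := runs_drain_t2 (i := i) (o := o) (c := []) (fun w => w) (fun _ => a)
    (fun s _ _ => runs_push_main s) x.ser.reverse r
  rwa [List.reverse_reverse, List.length_reverse, length_ser] at this

/-- Exchange the two expressions on top of the main stack. -/
def swap : StackProg (Alph Γ Δ A) :=
  .seq (skip fun s => .push t1 s) <| .seq (skip fun s => .push t2 s) <|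
    .seq (drain t1 fun s => .push main s) (drain t2 fun s => .push main s)

theorem runs_swap (i : List Γ) (o : List Δ) (x y : SExp A) (r : List (Option A)) :
    Runs swap (stk i o (x.ser ++ (y.ser ++ r)) [] [] []) (8 * (x.size + y.size) + 6)
      (stk i o (y.ser ++ (x.ser ++ r)) [] [] []) :=
  ((runs_skip_t1 i o x (y.ser ++ r) []).seq <| (runs_skip_t2 i o y r _).seq <|
    (runs_restore_t1 i o x r _).seq (runs_restore_t2 i o y (x.ser ++ r) [])).mono (by omega)

/-- Duplicate the expression on top of the main stack. -/
def dup : StackProg (Alph Γ Δ A) :=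
  .seq (skip fun s => .push t1 s) <|
    -- The copy on `t1` is reversed, so emptying it writes the expression the right way round on
    -- both `main` and `t2`. The copy on `t2` must be reversed once more before it can be put on
    -- `main`.
    .seq (drain t1 fun s => .seq (.push main s) (.push t2 s)) <|
    .seq (drain t2 fun s => .push t1 s) (drain t1 fun s => .push main s)

theorem runs_dup (i : List Γ) (o : List Δ) (x : SExp A) (r : List (Option A)) :
    Runs dup (stk i o (x.ser ++ r) [] [] []) (13 * x.size + 5)
      (stk i o (x.ser ++ (x.ser ++ r)) [] [] []) := by
  have h2 := runs_drain_t1 (i := i) (o := o) (c := []) (fun w => w ++ r) (fun w => w)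
    (fun s _ _ => (runs_push_main s).seq (runs_push_t2 s)) x.ser.reverse []
  have h3 := runs_drain_t2 (i := i) (o := o) (c := []) (fun _ => x.ser ++ r) (fun w => w)
    (fun s _ _ => runs_push_t1 s) x.ser []
  rw [List.reverse_reverse, List.append_nil, List.length_reverse, length_ser] at h2
  rw [List.append_nil, length_ser] at h3
  exact ((runs_skip_t1 i o x r []).seq (h2.seq (h3.seq
    (runs_restore_t1 i o x (x.ser ++ r) [])))).mono (by omega)

/-- Given `a` above the list `l`, replace both by `f^[len l] a`. -/
def iterate (f : StackProg (Alph Γ Δ A)) : StackProg (Alph Γ Δ A) :=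
  .loop main (fun | some none => false | _ => true) fun _ =>
    .seq (skip fun s => .push t1 s) <| .seq drop <| .seq (drain t1 fun s => .push main s) <|
      .seq swap <| .seq f swap

/-- The stack program that replaces the expression on top of the main stack by its image. -/
def compile : Code A → StackProg (Alph Γ Δ A)
  | id => .nop
  | const a => .seq drop (.push main (some a))
  | hd => .pop main fun
    | none => .nop
    | some none => drop
    | some (some a) => .push main (some a)
  | tl => .pop main fun
    | none => .nop
    | some none => .seq (skip fun s => .push t1 s) (.seq drop (drain t1 fun s => .push main s))
    | some (some a) => .push main (some a)
  -- The right child is serialised on top of the left one, so `f` has to run before `g`.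
  | pair f g => .seq dup <| .seq (compile f) <| .seq swap <| .seq (compile g) (.push main none)
  | comp f g => .seq (compile g) (compile f)
  | cond p f g h => .seq dup <| .seq (compile f) <| .pop main fun
    | none => .nop
    | some none => .seq drop (.seq drop (compile h))
    | some (some a) => if p a then compile g else compile h
  | iter f => .pop main fun
    | none => .nop
    | some (some a) => .push main (some a)
    | some none => .seq swap (iterate (compile f))

/-- Between rounds the remaining list lies above the current value. A round removes one `node` and
its left child, and swaps before and after `f` to give `f` access to the value. -/
theorem runs_iterate {f : Code A} {i : List Γ} {o : List Δ}
    (ih : ∀ (x : SExp A) (r : List (Option A)), Runs (compile f) (stk i o (x.ser ++ r) [] [] [])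
      (cost f x) (stk i o ((eval f x).ser ++ r) [] [] []))
    (l a : SExp A) (r : List (Option A)) :
    Runs (iterate (compile f)) (stk i o (l.ser ++ (a.ser ++ r)) [] [] [])
      (1 + ∑ i ∈ Finset.range l.len, (cost f ((eval f)^[i] a) +
        60 * (l.size + ((eval f)^[i] a).size + ((eval f)^[i + 1] a).size + 1)))
      (stk i o (((eval f)^[l.len] a).ser ++ r) [] [] []) := by
  induction l generalizing a with
  | atom b => exact runs_loop_main_stop rfl
  | node y l _ ihl =>
    have h1 := (runs_skip_t1 i o l (y.ser ++ (a.ser ++ r)) []).seq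
      ((runs_drop i o y (a.ser ++ r) _ []).seq ((runs_restore_t1 i o l (a.ser ++ r) []).seq
        ((runs_swap i o l a r).seq ((ih a (l.ser ++ r)).seq (runs_swap i o _ l r)))))
    rw [← List.append_assoc] at h1
    refine (runs_loop_main_step rfl h1 (ihl (eval f a))).mono ?_
    have hs : ∑ i ∈ Finset.range l.len, (cost f ((eval f)^[i] (eval f a)) +
        60 * (l.size + ((eval f)^[i] (eval f a)).size +
          ((eval f)^[i + 1] (eval f a)).size + 1)) ≤
        ∑ i ∈ Finset.range l.len, (cost f ((eval f)^[i + 1] a) +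
        60 * ((node y l).size + ((eval f)^[i + 1] a).size +
          ((eval f)^[i + 1 + 1] a).size + 1)) := by
      refine Finset.sum_le_sum fun j _ => ?_
      simp only [← Function.iterate_succ_apply, SExp.size, Nat.succ_eq_add_one]
      omega
    simp only [len, Finset.sum_range_succ', Function.iterate_zero, Function.id_def,
      zero_add, Function.iterate_one]
    simp only [SExp.size] at hs ⊢
    omega

theorem runs_compile (c : Code A) (i : List Γ) (o : List Δ) (x : SExp A) (r : List (Option A)) :
    Runs (compile c) (stk i o (x.ser ++ r) [] [] []) (cost c x)
      (stk i o ((eval c x).ser ++ r) [] [] []) := by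
  induction c generalizing x r with
  | id => exact Runs.nop
  | const a =>
    exact ((runs_drop i o x r [] []).seq (runs_push_main (some a))).mono
      (by simp only [cost]; omega)
  | hd =>
    cases x with
    | atom a => exact (runs_pop_main (runs_push_main (some a))).mono (by simp only [cost]; omega)
    | node x y =>
      have h := runs_drop i o y (x.ser ++ r) [] []
      rw [← List.append_assoc] at h
      exact (runs_pop_main h).mono (by simp only [cost, SExp.size]; omega)
  | tl =>
    cases x with
    | atom a => exact (runs_pop_main (runs_push_main (some a))).mono (by simp only [cost]; omega)
    | node x y =>
      have h := (runs_skip_t1 i o y (x.ser ++ r) []).seq ((runs_drop i o x r _ []).seq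
        (runs_restore_t1 i o y r []))
      rw [← List.append_assoc] at h
      exact (runs_pop_main h).mono (by simp only [cost, SExp.size]; omega)
  | pair f g ihf ihg =>
    have h := (runs_dup i o x r).seq ((ihf x (x.ser ++ r)).seq ((runs_swap i o _ x r).seq
      ((ihg x _).seq (runs_push_main none))))
    rw [← List.append_assoc, ← List.cons_append] at h
    exact h.mono (by simp only [cost]; omega)
  | comp f g ihf ihg => exact (ihg x r).seq (ihf _ r)
  | cond p f g h ihf ihg ihh =>
    have h1 := ihf x (x.ser ++ r)
    simp only [eval]
    cases hy : eval f x with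
    | atom a =>
      rw [hy] at h1
      refine ((runs_dup i o x r).seq (h1.seq (runs_pop_main (t := cost g x + cost h x) ?_))).mono
        (by simp only [cost]; omega)
      by_cases hx : p a
      · simp only [SExp.test, hx, if_true]
        exact (ihg x r).mono (by omega)
      · simp only [SExp.test, hx]
        exact (ihh x r).mono (by omega)
    | node y z =>
      rw [hy, ser, List.cons_append, List.append_assoc] at h1
      exact ((runs_dup i o x r).seq (h1.seq (runs_pop_main
        ((runs_drop i o z (y.ser ++ (x.ser ++ r)) [] []).seq
          ((runs_drop i o y (x.ser ++ r) [] []).seq (ihh x r)))))).mono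
            (by simp only [cost, hy, SExp.size]; omega)
  | iter f ih =>
    cases x with
    | atom a => exact runs_pop_main (runs_push_main (some a))
    | node l a =>
      have h1 := (runs_swap i o a l r).seq (runs_iterate ih l a r)
      rw [← List.append_assoc] at h1
      exact (runs_pop_main h1).mono (by simp only [cost]; omega)

end Code

/-! ## From codes to Turing machines -/

namespace SExp

variable {A : Type} [Inhabited A]

/-- A list as an expression. -/
def list (l : List (SExp A)) : SExp A := l.foldr node (atom default)

@[simp] theorem list_nil : list ([] : List (SExp A)) = atom default := rfl

@[simp] theorem list_cons (x : SExp A) (l : List (SExp A)) : list (x :: l) = node x (list l) := rfl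

/-- A word as an expression. -/
def word {Γ : Type} (e : Γ → A) (w : List Γ) : SExp A := list (w.map fun a => atom (e a))


@[simp] theorem word_cons {Γ : Type} (e : Γ → A) (a : Γ) (w : List Γ) :
    word e (a :: w) = node (atom (e a)) (word e w) := rfl

theorem ser_word {Γ : Type} (e : Γ → A) (w : List Γ) :
    (word e w).ser = List.replicate w.length none ++
      some default :: (w.map fun a => some (e a)).reverse := by
  induction w with
  | nil => rfl
  | cons a w ih => simp [ser, ih, List.replicate_succ]

theorem size_word {Γ : Type} (e : Γ → A) (w : List Γ) : (word e w).size = 2 * w.length + 1 := by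
  induction w with
  | nil => rfl
  | cons a w ih => simp [size, ih]; omega

end SExp

namespace Code

open StackId StackProg SExp

variable {Γ Δ A : Type} [Inhabited A]

/-- Read the input word. -/
def readInput (e : Γ → A) : StackProg (Alph Γ Δ A) :=
  .seq (drain inp fun a => .seq (.push main (some (e a))) (.push cnt ())) <|
    .seq (.push main (some default)) <| drain cnt fun _ => .push main none

theorem runs_readInput (e : Γ → A) (w : List Γ) :
    Runs (readInput e : StackProg (Alph Γ Δ A)) (stk w [] [] [] [] []) (5 * w.length + 3)
      (stk [] [] (word e w).ser [] [] []) := by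
  have h1 := runs_drain_inp (A := A) (o := ([] : List Δ)) (a := []) (b := [])
    (fun d => d.map fun a => some (e a)) (fun d => d.map fun _ => ())
    (fun s _ _ => (runs_push_main (some (e s))).seq runs_push_cnt) w []
  have h2 := runs_drain_cnt (A := A) (i := ([] : List Γ)) (o := ([] : List Δ)) (a := []) (b := [])
    (fun d => d.map (fun _ => none) ++ some default :: (w.map fun a => some (e a)).reverse)
    (fun s _ _ => runs_push_main none) ((w.reverse ++ []).map fun _ => ()) []
  rw [List.append_nil] at h1 h2
  have h3 : (((w.reverse.map fun _ => ()).reverse ++ []).map fun _ => (none : Option A)) =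
      List.replicate w.length none := by simp [List.map_const']
  rw [h3, List.length_map, List.length_reverse] at h2
  rw [ser_word]
  rw [List.map_reverse] at h1
  exact (h1.seq ((runs_push_main (some default)).seq h2)).mono (by omega)

/-- Write the output word. -/
def writeOutput (d : A → Option Δ) : StackProg (Alph Γ Δ A) :=
  .seq (.loop main (fun | some none => false | _ => true) fun _ => .nop) <|
    drain main fun s : Option A => match s.bind d with
      | some y => .push out y
      | none => .nop

/-- Once the marks and the end leaf are gone, the letters are popped from the last to the first, and
pushing them in this order leaves the word upright on `out`. -/
theorem runs_writeOutput {e : Δ → A} {d : A → Option Δ} (hd : ∀ y, d (e y) = some y) (w : List Δ) :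
    Runs (writeOutput d : StackProg (Alph Γ Δ A)) (stk [] [] (word e w).ser [] [] [])
      (4 * w.length + 2) (stk [] w [] [] [] []) := by
  have h1 : ∀ (n : ℕ) (m : List (Option A)), Runs (.loop main (fun | some none => false | _ => true)
      fun _ => .nop : StackProg (Alph Γ Δ A))
      (stk [] [] (List.replicate n none ++ some default :: m) [] [] []) (2 * n + 1)
      (stk [] [] m [] [] []) := by
    intro n m
    induction n with
    | zero => exact runs_loop_main_stop rfl
    | succ n ih => exact (runs_loop_main_step rfl Runs.nop ih).mono (by omega)
  have h2 := runs_drain_main (Γ := Γ) (n := 1)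
    (emit := fun s : Option A => match s.bind d with
      | some y => .push out y
      | none => .nop)
    (fun d' => d'.filterMap fun s : Option A => s.bind d) (fun s w d' => by
      cases hs : s.bind d with
      | none =>
        rw [List.filterMap_cons_none (f := fun s : Option A => s.bind d) hs]; exact Runs.nop
      | some y =>
        rw [List.filterMap_cons_some (f := fun s : Option A => s.bind d) hs]; exact runs_push_out y)
    (w.map fun a => some (e a)).reverse []
  rw [ser_word]
  have h3 : ((w.map fun a => some (e a)).reverse.reverse ++ []).filterMap
      (fun s : Option A => s.bind d) = w := by
    simp [List.filterMap_map, hd]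
  rw [h3] at h2
  refine ((h1 _ _).seq h2).mono ?_
  simp
  omega

/-- A program that reads a word, applies a code and writes the resulting word. -/
def program (c : Code A) (e : Γ → A) (d : A → Option Δ) : StackProg (Alph Γ Δ A) :=
  .seq (readInput e) (.seq (compile c) (writeOutput d))

theorem runs_program {c : Code A} {e : Γ → A} {e' : Δ → A} {d : A → Option Δ}
    (hd : ∀ y, d (e' y) = some y) {w : List Γ} {y : List Δ} (h : eval c (word e w) = word e' y) :
    Runs (program c e d : StackProg (Alph Γ Δ A)) (stk w [] [] [] [] [])
      (5 * w.length + 5 + cost c (word e w) + 2 * (eval c (word e w)).size)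
      (stk [] y [] [] [] []) := by
  have h2 := runs_compile (Γ := Γ) (Δ := Δ) c [] [] (word e w) []
  rw [List.append_nil, List.append_nil, h] at h2
  refine ((runs_readInput e w).seq (h2.seq (runs_writeOutput hd y))).mono ?_
  rw [h, size_word]
  omega

theorem exists_outputs [Fintype Γ] [Fintype Δ] [Fintype A] {c : Code A} {e : Γ → A} {e' : Δ → A}
    {d : A → Option Δ} (hd : ∀ y, d (e' y) = some y) {w : List Γ} {y : List Δ}
    (h : eval c (word e w) = word e' y) {t : ℕ}
    (ht : 5 * w.length + 6 + cost c (word e w) + 2 * (eval c (word e w)).size ≤ t) :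
    Nonempty (Turing.TM2OutputsInTime (toTM2 (program c e d : StackProg (Alph Γ Δ A)) inp out)
      w (some y) t) := by
  obtain ⟨u, hu, hr⟩ := runs_program hd h
  have h1 : Function.update (β := fun k => List (Alph Γ Δ A k)) (fun _ => []) inp w =
      stk w [] [] [] [] [] := by
    funext k; cases k <;> rfl
  have h2 : Function.update (β := fun k => List (Alph Γ Δ A k)) (fun _ => []) out y =
      stk [] y [] [] [] [] := by
    funext k; cases k <;> rfl
  rw [← h1, ← h2] at hr
  exact ⟨⟨⟨u + 1, hr.outputs⟩, by show u + 1 ≤ t; omega⟩⟩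

theorem computableInTime [Fintype Γ] [Fintype Δ] [Fintype A] {α β : Type} {ea : α → List Γ}
    {eb : β → List Δ} {f : α → β} (c : Code A) (e : Γ → A) (e' : Δ → A) (he' : e'.Injective)
    (h : ∀ a, eval c (word e (ea a)) = word e' (eb (f a))) (time : ℕ → ℕ)
    (ht : ∀ a, 5 * (ea a).length + 6 + cost c (word e (ea a)) +
      2 * (eval c (word e (ea a))).size ≤ time (ea a).length) :
    ∃ M : Turing.TM2ComputableInTime ea eb f, M.time = time := by
  classical
  -- A partial inverse of `e'`, which decodes the letters of the output.
  let d : A → Option Δ := fun a => if h : ∃ y, e' y = a then some h.choose else none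
  have hd : ∀ y, d (e' y) = some y := by
    intro y
    have hy : ∃ z, e' z = e' y := ⟨y, rfl⟩
    simp only [d, dif_pos hy]
    exact congrArg some (he' hy.choose_spec)
  refine ⟨⟨⟨toTM2 (program c e d : StackProg (Alph Γ Δ A)) inp out, Equiv.refl _, Equiv.refl _⟩,
    time, fun a => ?_⟩, rfl⟩
  have := (exists_outputs hd (h a) (ht a)).some
  exact Eq.mpr (congrArg₂ (fun x y => Turing.TM2OutputsInTime
    (toTM2 (program c e d : StackProg (Alph Γ Δ A)) inp out) x (some y) (time (ea a).length))
    (List.map_id (ea a)) (List.map_id (eb (f a)))) this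

end Code

/-! ## Polynomial time and exponential time -/

theorem Polynomial.eval_le_eval_of_le (p : Polynomial ℕ) {m n : ℕ} (h : m ≤ n) :
    p.eval m ≤ p.eval n := by
  rw [Polynomial.eval_eq_sum, Polynomial.eval_eq_sum]
  exact Finset.sum_le_sum fun i _ => Nat.mul_le_mul_left _ (Nat.pow_le_pow_left h i)

/-- This is why polynomial-time work on an exponentially large object stays within `2` to a
polynomial. -/
theorem Polynomial.exists_eval_two_pow_le (p : Polynomial ℕ) :
    ∃ q : Polynomial ℕ, ∀ n, p.eval (2 ^ n) ≤ 2 ^ q.eval n := by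
  induction p using Polynomial.induction_on' with
  | add p q hp hq =>
    obtain ⟨p', hp⟩ := hp
    obtain ⟨q', hq⟩ := hq
    refine ⟨p' + q' + 1, fun n => ?_⟩
    rw [Polynomial.eval_add, Polynomial.eval_add, Polynomial.eval_add, Polynomial.eval_one]
    have h1 := Nat.pow_le_pow_right (n := 2) (by norm_num) (Nat.le_add_right (p'.eval n) (q'.eval n))
    have h2 := Nat.pow_le_pow_right (n := 2) (by norm_num) (Nat.le_add_left (q'.eval n) (p'.eval n))
    have := hp n
    have := hq n
    rw [pow_succ]
    omega
  | monomial d c =>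
    refine ⟨Polynomial.C c + Polynomial.C d * Polynomial.X, fun n => ?_⟩
    simp only [Polynomial.eval_monomial, Polynomial.eval_add, Polynomial.eval_C,
      Polynomial.eval_mul, Polynomial.eval_X, pow_add]
    rw [← pow_mul, mul_comm n d]
    exact Nat.mul_le_mul_right _ Nat.lt_two_pow_self.le

namespace SExp

variable {A : Type}

theorem len_le_size (x : SExp A) : x.len ≤ x.size := by
  induction x with
  | atom a => simp [len]
  | node x y _ ih => simp only [len, size]; omega

theorem size_hd_le (x : SExp A) : x.hd.size ≤ x.size := by
  cases x <;> simp only [hd, size] <;> omega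

theorem size_tl_le (x : SExp A) : x.tl.size ≤ x.size := by
  cases x <;> simp only [tl, size] <;> omega

theorem size_hd_tl_le (x : SExp A) : x.hd.size + x.tl.size ≤ x.size + 1 := by
  cases x <;> simp only [hd, tl, size] <;> omega

end SExp

/-! ### Codes of polynomial and of exponential cost -/

namespace Code

open SExp

variable {A : Type}

/-- The size of the result is bounded together with the cost, since a composition charges the outer
code on that result. -/
def PolyTime (c : Code A) : Prop :=
  ∃ p : Polynomial ℕ, ∀ x, cost c x + (eval c x).size ≤ p.eval x.size

def ExpTime (c : Code A) : Prop :=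
  ∃ p : Polynomial ℕ, ∀ x, cost c x + (eval c x).size ≤ 2 ^ p.eval x.size

theorem PolyTime.id : PolyTime (id : Code A) := by
  refine ⟨Polynomial.X + 1, fun x => ?_⟩
  simp [cost, eval, add_comm]

theorem PolyTime.const (a : A) : PolyTime (const a) := by
  refine ⟨6 * Polynomial.X + 4, fun x => ?_⟩
  simp [cost, eval, SExp.size]

theorem PolyTime.hd : PolyTime (hd : Code A) := by
  refine ⟨7 * Polynomial.X + 3, fun x => ?_⟩
  have := size_hd_le x
  simp only [cost, eval, Polynomial.eval_add, Polynomial.eval_mul, Polynomial.eval_X,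
    Polynomial.eval_ofNat]
  omega

theorem PolyTime.tl : PolyTime (tl : Code A) := by
  refine ⟨21 * Polynomial.X + 20, fun x => ?_⟩
  have := size_tl_le x
  simp only [cost, eval, Polynomial.eval_add, Polynomial.eval_mul, Polynomial.eval_X,
    Polynomial.eval_ofNat]
  omega

theorem PolyTime.pair {f g : Code A} (hf : PolyTime f) (hg : PolyTime g) : PolyTime (pair f g) := by
  obtain ⟨p, hp⟩ := hf
  obtain ⟨q, hq⟩ := hg
  refine ⟨31 * p + q + 30 * Polynomial.X + 31, fun x => ?_⟩
  have := hp x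
  have := hq x
  simp only [cost, eval, SExp.size, Polynomial.eval_add, Polynomial.eval_mul, Polynomial.eval_X,
    Polynomial.eval_ofNat]
  omega

theorem PolyTime.comp {f g : Code A} (hf : PolyTime f) (hg : PolyTime g) : PolyTime (comp f g) := by
  obtain ⟨p, hp⟩ := hf
  obtain ⟨q, hq⟩ := hg
  refine ⟨q + p.comp q, fun x => ?_⟩
  have h1 := hq x
  have h2 := (hp (eval g x)).trans (p.eval_le_eval_of_le (Nat.le_of_add_left_le h1))
  simp only [cost, eval, Polynomial.eval_add, Polynomial.eval_comp]
  omega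

theorem PolyTime.cond {p : A → Bool} {f g h : Code A} (hf : PolyTime f) (hg : PolyTime g)
    (hh : PolyTime h) : PolyTime (cond p f g h) := by
  obtain ⟨p, hp⟩ := hf
  obtain ⟨q, hq⟩ := hg
  obtain ⟨r, hr⟩ := hh
  refine ⟨31 * p + q + r + 30 * Polynomial.X + 30, fun x => ?_⟩
  have := hp x
  have := hq x
  have := hr x
  simp only [cost, eval, Polynomial.eval_add, Polynomial.eval_mul, Polynomial.eval_X,
    Polynomial.eval_ofNat]
  split <;> omega

/-- The cost of an iteration in terms of a bound on the sizes of the iterates. -/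
theorem cost_iter_le {f : Code A} {p : Polynomial ℕ}
    (hp : ∀ x, cost f x + (eval f x).size ≤ p.eval x.size) (l a : SExp A) {m : ℕ}
    (hm : ∀ i ≤ l.len, ((eval f)^[i] a).size ≤ m) :
    cost (iter f) (node l a) + (eval (iter f) (node l a)).size ≤
      30 * (l.size + m + 1) + l.size * (p.eval m + 60 * (l.size + m + m + 1)) + m := by
  have h0 := hm 0 (Nat.zero_le _)
  have h1 := hm l.len le_rfl
  have h2 : ∑ i ∈ Finset.range l.len, (cost f ((eval f)^[i] a) +
        60 * (l.size + ((eval f)^[i] a).size + ((eval f)^[i + 1] a).size + 1)) ≤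
      l.len * (p.eval m + 60 * (l.size + m + m + 1)) := by
    refine (Finset.sum_le_card_nsmul _ _ (p.eval m + 60 * (l.size + m + m + 1)) ?_).trans
      (by simp)
    intro i hi
    rw [Finset.mem_range] at hi
    have h3 := hm i hi.le
    have h4 := hm (i + 1) hi
    have h5 := (hp ((eval f)^[i] a)).trans (p.eval_le_eval_of_le h3)
    omega
  have h3 := Nat.mul_le_mul_right (p.eval m + 60 * (l.size + m + m + 1)) l.len_le_size
  simp only [Function.iterate_zero, _root_.id] at h0
  simp only [cost, eval]
  omega

/-- A polynomial-time body does not suffice: doubling the size in each round would be exponential. A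
polynomial bound on all iterates must be supplied. -/
theorem PolyTime.iter {f : Code A} (hf : PolyTime f) (q : Polynomial ℕ)
    (hq : ∀ l a i, i ≤ l.len → ((eval f)^[i] a).size ≤ q.eval (node l a).size) :
    PolyTime (iter f) := by
  obtain ⟨p, hp⟩ := hf
  refine ⟨30 * (Polynomial.X + q + 1) + Polynomial.X * (p.comp q +
    60 * (Polynomial.X + q + q + 1)) + q + 3, fun x => ?_⟩
  cases x with
  | atom a => simp [cost, eval, SExp.size]
  | node l a =>
    refine (cost_iter_le hp l a (hq l a)).trans ?_
    have h : l.size ≤ (node l a).size := by simp only [SExp.size]; omega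
    simp only [Polynomial.eval_add, Polynomial.eval_mul, Polynomial.eval_X, Polynomial.eval_one,
      Polynomial.eval_ofNat, Polynomial.eval_comp]
    exact (Nat.add_le_add_right (Nat.add_le_add (by omega) (Nat.mul_le_mul h (by omega))) _).trans
      (Nat.le_add_right _ _)

/-- Iterating a function that increases the size by an amount depending only on an invariant. -/
theorem PolyTime.iter_of_le_add {f : Code A} (hf : PolyTime f) (κ : SExp A → ℕ) (q : Polynomial ℕ)
    (hκ : ∀ a, κ a ≤ a.size) (hκf : ∀ a, κ (eval f a) ≤ κ a)
    (hq : ∀ a, (eval f a).size ≤ a.size + q.eval (κ a)) : PolyTime (Code.iter f) := by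
  have key : ∀ i a, κ ((eval f)^[i] a) ≤ κ a ∧
      ((eval f)^[i] a).size ≤ a.size + i * q.eval (κ a) := by
    intro i a
    induction i with
    | zero => simp
    | succ i ih =>
      rw [Function.iterate_succ_apply']
      refine ⟨(hκf _).trans ih.1, (hq _).trans ?_⟩
      have := q.eval_le_eval_of_le ih.1
      rw [Nat.succ_mul]
      omega
  refine hf.iter (Polynomial.X + Polynomial.X * q) fun l a i hi => ((key i a).2).trans ?_
  simp only [Polynomial.eval_add, Polynomial.eval_mul, Polynomial.eval_X]
  have h1 := l.len_le_size
  exact Nat.add_le_add (by simp only [SExp.size]; omega) (Nat.mul_le_mul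
    (by simp only [SExp.size]; omega)
    (q.eval_le_eval_of_le ((hκ a).trans (by simp only [SExp.size]; omega))))

/-- Iterating a function that increases the size by a bounded amount. -/
theorem PolyTime.iter_of_le_add_const {f : Code A} (hf : PolyTime f) (n : ℕ)
    (hn : ∀ a, (eval f a).size ≤ a.size + n) : PolyTime (Code.iter f) :=
  hf.iter_of_le_add (fun _ => 0) (Polynomial.C n) (fun _ => Nat.zero_le _) (fun _ => le_rfl)
    (fun a => by simpa using hn a)

theorem size_iterate_le {f : Code A} {n : ℕ} (hn : ∀ a, (eval f a).size ≤ a.size + n) (i : ℕ)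
    (a : SExp A) : ((eval f)^[i] a).size ≤ a.size + i * n := by
  induction i with
  | zero => simp
  | succ i ih =>
    rw [Function.iterate_succ_apply', Nat.succ_mul]
    exact (hn _).trans (by omega)

theorem PolyTime.expTime {f : Code A} (hf : PolyTime f) : ExpTime f := by
  obtain ⟨p, hp⟩ := hf
  exact ⟨p, fun x => (hp x).trans Nat.lt_two_pow_self.le⟩

theorem ExpTime.pair {f g : Code A} (hf : ExpTime f) (hg : ExpTime g) : ExpTime (pair f g) := by
  obtain ⟨p, hp⟩ := hf
  obtain ⟨q, hq⟩ := hg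
  refine ⟨p + q + Polynomial.X + 7, fun x => ?_⟩
  have h1 := hp x
  have h2 := hq x
  simp only [Polynomial.eval_add, Polynomial.eval_X, Polynomial.eval_ofNat]
  have h3 : x.size < 2 ^ x.size := Nat.lt_two_pow_self
  have h4 : ∀ {m}, m ≤ p.eval x.size + q.eval x.size + x.size →
      2 ^ m ≤ 2 ^ (p.eval x.size + q.eval x.size + x.size) :=
    fun h => Nat.pow_le_pow_right (by norm_num) h
  have h5 := h4 (m := x.size) (by omega)
  have h6 := h4 (m := p.eval x.size) (by omega)
  have h7 := h4 (m := q.eval x.size) (by omega)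
  rw [pow_add _ _ 7]
  simp only [cost, eval, SExp.size]
  omega

/-- Two exponential bounds compose to a doubly exponential one, so in this lemma and the next only
one factor is exponential. -/
theorem PolyTime.comp_expTime {f g : Code A} (hf : PolyTime f) (hg : ExpTime g) :
    ExpTime (Code.comp f g) := by
  obtain ⟨p, hp⟩ := hf
  obtain ⟨q, hq⟩ := hg
  obtain ⟨r, hr⟩ := p.exists_eval_two_pow_le
  refine ⟨q + r.comp q + 1, fun x => ?_⟩
  have h1 := hq x
  have h2 := (hp (eval g x)).trans (p.eval_le_eval_of_le (Nat.le_of_add_left_le h1))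
  have h3 := hr (q.eval x.size)
  simp only [cost, eval, Polynomial.eval_add, Polynomial.eval_comp, Polynomial.eval_one]
  have h4 := Nat.pow_le_pow_right (n := 2) (by norm_num)
    (Nat.le_add_right (q.eval x.size) (r.eval (q.eval x.size)))
  have h5 := Nat.pow_le_pow_right (n := 2) (by norm_num)
    (Nat.le_add_left (r.eval (q.eval x.size)) (q.eval x.size))
  rw [pow_succ]
  omega

theorem ExpTime.comp_polyTime {f g : Code A} (hf : ExpTime f) (hg : PolyTime g) :
    ExpTime (Code.comp f g) := by
  obtain ⟨p, hp⟩ := hf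
  obtain ⟨q, hq⟩ := hg
  refine ⟨q + p.comp q + 1, fun x => ?_⟩
  have h1 := hq x
  have h2 := (hp (eval g x)).trans (Nat.pow_le_pow_right (by norm_num)
    (p.eval_le_eval_of_le (Nat.le_of_add_left_le h1)))
  simp only [cost, eval, Polynomial.eval_add, Polynomial.eval_comp, Polynomial.eval_one]
  have h4 := Nat.pow_le_pow_right (n := 2) (by norm_num)
    (Nat.le_add_right (q.eval x.size) (p.eval (q.eval x.size)))
  have h5 := Nat.pow_le_pow_right (n := 2) (by norm_num)
    (Nat.le_add_left (p.eval (q.eval x.size)) (q.eval x.size))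
  have h6 : q.eval x.size < 2 ^ q.eval x.size := Nat.lt_two_pow_self
  rw [pow_succ]
  omega

/-- Iterating a function that at most doubles the size, up to a constant. -/
theorem PolyTime.expTime_iter {f : Code A} (hf : PolyTime f) (n : ℕ)
    (hn : ∀ a, (eval f a).size ≤ 2 * a.size + n) : ExpTime (Code.iter f) := by
  obtain ⟨p, hp⟩ := hf
  -- Adding `n` turns the recursion into plain doubling, because `(2s + n) + n = 2(s + n)`.
  have key : ∀ i a, ((eval f)^[i] a).size + n ≤ 2 ^ i * (a.size + n) := by
    intro i a
    induction i with
    | zero => simp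
    | succ i ih =>
      rw [Function.iterate_succ_apply', pow_succ, mul_comm _ 2, mul_assoc]
      have := hn ((eval f)^[i] a)
      omega
  obtain ⟨r, hr⟩ := (30 * (Polynomial.X + Polynomial.X + 1) + Polynomial.X * (p +
    60 * (Polynomial.X + Polynomial.X + Polynomial.X + 1)) +
      Polynomial.X + 3 : Polynomial ℕ).exists_eval_two_pow_le
  refine ⟨r.comp (2 * Polynomial.X + Polynomial.C n), fun x => ?_⟩
  cases x with
  | atom a =>
    refine le_trans ?_ ((hr _).trans_eq (by rw [Polynomial.eval_comp]))
    simp [cost, eval, SExp.size]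
  | node l a =>
    have hs : (2 : ℕ) ^ l.len * (a.size + n) ≤
        2 ^ ((2 * Polynomial.X + Polynomial.C n : Polynomial ℕ).eval (node l a).size) := by
      have h1 := l.len_le_size
      have h2 : a.size + n < 2 ^ (a.size + n) := Nat.lt_two_pow_self
      refine (Nat.mul_le_mul_left _ h2.le).trans ?_
      rw [← pow_add]
      refine Nat.pow_le_pow_right (by norm_num) ?_
      simp [SExp.size]
      omega
    have hl : l.size ≤
        2 ^ ((2 * Polynomial.X + Polynomial.C n : Polynomial ℕ).eval (node l a).size) := by
      refine le_trans ?_ Nat.lt_two_pow_self.le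
      simp [SExp.size]
      omega
    refine (cost_iter_le hp l a (m := 2 ^ ((2 * Polynomial.X + Polynomial.C n :
      Polynomial ℕ).eval (node l a).size)) fun i hi => ?_).trans ?_
    · have h1 := (key i a).trans (Nat.mul_le_mul_right _ (Nat.pow_le_pow_right (by norm_num) hi))
      omega
    · refine le_trans ?_ ((hr _).trans_eq (by rw [Polynomial.eval_comp]))
      generalize 2 ^ ((2 * Polynomial.X + Polynomial.C n : Polynomial ℕ).eval (node l a).size) = M
        at hl
      simp only [Polynomial.eval_add, Polynomial.eval_mul, Polynomial.eval_X, Polynomial.eval_one,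
        Polynomial.eval_ofNat]
      exact (Nat.add_le_add_right (Nat.add_le_add (by omega) (Nat.mul_le_mul hl (by omega))) _).trans
        (Nat.le_add_right _ _)

end Code

/-! ## List functions -/

namespace SExp

variable {A : Type}

@[simp] theorem hd_node (x y : SExp A) : (node x y).hd = x := rfl
@[simp] theorem tl_node (x y : SExp A) : (node x y).tl = y := rfl
@[simp] theorem hd_atom (a : A) : (atom a).hd = atom a := rfl
@[simp] theorem tl_atom (a : A) : (atom a).tl = atom a := rfl
@[simp] theorem test_atom (p : A → Bool) (a : A) : (atom a).test p = p a := rfl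
@[simp] theorem test_node (p : A → Bool) (x y : SExp A) : (node x y).test p = false := rfl
@[simp] theorem len_node (x y : SExp A) : (node x y).len = y.len + 1 := rfl
@[simp] theorem len_atom (a : A) : (atom a).len = 0 := rfl

@[simp] theorem len_list [Inhabited A] (l : List (SExp A)) : (list l).len = l.length := by
  induction l <;> simp_all

@[simp] theorem tl_list [Inhabited A] (l : List (SExp A)) : (list l).tl = list l.tail := by
  cases l <;> rfl

theorem tl_iterate_list [Inhabited A] (n : ℕ) (l : List (SExp A)) :
    tl^[n] (list l) = list (l.drop n) := by
  induction n generalizing l with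
  | zero => rfl
  | succ n ih => rw [Function.iterate_succ_apply, tl_list, ih, List.drop_tail]

end SExp

namespace Code

open SExp

variable {A : Type}

section
variable (c f g h : Code A) (x y z l : SExp A) (p : A → Bool) (a : A)

@[simp] theorem eval_id : eval id x = x := rfl
@[simp] theorem eval_const : eval (const a) x = atom a := rfl
@[simp] theorem eval_hd : eval hd x = x.hd := rfl
@[simp] theorem eval_tl : eval tl x = x.tl := rfl
@[simp] theorem eval_pair : eval (pair f g) x = node (eval f x) (eval g x) := rfl
@[simp] theorem eval_comp : eval (comp f g) x = eval f (eval g x) := rfl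
@[simp] theorem eval_cond :
    eval (cond p f g h) x = if (eval f x).test p then eval g x else eval h x := rfl
@[simp] theorem eval_iter : eval (iter f) (node l x) = (eval f)^[l.len] x := rfl

end

/-- `node l a` is mapped to the left fold over `l`, starting from `a`. -/
def foldlStep (f : Code A) : Code A := pair (comp tl hd) (comp f (pair (comp hd hd) tl))

def foldl (f : Code A) : Code A := comp tl (comp (iter (foldlStep f)) (pair hd id))

theorem eval_foldl [Inhabited A] (f : Code A) (l : List (SExp A)) (a : SExp A) :
    eval (foldl f) (node (list l) a) = l.foldl (fun a y => eval f (node y a)) a := by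
  have key : ∀ (l : List (SExp A)) (a : SExp A),
      ((eval (foldlStep f))^[l.length] (node (list l) a)).tl =
        l.foldl (fun a y => eval f (node y a)) a := by
    intro l
    induction l with
    | nil => intro a; rfl
    | cons y l ih => intro a; exact ih _
  simpa [foldl] using key l a

theorem size_foldlStep {f : Code A} {n : ℕ}
    (hn : ∀ y a, (eval f (node y a)).size ≤ y.size + a.size + n) (x : SExp A) :
    (eval (foldlStep f) x).size ≤ x.size + (n + 3) := by
  have h1 := hn x.hd.hd x.tl
  have h2 := x.hd.size_hd_tl_le
  have h3 : x.hd.size + x.tl.size + 1 ≤ x.size + 2 := by have := x.size_hd_tl_le; omega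
  simp only [foldlStep, eval_pair, eval_comp, eval_tl, eval_hd, SExp.size]
  omega

theorem PolyTime.foldl {f : Code A} (hf : PolyTime f) (n : ℕ)
    (hn : ∀ y a, (eval f (node y a)).size ≤ y.size + a.size + n) : PolyTime (foldl f) :=
  PolyTime.tl.comp ((PolyTime.iter_of_le_add_const ((PolyTime.tl.comp .hd).pair
    (hf.comp ((PolyTime.hd.comp .hd).pair .tl))) (n + 3) (size_foldlStep hn)).comp
      (PolyTime.hd.pair .id))

/-- `node l m` is mapped to the reversal of `l`, followed by `m`. -/
def revAppend : Code A := foldl id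

@[simp] theorem eval_revAppend [Inhabited A] (l m : List (SExp A)) :
    eval revAppend (node (list l) (list m)) = list (l.reverse ++ m) := by
  rw [revAppend, eval_foldl]
  induction l generalizing m with
  | nil => rfl
  | cons x l ih => simpa using ih (x :: m)

theorem PolyTime.revAppend : PolyTime (revAppend : Code A) :=
  PolyTime.foldl .id 1 fun y a => by simp only [eval_id, SExp.size]; omega

theorem size_revAppend_le (l m : SExp A) :
    (eval revAppend (node l m)).size ≤ l.size + m.size := by
  change ((eval (foldlStep Code.id))^[l.len] (node l m)).tl.size ≤ l.size + m.size
  induction l generalizing m with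
  | atom a => simp
  | node x l _ ih =>
    have h1 : eval (foldlStep Code.id) (node (node x l) m) = node l (node x m) := rfl
    rw [len_node, Function.iterate_succ_apply, h1]
    refine (ih _).trans ?_
    simp only [SExp.size]
    omega

def reverse [Inhabited A] : Code A := comp revAppend (pair id (const default))

@[simp] theorem eval_reverse [Inhabited A] (l : List (SExp A)) :
    eval reverse (list l) = list l.reverse := by
  have := eval_revAppend l []
  rw [List.append_nil] at this
  simpa [reverse] using this

theorem PolyTime.reverse [Inhabited A] : PolyTime (reverse : Code A) :=
  PolyTime.revAppend.comp (PolyTime.id.pair (.const _))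

/-- The number `k` in unary. -/
def _root_.SExp.unary [Inhabited A] (k : ℕ) : SExp A := list (List.replicate k (atom default))

/-- Extend the list `m` in `node l m` by as many elements as `l` has. -/
def extend [Inhabited A] : Code A := iter (pair (const default) id)

theorem eval_extend [Inhabited A] (l m : SExp A) :
    eval extend (node l m) = (node (atom default))^[l.len] m := rfl

theorem len_extend [Inhabited A] (l m : SExp A) :
    (eval extend (node l m)).len = l.len + m.len := by
  rw [eval_extend]
  induction l.len with
  | zero => simp
  | succ n ih => rw [Function.iterate_succ_apply', len_node, ih]; omega

theorem eval_extend_unary [Inhabited A] (l : SExp A) (k : ℕ) :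
    eval extend (node l (unary k)) = unary (l.len + k) := by
  rw [eval_extend]
  induction l.len with
  | zero => simp
  | succ n ih => rw [Function.iterate_succ_apply', ih, Nat.succ_add]; rfl

theorem size_extend [Inhabited A] (l m : SExp A) :
    (eval extend (node l m)).size = 2 * l.len + m.size := by
  rw [eval_extend]
  induction l.len with
  | zero => simp
  | succ n ih => rw [Function.iterate_succ_apply', SExp.size, ih, SExp.size]; omega

theorem PolyTime.extend [Inhabited A] : PolyTime (extend : Code A) :=
  PolyTime.iter_of_le_add_const ((PolyTime.const _).pair .id) 2 fun a => by
    simp only [eval_pair, eval_const, eval_id, SExp.size]; omega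

/-- Drop the first elements of `m` in `node i m`, as many as `i` has. -/
def dropN : Code A := iter tl

@[simp] theorem eval_dropN [Inhabited A] (i : SExp A) (m : List (SExp A)) :
    eval dropN (node i (list m)) = list (m.drop i.len) := tl_iterate_list _ _

theorem size_dropN_le (i m : SExp A) : (eval dropN (node i m)).size ≤ m.size := by
  have := size_iterate_le (f := (tl : Code A)) (n := 0) size_tl_le i.len m
  simpa [dropN] using this

theorem PolyTime.dropN : PolyTime (dropN : Code A) :=
  PolyTime.iter_of_le_add_const .tl 0 size_tl_le

/-- The element of `m` at position `i`, applied to `node i m`. -/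
def get : Code A := comp hd dropN

theorem eval_get [Inhabited A] (i : SExp A) (m : List (SExp A)) {x : SExp A}
    (h : m[i.len]? = some x) : eval get (node i (list m)) = x := by
  rw [get, eval_comp, eval_dropN]
  obtain ⟨h1, rfl⟩ := List.getElem?_eq_some_iff.1 h
  rw [List.drop_eq_getElem_cons h1]
  rfl

theorem PolyTime.get : PolyTime (get : Code A) := PolyTime.hd.comp .dropN

/-- Move one element from the list `m` to the list `l` in `node l m`. -/
def move : Code A := pair (pair (comp hd tl) hd) (comp tl tl)

theorem size_move_le (x : SExp A) : (eval move x).size ≤ x.size + 4 := by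
  have h1 := x.size_hd_tl_le
  have h2 := x.tl.size_hd_tl_le
  simp only [move, eval_pair, eval_comp, eval_tl, eval_hd, SExp.size]
  omega

/-- Applied to `node i (node v m)`: replace the element of `m` at position `i` by `v`. -/
def set [Inhabited A] : Code A :=
  comp (comp revAppend (pair (comp hd tl) (pair hd (comp tl (comp tl tl)))))
    (pair (comp hd tl) (comp (iter move) (pair hd (pair (const default) (comp tl tl)))))

theorem eval_set [Inhabited A] (i v : SExp A) (m : List (SExp A)) (h : i.len < m.length) :
    eval set (node i (node v (list m))) = list (m.set i.len v) := by
  -- Moving elements one at a time leaves the prefix reversed, which is what `revAppend` undoes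
  -- after the exchange of one element.
  have key : ∀ (n : ℕ) (l m : List (SExp A)), n ≤ m.length →
      (eval move)^[n] (node (list l) (list m)) =
        node (list ((m.take n).reverse ++ l)) (list (m.drop n)) := by
    intro n
    induction n with
    | zero => intro l m _; simp
    | succ n ih =>
      intro l m hm
      cases m with
      | nil => simp at hm
      | cons x m =>
        have h1 : eval move (node (list l) (list (x :: m))) = node (list (x :: l)) (list m) := rfl
        rw [Function.iterate_succ_apply, h1, ih _ _ (by simpa using hm)]
        simp
  have h2 := key i.len [] m h.le
  rw [List.append_nil, list_nil] at h2
  simp only [set, eval_comp, eval_pair, eval_hd, eval_tl, eval_const, hd_node, tl_node, eval_iter,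
    h2, tl_list]
  rw [← list_cons, eval_revAppend, List.reverse_reverse, List.tail_drop,
    List.set_eq_take_append_cons_drop, if_pos h]

theorem size_set_le [Inhabited A] (i v m : SExp A) :
    (eval set (node i (node v m))).size ≤ m.size + v.size + 4 * i.size + 4 := by
  simp only [set, eval_comp, eval_pair, eval_hd, eval_tl, eval_const, hd_node, tl_node, eval_iter]
  have h1 := size_iterate_le (f := (move : Code A)) size_move_le i.len (node (atom default) m)
  have h2 := i.len_le_size
  generalize (eval move)^[i.len] (node (atom default) m) = s at h1
  have h3 := s.size_hd_tl_le
  have h4 := s.tl.size_tl_le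
  refine (size_revAppend_le _ _).trans ?_
  simp only [SExp.size] at h1 ⊢
  cases s with
  | atom a => simp only [hd_atom, tl_atom, SExp.size] at *; have := m.size_pos; omega
  | node x y => simp only [hd_node, tl_node, SExp.size] at *; omega

theorem PolyTime.set [Inhabited A] : PolyTime (set : Code A) :=
  (PolyTime.revAppend.comp ((PolyTime.hd.comp .tl).pair (PolyTime.hd.pair
    (PolyTime.tl.comp (PolyTime.tl.comp .tl))))).comp ((PolyTime.hd.comp .tl).pair
      ((PolyTime.iter_of_le_add_const (((PolyTime.hd.comp .tl).pair .hd).pair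
        (PolyTime.tl.comp .tl)) 4 size_move_le).comp
          (PolyTime.hd.pair ((PolyTime.const _).pair (PolyTime.tl.comp .tl)))))

end Code

/-! ## Arithmetic on bit lists -/

/-- The value of a bit list, least significant bit first. -/
def bval : List Bool → ℕ
  | [] => 0
  | b :: l => b.toNat + 2 * bval l

theorem bval_eq_head_add_tail (l : List Bool) :
    bval l = (l.headD false).toNat + 2 * bval l.tail := by
  cases l <;> rfl

theorem bval_lt (l : List Bool) : bval l < 2 ^ l.length := by
  induction l with
  | nil => simp [bval]
  | cons b l ih =>
    rw [bval, List.length_cons, pow_succ]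
    have := Bool.toNat_le b
    omega

theorem bval_encodePosNum (n : PosNum) : bval (Computability.encodePosNum n) = n := by
  induction n with
  | one => rfl
  | bit1 n ih =>
    rw [Computability.encodePosNum, bval, ih, PosNum.cast_bit1, Bool.toNat_true]; omega
  | bit0 n ih => rw [Computability.encodePosNum, bval, ih, PosNum.cast_bit0, Bool.toNat_false]; omega

theorem bval_encodeNat (k : ℕ) : bval (Computability.encodeNat k) = k := by
  conv_rhs => rw [← Num.to_of_nat k]
  unfold Computability.encodeNat
  cases (k : Num) with
  | zero => rfl
  | pos n => exact bval_encodePosNum n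

/-- Bitwise addition or subtraction with the carry function `F`. -/
def aluOut (F : Bool → Bool → Bool → Bool) : ℕ → List Bool → List Bool → Bool → List Bool
  | 0, _, _, _ => []
  | n + 1, a, b, c => (a.headD false ^^ (b.headD false ^^ c)) ::
      aluOut F n a.tail b.tail (F (a.headD false) (b.headD false) c)

def aluCarry (F : Bool → Bool → Bool → Bool) : ℕ → List Bool → List Bool → Bool → Bool
  | 0, _, _, c => c
  | n + 1, a, b, c => aluCarry F n a.tail b.tail (F (a.headD false) (b.headD false) c)

theorem length_aluOut (F n a b c) : (aluOut F n a b c).length = n := by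
  induction n generalizing a b c with
  | zero => rfl
  | succ n ih => rw [aluOut, List.length_cons, ih]

def addCarry (a b c : Bool) : Bool := (a && b) || (a && c) || (b && c)

def subCarry (a b c : Bool) : Bool := (!a && b) || (!a && c) || (b && c)

theorem bval_add {n : ℕ} {a b : List Bool} (c : Bool) (ha : a.length ≤ n) (hb : b.length ≤ n) :
    bval (aluOut addCarry n a b c) + 2 ^ n * (aluCarry addCarry n a b c).toNat =
      bval a + bval b + c.toNat := by
  induction n generalizing a b c with
  | zero =>
    rw [Nat.le_zero, List.length_eq_zero_iff] at ha hb
    subst ha hb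
    simp [aluOut, aluCarry, bval]
  | succ n ih =>
    have h := ih (a := a.tail) (b := b.tail) (addCarry (a.headD false) (b.headD false) c)
      (by simp; omega) (by simp; omega)
    rw [aluOut, aluCarry, bval, bval_eq_head_add_tail a, bval_eq_head_add_tail b, pow_succ]
    generalize aluCarry addCarry n a.tail b.tail _ = d at *
    generalize a.headD false = x at *
    generalize b.headD false = y at *
    cases d <;> cases x <;> cases y <;> cases c <;> simp [addCarry] at h ⊢ <;> omega

/-- The digits of a difference are the same exclusive-or as those of a sum; only the rule for the
carry changes. One code thus serves addition, subtraction and comparison. -/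
theorem bval_sub {n : ℕ} {a b : List Bool} (c : Bool) (ha : a.length ≤ n) (hb : b.length ≤ n) :
    bval (aluOut subCarry n a b c) + bval b + c.toNat =
      bval a + 2 ^ n * (aluCarry subCarry n a b c).toNat := by
  induction n generalizing a b c with
  | zero =>
    rw [Nat.le_zero, List.length_eq_zero_iff] at ha hb
    subst ha hb
    simp [aluOut, aluCarry, bval]
  | succ n ih =>
    have h := ih (a := a.tail) (b := b.tail) (subCarry (a.headD false) (b.headD false) c)
      (by simp; omega) (by simp; omega)
    rw [aluOut, aluCarry, bval, bval_eq_head_add_tail a, bval_eq_head_add_tail b, pow_succ]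
    generalize aluCarry subCarry n a.tail b.tail _ = d at *
    generalize a.headD false = x at *
    generalize b.headD false = y at *
    cases d <;> cases x <;> cases y <;> cases c <;> simp [subCarry] at h ⊢ <;> omega

theorem bval_aluOut_add {n : ℕ} {a b : List Bool} (ha : a.length ≤ n) (hb : b.length ≤ n)
    (h : bval a + bval b < 2 ^ n) : bval (aluOut addCarry n a b false) = bval a + bval b := by
  have := bval_add false ha hb
  cases hc : aluCarry addCarry n a b false <;> rw [hc] at this <;> simp at this <;> omega

/-- The output bits represent a number below `2 ^ n`, so the identity `bval_sub` leaves only one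
value for the final borrow. Tests are decided by it. -/
theorem aluCarry_sub {n : ℕ} {a b : List Bool} (ha : a.length ≤ n) (hb : b.length ≤ n) :
    aluCarry subCarry n a b false = decide (bval a < bval b) := by
  have := bval_sub false ha hb
  have h2 := bval_lt (aluOut subCarry n a b false)
  rw [length_aluOut] at h2
  cases hc : aluCarry subCarry n a b false <;> rw [hc] at this <;> simp at this <;>
    simp <;> omega

theorem bval_aluOut_sub {n : ℕ} {a b : List Bool} (ha : a.length ≤ n) (hb : b.length ≤ n)
    (h : bval b ≤ bval a) : bval (aluOut subCarry n a b false) = bval a - bval b := by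
  have := bval_sub false ha hb
  rw [aluCarry_sub ha hb, decide_eq_false (by omega)] at this
  simp at this
  omega

/-! ## Interpreting counter programs -/

/-- With this default leaf, `const .comma` is at once the empty list, the number zero in unary and
in binary, and a leaf that reads as the bit `false`. Bit lists are thereby padded with zeros. -/
instance : Inhabited CPSym := ⟨.comma⟩

namespace Code

open SExp

/-- A Boolean function of three bits. -/
def bool3 (F : Bool → Bool → Bool → Bool) (f g h : Code CPSym) : Code CPSym :=
  let ite (x y z : Code CPSym) := cond (fun a => a = .bit true) x y z
  let row (a : Bool) := ite g (ite h (const (.bit (F a true true))) (const (.bit (F a true false))))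
    (ite h (const (.bit (F a false true))) (const (.bit (F a false false))))
  ite f (row true) (row false)

/-- The bit at a leaf. -/
def _root_.SExp.bit (x : SExp CPSym) : Bool := x.test fun a => a = .bit true

@[simp] theorem _root_.SExp.bit_atom (b : Bool) : (atom (CPSym.bit b)).bit = b := by
  cases b <;> simp [SExp.bit]

theorem eval_bool3 (F : Bool → Bool → Bool → Bool) (f g h : Code CPSym) (x : SExp CPSym) :
    eval (bool3 F f g h) x =
      atom (.bit (F (eval f x).bit (eval g x).bit (eval h x).bit)) := by
  simp only [bool3, eval_cond, eval_const, ← SExp.bit.eq_1]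
  cases (eval f x).bit <;> cases (eval g x).bit <;> cases (eval h x).bit <;> rfl

theorem PolyTime.bool3 {F : Bool → Bool → Bool → Bool} {f g h : Code CPSym} (hf : PolyTime f)
    (hg : PolyTime g) (hh : PolyTime h) : PolyTime (bool3 F f g h) := by
  have h1 : ∀ a : Bool, PolyTime (Code.const (CPSym.bit a)) := fun _ => .const _
  exact PolyTime.cond hf (.cond hg (.cond hh (h1 _) (h1 _)) (.cond hh (h1 _) (h1 _)))
    (.cond hg (.cond hh (h1 _) (h1 _)) (.cond hh (h1 _) (h1 _)))

/-- One step of `alu`, on states `node a (node b (node carry out))`. -/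
def aluStep (F : Bool → Bool → Bool → Bool) : Code CPSym :=
  let a := comp hd hd
  let b := comp hd (comp hd tl)
  let c := comp hd (comp tl tl)
  pair (comp tl hd) (pair (comp tl (comp hd tl))
    (pair (bool3 F a b c) (pair (bool3 (fun x y z => x ^^ (y ^^ z)) a b c)
      (comp tl (comp tl tl)))))

/-- Applied to `node l (node a b)`, where the length of `l` gives the number of bits: the final
carry and the resulting bits. -/
def alu (F : Bool → Bool → Bool → Bool) : Code CPSym :=
  comp (pair (comp hd (comp tl tl)) (comp reverse (comp tl (comp tl tl))))
    (comp (iter (aluStep F)) (pair hd (pair (comp hd tl) (pair (comp tl tl)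
      (pair (const (.bit false)) (const .comma))))))

/-- A list of bits. -/
abbrev _root_.SExp.bits (l : List Bool) : SExp CPSym := word CPSym.bit l

theorem _root_.SExp.bit_hd_bits (l : List Bool) : (bits l).hd.bit = l.headD false := by
  cases l with
  | nil => rfl
  | cons b l => exact SExp.bit_atom b

theorem _root_.SExp.tl_bits (l : List Bool) : (bits l).tl = bits l.tail := by
  cases l <;> rfl

theorem eval_aluStep (F : Bool → Bool → Bool → Bool) (a b : List Bool) (c : Bool)
    (o : SExp CPSym) :
    eval (aluStep F) (node (bits a) (node (bits b) (node (atom (.bit c)) o))) =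
      node (bits a.tail) (node (bits b.tail) (node (atom (.bit (F (a.headD false) (b.headD false) c)))
        (node (atom (.bit (a.headD false ^^ (b.headD false ^^ c)))) o))) := by
  simp only [aluStep, eval_pair, eval_comp, eval_hd, eval_tl, hd_node, tl_node, eval_bool3,
    bit_hd_bits, tl_bits, bit_atom]

theorem eval_alu (F : Bool → Bool → Bool → Bool) (l : SExp CPSym) (a b : List Bool) :
    eval (alu F) (node l (node (bits a) (bits b))) =
      node (atom (.bit (aluCarry F l.len a b false))) (bits (aluOut F l.len a b false)) := by
  have key : ∀ (n : ℕ) (a b : List Bool) (c : Bool) (o : List Bool), ∃ a' b' : SExp CPSym,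
      (eval (aluStep F))^[n] (node (bits a) (node (bits b) (node (atom (.bit c)) (bits o)))) =
        node a' (node b' (node (atom (.bit (aluCarry F n a b c)))
          (bits ((aluOut F n a b c).reverse ++ o)))) := by
    intro n
    induction n with
    | zero => intro a b c o; exact ⟨_, _, rfl⟩
    | succ n ih =>
      intro a b c o
      rw [Function.iterate_succ_apply, eval_aluStep]
      obtain ⟨a', b', h⟩ := ih a.tail b.tail (F (a.headD false) (b.headD false) c)
        ((a.headD false ^^ (b.headD false ^^ c)) :: o)
      exact ⟨a', b', h.trans (by simp [aluOut, aluCarry])⟩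
  obtain ⟨a', b', h⟩ := key l.len a b false []
  rw [List.append_nil] at h
  have h0 : atom CPSym.comma = bits [] := rfl
  simp only [alu, eval_pair, eval_comp, eval_hd, eval_tl, hd_node, tl_node, eval_iter, eval_const]
  rw [h0, h]
  simp only [hd_node, tl_node, bits, word, eval_reverse, ← List.map_reverse, List.reverse_reverse]

theorem size_bool3 (F : Bool → Bool → Bool → Bool) (f g h : Code CPSym) (x : SExp CPSym) :
    (eval (bool3 F f g h) x).size = 1 := by rw [eval_bool3, SExp.size]

theorem size_aluStep_le (F : Bool → Bool → Bool → Bool) (x : SExp CPSym) :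
    (eval (aluStep F) x).size ≤ x.size + 8 := by
  have h1 := x.size_hd_tl_le
  have h2 := x.tl.size_hd_tl_le
  have h3 := x.hd.size_tl_le
  have h4 := x.tl.hd.size_tl_le
  have h5 := x.tl.tl.size_tl_le
  simp only [aluStep, eval_pair, eval_comp, eval_tl, eval_hd, SExp.size, size_bool3]
  omega

theorem size_tl_alu_le (F : Bool → Bool → Bool → Bool) (l x y : SExp CPSym) :
    (eval (alu F) (node l (node x y))).tl.size ≤ 2 * l.size + 2 := by
  have key : ∀ (n : ℕ) (s : SExp CPSym), ((eval (aluStep F))^[n] s).tl.tl.tl.size ≤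
      s.tl.tl.tl.size + 2 * n := by
    intro n s
    induction n with
    | zero => simp
    | succ n ih =>
      rw [Function.iterate_succ_apply']
      simp only [aluStep, eval_pair, eval_comp, eval_tl, eval_hd, tl_node, SExp.size,
        size_bool3] at ih ⊢
      omega
  have h := key l.len (node x (node y (node (atom (.bit false)) (atom .comma))))
  simp only [tl_node, SExp.size] at h
  have h1 := l.len_le_size
  simp only [alu, eval_pair, eval_comp, eval_hd, eval_tl, hd_node, tl_node, eval_iter, eval_const,
    reverse, eval_id]
  refine (size_revAppend_le _ _).trans ?_
  simp only [SExp.size]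
  omega

theorem PolyTime.aluStep (F : Bool → Bool → Bool → Bool) : PolyTime (aluStep F) := by
  rw [Code.aluStep]
  simp (maxDischargeDepth := 30) only [PolyTime.pair, PolyTime.comp, PolyTime.hd, PolyTime.tl,
    PolyTime.bool3]

theorem PolyTime.alu (F : Bool → Bool → Bool → Bool) : PolyTime (alu F) := by
  have h := PolyTime.iter_of_le_add_const (.aluStep F) 8 (size_aluStep_le F)
  rw [Code.alu]
  simp (maxDischargeDepth := 30) only [h, PolyTime.pair, PolyTime.comp, PolyTime.hd, PolyTime.tl, PolyTime.const,
    PolyTime.reverse]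

end Code

/-! ### The interpreter of a single instruction -/

namespace Code

open SExp

/-- The rest of the program from the current instruction on; the interpreter works on states
`node (node width instrs) (node pc mem)`. -/
def rest : Code CPSym := comp dropN (pair (comp hd tl) (comp tl hd))

def curArg : ℕ → Code CPSym
  | 0 => comp hd rest
  | n + 1 => comp tl (curArg n)

/-- The value of the counter named by the argument `n` of the current instruction. -/
def counter (n : ℕ) : Code CPSym := comp get (pair (comp hd (curArg n)) (comp tl tl))

def nextPc : Code CPSym := pair (const .comma) (comp hd tl)

def execArith (F : Bool → Bool → Bool → Bool) : Code CPSym :=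
  pair hd (pair nextPc (comp set (pair (comp hd (curArg 1)) (pair
    (comp tl (comp (alu F) (pair (comp hd hd) (pair (counter 2) (counter 3))))) (comp tl tl)))))

/-- A final borrow means that the first counter is smaller, so in that case the test fails and
execution goes on to the next instruction. -/
def execTest : Code CPSym :=
  pair hd (pair (cond (fun a => a = .bit true)
    (comp hd (comp (alu subCarry) (pair (comp hd hd) (pair (counter 1) (counter 2)))))
      nextPc (comp hd (curArg 3))) (comp tl tl))

/-- One step of the interpreter. -/
def execStep : Code CPSym :=
  -- The predicate accepts every leaf, and the rest of the program is a leaf exactly when `halt` has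
  -- been reached; the state is then kept.
  cond (fun _ => true) rest id (cond (fun a => a = .add) (comp hd (curArg 0)) (execArith addCarry)
    (cond (fun a => a = .sub) (comp hd (curArg 0)) (execArith subCarry) execTest))

theorem PolyTime.curArg (n : ℕ) : PolyTime (curArg n) := by
  have h : PolyTime rest := PolyTime.dropN.comp ((PolyTime.hd.comp .tl).pair (PolyTime.tl.comp .hd))
  induction n with
  | zero => exact PolyTime.hd.comp h
  | succ n ih => exact PolyTime.tl.comp ih

theorem PolyTime.counter (n : ℕ) : PolyTime (counter n) :=
  PolyTime.get.comp ((PolyTime.hd.comp (.curArg n)).pair (PolyTime.tl.comp .tl))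

theorem PolyTime.nextPc : PolyTime nextPc := (PolyTime.const _).pair (PolyTime.hd.comp .tl)

theorem PolyTime.execArith (F : Bool → Bool → Bool → Bool) : PolyTime (execArith F) := by
  rw [Code.execArith]
  simp (maxDischargeDepth := 30) only [PolyTime.pair, PolyTime.comp, PolyTime.hd, PolyTime.tl,
    PolyTime.set, PolyTime.alu, PolyTime.nextPc, PolyTime.curArg, PolyTime.counter]

theorem PolyTime.execStep : PolyTime execStep := by
  have h : PolyTime rest := PolyTime.dropN.comp ((PolyTime.hd.comp .tl).pair (PolyTime.tl.comp .hd))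
  rw [Code.execStep, Code.execTest]
  simp (maxDischargeDepth := 30) only [PolyTime.pair, PolyTime.comp, PolyTime.hd, PolyTime.tl,
    PolyTime.id, PolyTime.cond, h, PolyTime.execArith, PolyTime.alu, PolyTime.nextPc,
    PolyTime.curArg, PolyTime.counter]

theorem size_curArg_le (n : ℕ) (x : SExp CPSym) : (eval (curArg n) x).size ≤ x.hd.size := by
  induction n with
  | zero =>
    exact (size_hd_le _).trans ((size_dropN_le _ _).trans (size_tl_le _))
  | succ n ih => exact (size_tl_le _).trans ih

theorem size_nextPc (x : SExp CPSym) : (eval nextPc x).size = x.tl.hd.size + 2 := by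
  simp only [nextPc, eval_pair, eval_const, eval_comp, eval_hd, eval_tl, SExp.size]
  omega

theorem size_execArith_le (F : Bool → Bool → Bool → Bool) (x : SExp CPSym) :
    (eval (execArith F) x).size ≤ x.size + 6 * x.hd.size + 20 := by
  have h1 := x.size_hd_tl_le
  have h2 := x.tl.size_hd_tl_le
  have h3 := size_nextPc x
  have h4 := (size_hd_le (eval (curArg 1) x)).trans (size_curArg_le 1 x)
  have h5 := size_tl_alu_le F x.hd.hd (eval (counter 2) x) (eval (counter 3) x)
  have h6 := x.hd.size_hd_le
  have h7 := size_set_le (eval (curArg 1) x).hd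
    (eval (alu F) (node x.hd.hd (node (eval (counter 2) x) (eval (counter 3) x)))).tl x.tl.tl
  simp only [execArith, eval_pair, eval_comp, eval_hd, eval_tl, SExp.size]
  omega

theorem size_execTest_le (x : SExp CPSym) :
    (eval execTest x).size ≤ x.size + 6 * x.hd.size + 20 := by
  have h1 := x.size_hd_tl_le
  have h2 := x.tl.size_hd_tl_le
  have h3 := size_nextPc x
  have h4 := (size_hd_le (eval (curArg 3) x)).trans (size_curArg_le 3 x)
  simp only [execTest, eval_pair, eval_cond]
  split <;> simp only [eval_comp, eval_hd, eval_tl, SExp.size] <;> omega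

/-- A new value has as many bits as the width, and a jump target is copied from the program. Both
lie in `x.hd`, which never changes by `hd_execStep`. Growth per step is thus controlled by an
invariant, and iterating stays polynomial. -/
theorem size_execStep_le (x : SExp CPSym) :
    (eval execStep x).size ≤ x.size + 6 * x.hd.size + 20 := by
  have h1 := size_execArith_le addCarry x
  have h2 := size_execArith_le subCarry x
  have h3 := size_execTest_le x
  simp only [execStep, eval_cond, eval_id]
  split
  · omega
  · split
    · exact h1
    · split
      · exact h2
      · exact h3

theorem hd_execStep (x : SExp CPSym) : (eval execStep x).hd = x.hd := by
  simp only [execStep, eval_cond, eval_id, execArith, execTest, eval_pair, eval_hd]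
  split
  · rfl
  · split
    · rfl
    · split <;> rfl

theorem PolyTime.iter_execStep : PolyTime (Code.iter Code.execStep) :=
  PolyTime.execStep.iter_of_le_add (fun a => a.hd.size) (6 * Polynomial.X + 20)
    (fun a => a.size_hd_le) (fun a => by rw [hd_execStep]) (fun a => by
      have := size_execStep_le a
      simp only [Polynomial.eval_add, Polynomial.eval_mul, Polynomial.eval_X, Polynomial.eval_ofNat]
      omega)

end Code

namespace CPInstr

open SExp

def toSExp {n m : ℕ} : CPInstr n m → SExp CPSym
  | add i j k => list [atom .add, unary i, unary j, unary k]
  | sub i j k => list [atom .sub, unary i, unary j, unary k]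
  | test i j t => list [atom .test, unary i, unary j, unary t]

end CPInstr

namespace CounterProgram

open SExp Code

variable (P : CounterProgram)

theorem _root_.SExp.len_unary {A : Type} [Inhabited A] (k : ℕ) : (unary k : SExp A).len = k := by
  simp [unary]

/-- `s` represents the configuration `c`, with counters of at most `W.len` bits. -/
def Represents (W : SExp CPSym) (c : P.Cfg) (s : SExp CPSym) : Prop :=
  ∃ m : List (List Bool), m.length = P.n ∧
    (∀ (i : Fin P.n), ∃ b, m[(i : ℕ)]? = some b ∧ b.length ≤ W.len ∧ (bval b : ℤ) = c.val i) ∧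
    s = node (node W (list ((List.ofFn P.instr).map CPInstr.toSExp)))
      (node (unary c.pc) (list (m.map bits)))

variable {P}

theorem eval_rest {W : SExp CPSym} {c : P.Cfg} {s : SExp CPSym} (h : P.Represents W c s) :
    eval rest s = list (((List.ofFn P.instr).map CPInstr.toSExp).drop c.pc) := by
  obtain ⟨m, -, -, rfl⟩ := h
  simp only [rest, eval_comp, eval_pair, eval_hd, eval_tl, hd_node, tl_node, eval_dropN, len_unary]

theorem eval_rest_of_lt {W : SExp CPSym} {c : P.Cfg} {s : SExp CPSym} (h : P.Represents W c s)
    (hc : (c.pc : ℕ) < P.len) :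
    ∃ y, eval rest s = node (P.instr ⟨c.pc, hc⟩).toSExp y := by
  rw [eval_rest h, List.drop_eq_getElem_cons (by simpa using hc)]
  simp

theorem eval_execStep_halt {W : SExp CPSym} {c : P.Cfg} {s : SExp CPSym} (h : P.Represents W c s)
    (hc : ¬ (c.pc : ℕ) < P.len) : eval execStep s = s := by
  have h1 : eval rest s = atom .comma := by
    rw [eval_rest h, List.drop_of_length_le (by simpa using hc)]
    rfl
  simp [execStep, h1]

theorem represents_update {W : SExp CPSym} {c : P.Cfg} {m : List (List Bool)}
    (hm : m.length = P.n)
    (hb : ∀ (i : Fin P.n), ∃ b, m[(i : ℕ)]? = some b ∧ b.length ≤ W.len ∧ (bval b : ℤ) = c.val i)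
    (i : Fin P.n) (b : List Bool) (hbl : b.length ≤ W.len) (k : ℕ) (q : Fin (P.len + 1))
    (hq : (q : ℕ) = k) (v : ℤ) (hv : (bval b : ℤ) = v) :
    P.Represents W ⟨q, Function.update c.val i v⟩
      (node (node W (list ((List.ofFn P.instr).map CPInstr.toSExp)))
        (node (unary k) (list ((m.map bits).set i (bits b))))) := by
  refine ⟨m.set i b, by simpa using hm, fun j => ?_, ?_⟩
  · by_cases hj : j = i
    · subst hj
      exact ⟨b, by rw [List.getElem?_set_self (by rw [hm]; exact j.2)], hbl, by simpa using hv⟩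
    · rw [List.getElem?_set_ne (fun h => hj (Fin.ext h.symm))]
      simpa [hj] using hb j
  · rw [hq, ← List.map_set]

/-- The conditions on the next configuration are what exact fixed-width arithmetic needs: the upper
bound rules out an overflow in an addition, and non-negativity a final borrow in a subtraction. -/
theorem Represents.step {W : SExp CPSym} {c : P.Cfg} {s : SExp CPSym} (h : P.Represents W c s)
    (h0 : ∀ i, 0 ≤ (P.step c).val i) (hW : ∀ i, (P.step c).val i < 2 ^ W.len) :
    P.Represents W (P.step c) (eval execStep s) := by
  by_cases hc : (c.pc : ℕ) < P.len
  · obtain ⟨y, hy⟩ := eval_rest_of_lt h hc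
    obtain ⟨m, hm, hb, hs⟩ := h
    have hget : ∀ i : Fin P.n, eval get (node (unary i) (list (m.map bits))) =
        bits (m[(i : ℕ)]'(by rw [hm]; exact i.2)) := by
      intro i
      refine eval_get _ _ ?_
      have hi : (i : ℕ) < m.length := by rw [hm]; exact i.2
      rw [len_unary, List.getElem?_map, List.getElem?_eq_getElem hi]
      rfl
    have hbits : ∀ i : Fin P.n, ∃ b : List Bool, eval get (node (unary i) (list (m.map bits))) =
        bits b ∧ b.length ≤ W.len ∧ (bval b : ℤ) = c.val i := by
      intro i
      obtain ⟨b, h1, h2, h3⟩ := hb i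
      obtain ⟨h4, rfl⟩ := List.getElem?_eq_some_iff.1 h1
      exact ⟨_, hget i, h2, h3⟩
    have hset : ∀ (i : Fin P.n) (v : SExp CPSym), eval set (node (unary i) (node v (list (m.map bits))))
        = list ((m.map bits).set i v) := by
      intro i v
      rw [eval_set _ _ _ (by simp [len_unary, hm]), len_unary]
    unfold CounterProgram.step at h0 hW ⊢
    simp only [hc, dif_pos] at h0 hW ⊢
    cases hi : P.instr ⟨c.pc, hc⟩ with
    | add i j k =>
      rw [hi] at hy
      simp only [hi] at h0 hW ⊢
      obtain ⟨a, ha1, ha2, ha3⟩ := hbits j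
      obtain ⟨b, hb1, hb2, hb3⟩ := hbits k
      have h1 := hW i
      simp only [Function.update_self, ← ha3, ← hb3] at h1
      have h2 := bval_aluOut_add ha2 hb2 (by exact_mod_cast h1)
      have e : eval execStep s = node (node W (list ((List.ofFn P.instr).map CPInstr.toSExp)))
        (node (unary (c.pc + 1)) (list ((m.map bits).set i
          (bits (aluOut addCarry W.len a b false))))) := by
        simp only [execStep, execArith, eval_cond, curArg, eval_comp, counter, eval_pair,
          hy, nextPc]
        subst hs
        simp only [CPInstr.toSExp, list_cons, eval_hd, eval_tl, hd_node, tl_node, test_atom,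
          eval_const, decide_true, if_true, ha1, hb1, eval_alu, hset]
        rfl
      rw [e]
      refine represents_update hm hb i _ (length_aluOut _ _ _ _ _).le _ _ (by simp) _ ?_
      rw [h2, ← ha3, ← hb3]
      push_cast
      rfl
    | sub i j k =>
      rw [hi] at hy
      simp only [hi] at h0 hW ⊢
      obtain ⟨a, ha1, ha2, ha3⟩ := hbits j
      obtain ⟨b, hb1, hb2, hb3⟩ := hbits k
      have h1 := h0 i
      simp only [Function.update_self, ← ha3, ← hb3] at h1
      have hle : bval b ≤ bval a := by omega
      have h2 := bval_aluOut_sub ha2 hb2 hle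
      have e : eval execStep s = node (node W (list ((List.ofFn P.instr).map CPInstr.toSExp)))
        (node (unary (c.pc + 1)) (list ((m.map bits).set i
          (bits (aluOut subCarry W.len a b false))))) := by
        simp only [execStep, execArith, eval_cond, curArg, eval_comp, counter, eval_pair,
          hy, nextPc]
        subst hs
        simp only [CPInstr.toSExp, list_cons, eval_hd, eval_tl, hd_node, tl_node, test_atom,
          eval_const, decide_true, if_true, ha1, hb1, eval_alu, hset]
        rfl
      rw [e]
      refine represents_update hm hb i _ (length_aluOut _ _ _ _ _).le _ _ (by simp) _ ?_
      rw [h2, ← ha3, ← hb3]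
      omega
    | test i j t =>
      rw [hi] at hy
      simp only [hi] at h0 hW ⊢
      obtain ⟨a, ha1, ha2, ha3⟩ := hbits i
      obtain ⟨b, hb1, hb2, hb3⟩ := hbits j
      refine ⟨m, hm, hb, ?_⟩
      simp only [execStep, execTest, eval_cond, curArg, eval_comp, counter, eval_pair,
          hy, nextPc]
      subst hs
      simp only [CPInstr.toSExp, list_cons, eval_hd, eval_tl, hd_node, tl_node, test_atom,
          eval_const, ha1, hb1, eval_alu, aluCarry_sub ha2 hb2, ← ha3, ← hb3]
      by_cases hlt : bval a < bval b
      · simp [hlt, not_le.2 hlt]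
        rfl
      · simp [hlt, not_lt.1 hlt]
  · rw [eval_execStep_halt h hc]
    have : P.step c = c := by simp [CounterProgram.step, hc]
    rwa [this]

end CounterProgram

/-! ## Parsing instances and the upper bound -/

namespace Code

open SExp

/-- One step of the parser, which reads the word from right to left and keeps the numbers read
since the last marker, and the instructions: applied to `node symbol (node numbers instrs)`. The
code `b` adds a bit to a number. -/
def parseStep (b : Code CPSym) : Code CPSym :=
  cond (fun a => a = .comma) hd (pair (pair (const .comma) (comp hd tl)) (comp tl tl)) <|
    cond (fun a => a = .bit true || a = .bit false) hd
      (pair (pair (comp b (pair hd (comp hd (comp hd tl)))) (comp tl (comp hd tl))) (comp tl tl))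
      (pair (const .comma) (pair (pair hd (comp hd tl)) (comp tl tl)))

def parse (b : Code CPSym) : Code CPSym :=
  comp (foldl (parseStep b)) (pair reverse (pair (const .comma) (const .comma)))

/-- Add a bit to a unary number: applied to `node bit u`. -/
def unaryBit : Code CPSym :=
  cond (fun a => a = .bit true) hd (pair (const .comma) (comp extend (pair tl tl)))
    (comp extend (pair tl tl))

theorem eval_parse (b : Code CPSym) (w : List CPSym) :
    eval (parse b) (word _root_.id w) =
      w.foldr (fun a s => eval (parseStep b) (node (atom a) s)) (node (list []) (list [])) := by
  simp only [parse, eval_comp, eval_pair, word, eval_reverse, eval_foldl, List.foldl_reverse,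
    List.foldr_map, eval_const]
  rfl

section
variable (b : Code CPSym) (x y l m : SExp CPSym)

theorem eval_parseStep_comma : eval (parseStep b) (node (atom .comma) (node l m)) =
    node (node (atom .comma) l) m := by
  simp [parseStep]

theorem eval_parseStep_bit (a : Bool) :
    eval (parseStep b) (node (atom (.bit a)) (node (node x l) m)) =
      node (node (eval b (node (atom (.bit a)) x)) l) m := by
  cases a <;> simp [parseStep]

theorem eval_parseStep_marker {a : CPSym} (h1 : a ≠ .comma) (h2 : ∀ c, a ≠ .bit c) :
    eval (parseStep b) (node (atom a) (node l m)) =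
      node (list []) (node (node (atom a) l) m) := by
  simp [parseStep, h1, h2]
  rfl

/-- What the parser, with the code `b`, makes of a number. -/
def numeral (b : Code CPSym) (k : ℕ) : SExp CPSym :=
  (Computability.encodeNat k).foldr (fun c x => eval b (node (atom (.bit c)) x)) (atom .comma)

theorem foldr_parseStep_encodeNatSym (k : ℕ) (w : List CPSym) {l m : SExp CPSym} {z : SExp CPSym}
    (h : w.foldr (fun a s => eval (parseStep b) (node (atom a) s)) z = node l m) :
    (encodeNatSym k ++ w).foldr (fun a s => eval (parseStep b) (node (atom a) s)) z =
      node (node (numeral b k) l) m := by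
  rw [encodeNatSym, List.append_assoc, List.foldr_append, List.singleton_append, List.foldr_cons, h,
    eval_parseStep_comma, List.foldr_map, numeral]
  generalize Computability.encodeNat k = t
  induction t with
  | nil => rfl
  | cons c t ih => rw [List.foldr_cons, ih, eval_parseStep_bit, List.foldr_cons]

theorem foldr_parseStep_flatMap (t : List ℕ) (w : List CPSym) {l : List (SExp CPSym)}
    {m z : SExp CPSym}
    (h : w.foldr (fun a s => eval (parseStep b) (node (atom a) s)) z = node (list l) m) :
    (t.flatMap encodeNatSym ++ w).foldr (fun a s => eval (parseStep b) (node (atom a) s)) z =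
      node (list (t.map (numeral b) ++ l)) m := by
  induction t with
  | nil => simpa using h
  | cons k t ih =>
    rw [List.flatMap_cons, List.append_assoc, foldr_parseStep_encodeNatSym b k _ ih]
    rfl

end

/-- What the parser makes of an instruction. -/
def parsedInstr (b : Code CPSym) {n m : ℕ} : CPInstr n m → SExp CPSym
  | .add i j k => list [atom .add, numeral b i, numeral b j, numeral b k]
  | .sub i j k => list [atom .sub, numeral b i, numeral b j, numeral b k]
  | .test i j t => list [atom .test, numeral b i, numeral b j, numeral b t]

theorem foldr_parseStep_instrs (b : Code CPSym) {n m : ℕ} (t : List (CPInstr n m)) :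
    (t.flatMap CPInstr.encode).foldr (fun a s => eval (parseStep b) (node (atom a) s))
      (node (list []) (list [])) = node (list []) (list (t.map (parsedInstr b))) := by
  induction t with
  | nil => rfl
  | cons x t ih =>
    rw [List.flatMap_cons]
    cases x with
    | add i j k =>
      rw [CPInstr.encode, List.cons_append, List.foldr_cons, List.append_assoc, List.append_assoc,
        foldr_parseStep_encodeNatSym b i _ (foldr_parseStep_encodeNatSym b j _
          (foldr_parseStep_encodeNatSym b k _ ih)), eval_parseStep_marker _ _ _ (by simp) (by simp)]
      rfl
    | sub i j k =>
      rw [CPInstr.encode, List.cons_append, List.foldr_cons, List.append_assoc, List.append_assoc,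
        foldr_parseStep_encodeNatSym b i _ (foldr_parseStep_encodeNatSym b j _
          (foldr_parseStep_encodeNatSym b k _ ih)), eval_parseStep_marker _ _ _ (by simp) (by simp)]
      rfl
    | test i j k =>
      rw [CPInstr.encode, List.cons_append, List.foldr_cons, List.append_assoc, List.append_assoc,
        foldr_parseStep_encodeNatSym b i _ (foldr_parseStep_encodeNatSym b j _
          (foldr_parseStep_encodeNatSym b k _ ih)), eval_parseStep_marker _ _ _ (by simp) (by simp)]
      rfl

theorem eval_parse_encode (b : Code CPSym) (I : BTInstance) :
    eval (parse b) (word _root_.id I.encode) =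
      node (list (numeral b I.N :: numeral b I.prog.n :: numeral b (I.prog.len + 1) ::
        (List.ofFn I.prog.init).map (numeral b))) (list ((List.ofFn I.prog.instr).map (parsedInstr b))) := by
  have h := foldr_parseStep_flatMap b (List.ofFn I.prog.init) _
    (foldr_parseStep_instrs b (List.ofFn I.prog.instr))
  rw [List.append_nil] at h
  rw [eval_parse, BTInstance.encode, foldr_parseStep_encodeNatSym b _ _
    (foldr_parseStep_encodeNatSym b _ _ (foldr_parseStep_encodeNatSym b _ _ h))]
  rfl

theorem numeral_id (k : ℕ) : numeral id k = bits (Computability.encodeNat k) := by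
  unfold numeral
  induction Computability.encodeNat k with
  | nil => rfl
  | cons c t ih => rw [List.foldr_cons, ih]; rfl

theorem numeral_unaryBit (k : ℕ) : numeral unaryBit k = unary k := by
  conv_rhs => rw [← bval_encodeNat k]
  unfold numeral
  induction Computability.encodeNat k with
  | nil => rfl
  | cons c t ih =>
    rw [List.foldr_cons, ih]
    have h := eval_extend_unary (A := CPSym) (unary (bval t)) (bval t)
    rw [len_unary, ← two_mul] at h
    cases c
    · simp only [unaryBit, eval_cond, eval_hd, hd_node, test_atom, eval_comp, eval_pair, eval_tl,
        tl_node, h, bval]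
      simp
    · simp only [unaryBit, eval_cond, eval_hd, hd_node, test_atom, eval_comp, eval_pair, eval_tl,
        tl_node, h, bval, eval_const]
      simp [add_comm 1]
      rfl

theorem parsedInstr_unaryBit {n m : ℕ} (x : CPInstr n m) : parsedInstr unaryBit x = x.toSExp := by
  cases x <;> simp only [parsedInstr, CPInstr.toSExp, numeral_unaryBit]

/-! ### The decision procedure and its cost -/

/-- Applied to `node w u`, where `u` is the unary parse of the word `w`: run the program. -/
def simulate : Code CPSym :=
  let N := comp hd (comp hd tl)
  comp (cond (fun _ => true) rest (pair (const (.bit true)) (const .comma))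
      (pair (const (.bit false)) (const .comma)))
    -- The unary `N` drives the loop, and lengthened by `w` it also gives the width. Instructions
    -- come from the unary parse, but the initial values come from a second, binary parse, whose
    -- first three numbers are `N` and the numbers of counters and instructions.
    (comp (iter execStep) (pair N (pair (pair (comp extend (pair N hd)) (comp tl tl))
      (pair (const .comma) (comp tl (comp tl (comp tl (comp hd (comp (parse id) hd)))))))))

/-- Decide whether the halting instruction is reached. -/
def decideHalt : Code CPSym := comp simulate (pair id (parse unaryBit))

theorem PolyTime.parseStep {b : Code CPSym} (hb : PolyTime b) : PolyTime (parseStep b) := by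
  rw [Code.parseStep]
  simp (maxDischargeDepth := 30) only [PolyTime.pair, PolyTime.comp, PolyTime.hd, PolyTime.tl,
    PolyTime.const, PolyTime.cond, hb]

/-- Used with `k = 0` for bit lists, where a bit adds a constant, and with `k = 1` for unary
numbers, where a bit may double the size. -/
theorem size_parseStep_le {b : Code CPSym} {k n : ℕ}
    (hb : ∀ x y, (eval b (node x y)).size ≤ x.size + (k + 1) * y.size + n) (y a : SExp CPSym) :
    (eval (parseStep b) (node y a)).size ≤ y.size + (k + 1) * a.size + (n + 2 * k + 10) := by
  have h1 := a.size_hd_tl_le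
  have h2 := a.hd.size_hd_tl_le
  have h3 := hb y a.hd.hd
  have h4 : k * a.hd.hd.size + k * a.hd.tl.size ≤ k * a.hd.size + k := by
    rw [← mul_add, ← Nat.mul_succ]; exact Nat.mul_le_mul_left _ h2
  have h5 : k * a.hd.size + k * a.tl.size ≤ k * a.size + k := by
    rw [← mul_add, ← Nat.mul_succ]; exact Nat.mul_le_mul_left _ h1
  rw [Nat.succ_mul] at h3 ⊢
  simp only [parseStep, eval_cond]
  split
  · simp only [eval_pair, eval_comp, eval_hd, eval_tl, tl_node, eval_const, SExp.size]
    omega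
  · split <;>
    · simp only [eval_pair, eval_comp, eval_hd, eval_tl, hd_node, tl_node, eval_const, SExp.size]
      omega

theorem PolyTime.parse_id : PolyTime (parse Code.id) := by
  have h := PolyTime.foldl (.parseStep .id) (1 + 2 * 0 + 10) (fun y a => by
    have := size_parseStep_le (b := Code.id) (k := 0) (n := 1) (fun x y => by
      rw [eval_id, SExp.size]; omega) y a
    omega)
  rw [Code.parse]
  simp (maxDischargeDepth := 30) only [PolyTime.pair, PolyTime.comp, PolyTime.const,
    PolyTime.reverse, h]

theorem PolyTime.unaryBit : PolyTime unaryBit := by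
  rw [Code.unaryBit]
  simp (maxDischargeDepth := 30) only [PolyTime.pair, PolyTime.comp, PolyTime.hd, PolyTime.tl,
    PolyTime.const, PolyTime.cond, PolyTime.extend]

theorem _root_.SExp.two_mul_len_lt {A : Type} (x : SExp A) : 2 * x.len < x.size := by
  induction x with
  | atom a => simp [len, SExp.size]
  | node x y _ ih => simp only [len, SExp.size]; have := x.size_pos; omega

/-- One symbol of the input at most doubles the state up to a constant, so `expTime_iter` applies to
the fold. -/
theorem ExpTime.parse_unaryBit : ExpTime (parse Code.unaryBit) := by
  have hb : ∀ x y : SExp CPSym,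
      (eval Code.unaryBit (node x y)).size ≤ x.size + (1 + 1) * y.size + 2 := by
    intro x y
    have h1 := y.two_mul_len_lt
    have h2 := size_extend y y
    simp only [Code.unaryBit, eval_cond]
    split <;> simp only [eval_pair, eval_comp, eval_tl, tl_node, eval_const, SExp.size, h2] <;> omega
  have hs := size_parseStep_le hb
  have h : ExpTime (Code.iter (foldlStep (parseStep Code.unaryBit))) := by
    refine PolyTime.expTime_iter ?_ 20 fun x => ?_
    · have := PolyTime.parseStep .unaryBit
      rw [foldlStep]
      simp (maxDischargeDepth := 30) only [PolyTime.pair, PolyTime.comp, PolyTime.hd, PolyTime.tl,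
        this]
    · have h1 := hs x.hd.hd x.tl
      have h2 := x.hd.size_hd_tl_le
      have h3 := x.size_hd_tl_le
      simp only [foldlStep, eval_pair, eval_comp, eval_tl, eval_hd, SExp.size]
      omega
  rw [Code.parse, foldl]
  refine ExpTime.comp_polyTime ?_ ?_
  · exact PolyTime.tl.comp_expTime (h.comp_polyTime (PolyTime.hd.pair .id))
  · simp (maxDischargeDepth := 30) only [PolyTime.pair, PolyTime.const,
      PolyTime.reverse]

theorem PolyTime.simulate : PolyTime simulate := by
  have h : PolyTime rest := PolyTime.dropN.comp ((PolyTime.hd.comp .tl).pair (PolyTime.tl.comp .hd))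
  have h2 := PolyTime.iter_execStep
  have h3 := PolyTime.parse_id
  rw [Code.simulate]
  simp (maxDischargeDepth := 30) only [PolyTime.pair, PolyTime.comp, PolyTime.hd, PolyTime.tl,
    PolyTime.const, PolyTime.cond, PolyTime.extend, h, h2, h3]

theorem ExpTime.decideHalt : ExpTime decideHalt :=
  PolyTime.simulate.comp_expTime (PolyTime.id.expTime.pair .parse_unaryBit)

end Code

/-! ### Correctness of the decision procedure -/

namespace CounterProgram

open SExp Code

theorem pc_iterate_of_halted {P : CounterProgram} {k n : ℕ} (h : k ≤ n) {c : P.Cfg}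
    (hk : (P.step^[k] c).pc = Fin.last P.len) : (P.step^[n] c).pc = Fin.last P.len := by
  obtain ⟨m, rfl⟩ := Nat.exists_eq_add_of_le' h
  rw [Function.iterate_add_apply]
  generalize P.step^[k] c = d at hk
  have : P.step d = d := by simp [step, hk]
  rw [Function.iterate_fixed this]
  exact hk

theorem haltsWithin_iff {P : CounterProgram} {N : ℕ} :
    P.HaltsWithin N ↔ (P.step^[N] P.initCfg).pc = Fin.last P.len :=
  ⟨fun ⟨_, hk, h⟩ => pc_iterate_of_halted hk h, fun h => ⟨N, le_rfl, h⟩⟩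

theorem step_val_le {P : CounterProgram} {c : P.Cfg} {B : ℤ} (h0 : ∀ i, 0 ≤ c.val i)
    (hB : ∀ i, c.val i ≤ B) (i : Fin P.n) : (P.step c).val i ≤ 2 * B := by
  have hB' : ∀ i, c.val i ≤ 2 * B := fun i => by have := h0 i; have := hB i; omega
  unfold step
  split
  · dsimp only
    split
    · rename_i j k l _
      have := hB k
      have := hB l
      by_cases h : i = j
      · subst h; simp; omega
      · simpa [h] using hB' i
    · rename_i j k l _
      have := hB k
      have := h0 k
      have := h0 l
      by_cases h : i = j
      · subst h; simp; omega
      · simpa [h] using hB' i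
    · exact hB' i
  · exact hB' i

theorem length_encodeNat_le {n : ℕ} (init : Fin n → ℕ) (i : Fin n) :
    (Computability.encodeNat (init i)).length ≤ ((List.ofFn init).flatMap encodeNatSym).length := by
  have h : init i ∈ List.ofFn init := List.mem_ofFn.2 ⟨i, rfl⟩
  obtain ⟨u, v, h⟩ := List.append_of_mem h
  rw [h]
  simp [encodeNatSym]
  omega

/-- Simplicity enters only through non-negativity, which `step_val_le` needs at every configuration
on the way. The bound `2 ^ k * (2 ^ b - 1)` is the one that doubles exactly. -/
theorem iterate_step_val_lt {P : CounterProgram} (hP : P.IsSimple) {b : ℕ}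
    (hb : ∀ i, P.init i < 2 ^ b) (k : ℕ) (i : Fin P.n) :
    (P.step^[k] P.initCfg).val i < 2 ^ (k + b) := by
  suffices h : ∀ i, (P.step^[k] P.initCfg).val i ≤ 2 ^ k * (2 ^ b - 1) by
    have := h i
    have h2 : (0 : ℤ) < 2 ^ k := by positivity
    rw [pow_add]
    nlinarith
  induction k with
  | zero =>
    intro i
    have := hb i
    have h2 : ((P.init i : ℕ) : ℤ) < 2 ^ b := by exact_mod_cast this
    simp only [Function.iterate_zero, initCfg, _root_.id]
    push_cast
    omega
  | succ k ih =>
    intro i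
    rw [Function.iterate_succ_apply']
    refine (step_val_le (hP.1 _ ⟨k, rfl⟩) ih i).trans (le_of_eq (by ring))

open Classical in
theorem eval_decideHalt_encode (I : BTInstance) (hI : I.prog.IsSimple) :
    eval Code.decideHalt (word _root_.id I.encode) =
      bits [decide (I.prog.HaltsWithin I.N)] := by
  obtain ⟨P, N⟩ := I
  obtain ⟨w, hw⟩ : ∃ w, w = (⟨P, N⟩ : BTInstance).encode := ⟨_, rfl⟩
  have hlen : ∀ i, (Computability.encodeNat (P.init i)).length ≤ w.length := by
    intro i
    have := length_encodeNat_le P.init i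
    simp only [hw, BTInstance.encode, List.length_append]
    omega
  have hwl : (word _root_.id w : SExp CPSym).len = w.length := by simp [word]
  set W : SExp CPSym := eval extend (node (unary N) (word _root_.id w)) with hW
  have hWl : W.len = N + w.length := by
    rw [hW, len_extend, len_unary, hwl]
  have key : ∀ k ≤ N, P.Represents W (P.step^[k] P.initCfg) ((eval execStep)^[k]
      (node (node W (list ((List.ofFn P.instr).map CPInstr.toSExp)))
        (node (unary 0) (list (((List.ofFn P.init).map Computability.encodeNat).map bits))))) := by
    intro k hk
    induction k with
    | zero =>
      refine ⟨(List.ofFn P.init).map Computability.encodeNat, by simp, fun i => ?_, rfl⟩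
      refine ⟨Computability.encodeNat (P.init i), by simp, by have := hlen i; omega, ?_⟩
      rw [bval_encodeNat]
      rfl
    | succ k ih =>
      rw [Function.iterate_succ_apply', Function.iterate_succ_apply']
      refine (ih (by omega)).step (fun i => hI.1 _ ⟨k + 1, ?_⟩ i) (fun i => ?_)
      · rw [Function.iterate_succ_apply']
      -- Each initial value has at most `|w|` bits since its numeral is a part of `w`, so after `k +
      -- 1 ≤ N` steps the width `N + |w|` is still enough.
      · have h := iterate_step_val_lt hI (b := w.length) (fun j => ?_) (k + 1) i
        · rw [Function.iterate_succ_apply'] at h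
          refine h.trans_le ?_
          rw [hWl]
          exact pow_le_pow_right₀ (by norm_num) (by omega)
        · have h1 := bval_lt (Computability.encodeNat (P.init j))
          rw [bval_encodeNat] at h1
          exact h1.trans_le (pow_le_pow_right₀ (by norm_num) (hlen j))
  have hN := key N le_rfl
  have hr := eval_rest hN
  have hmap : (List.ofFn P.instr).map (parsedInstr unaryBit) =
      (List.ofFn P.instr).map CPInstr.toSExp :=
    List.map_congr_left fun x _ => parsedInstr_unaryBit x
  have hinit : (List.ofFn P.init).map (numeral Code.id) =
      ((List.ofFn P.init).map Computability.encodeNat).map bits := by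
    rw [List.map_map]
    exact List.map_congr_left fun x _ => numeral_id x
  have h1 := eval_parse_encode unaryBit ⟨P, N⟩
  have h2 := eval_parse_encode Code.id ⟨P, N⟩
  simp only [hmap, hinit, ← hw, numeral_unaryBit, list_cons] at h1 h2
  rw [← hw, decideHalt, simulate]
  simp only [eval_comp, eval_pair, eval_id, h1, h2, eval_hd, eval_tl, hd_node,
    tl_node, ← hW, eval_iter, len_unary, eval_cond]
  rw [eval_const, eval_const, eval_const, eval_const,
    show (atom CPSym.comma : SExp CPSym) = unary 0 from rfl, hr]
  by_cases h : P.HaltsWithin N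
  · rw [List.drop_of_length_le (by simp [haltsWithin_iff.1 h])]
    simp [h, test]
    rfl
  · have h3 : (P.step^[N] P.initCfg).pc.val < P.len :=
      Fin.val_lt_last fun h' => h (haltsWithin_iff.2 h')
    rw [List.drop_eq_getElem_cons (by simpa using h3)]
    simp [h, test]
    rfl

/-- What the decider answers on a word. -/
theorem exists_eval_decideHalt (w : List CPSym) :
    ∃ b, eval Code.decideHalt (word _root_.id w) = bits [b] := by
  rw [decideHalt, simulate]
  simp only [eval_comp, eval_cond, eval_pair]
  split
  · exact ⟨true, rfl⟩
  · exact ⟨false, rfl⟩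

theorem memEXP_simpleBoundedTermination : simpleBoundedTermination.MemEXP := by
  classical
  choose f hf using exists_eval_decideHalt
  obtain ⟨p, hp⟩ := ExpTime.decideHalt
  refine ⟨{w | f w = true}, ?_, fun a => ?_⟩
  · obtain ⟨M, hM⟩ := Code.computableInTime (ea := (_root_.id : List CPSym → List CPSym))
      (eb := Computability.encodeBool) (f := f) Code.decideHalt _root_.id CPSym.bit
      (fun a b h => by injection h) (fun w => by rw [hf]; rfl)
      (fun n => 5 * n + 6 + 2 * 2 ^ p.eval (2 * n + 1)) (fun w => by
        have := hp (word _root_.id w)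
        rw [size_word] at this
        simp only [_root_.id]
        omega)
    refine ⟨f, M, p.comp (2 * Polynomial.X + 1) + 5 * Polynomial.X + 7, fun w => Iff.rfl,
      fun n => ?_⟩
    rw [hM]
    simp only [Polynomial.eval_add, Polynomial.eval_comp, Polynomial.eval_mul, Polynomial.eval_X,
      Polynomial.eval_ofNat, Polynomial.eval_one]
    have h1 : 5 * n + 6 < 2 ^ (5 * n + 6) := Nat.lt_two_pow_self
    have h2 : 1 ≤ 2 ^ p.eval (2 * n + 1) := Nat.one_le_two_pow
    rw [show p.eval (2 * n + 1) + 5 * n + 7 = p.eval (2 * n + 1) + (5 * n + 6) + 1 by ring,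
      pow_succ, pow_add]
    nlinarith
  · have h := eval_decideHalt_encode a.1 a.2
    have h2 := hf a.1.encode
    rw [h] at h2
    have h3 : decide (a.1.prog.HaltsWithin a.1.N) = f a.1.encode := by
      simpa [bits, word, list_cons] using h2
    change f a.1.encode = true ↔ _
    rw [← h3, decide_eq_true_iff]
    rfl

end CounterProgram

/-! ## Bit-stack machines as simple counter programs -/

/-- The counters used to simulate `κ` stacks. -/
inductive Ctr (κ : ℕ)
  /-- the counters that occur in tests -/
  | left
  | right
  /-- the scale -/
  | scale
  /-- the counter that is always zero -/
  | zero
  /-- the counter for a stack -/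
  | stack (k : Fin κ)
  deriving DecidableEq

namespace Ctr

variable {κ : ℕ}

def toFin : Ctr κ → Fin (4 + κ)
  | left => Fin.castAdd κ 0
  | right => Fin.castAdd κ 1
  | scale => Fin.castAdd κ 2
  | zero => Fin.castAdd κ 3
  | stack k => Fin.natAdd 4 k

def ofFin : Fin (4 + κ) → Ctr κ :=
  Fin.addCases ![left, right, scale, zero] stack

def equivFin : Ctr κ ≃ Fin (4 + κ) where
  toFun := toFin
  invFun := ofFin
  left_inv x := by cases x <;> simp [toFin, ofFin, Fin.addCases_left, Fin.addCases_right]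
  right_inv i := by
    induction i using Fin.addCases with
    | left i => fin_cases i <;> simp [toFin, ofFin, Fin.addCases_left]
    | right i => simp [toFin, ofFin, Fin.addCases_right]

end Ctr

/-- Instructions of a counter program on the counters `Ctr κ`. The only test is
`if left ≥ right goto t`; it is annotated by counters `x`, `y` with `left = 640 x` or
`left = 64 x`, and `right = 64 y`. -/
inductive LinInstr (κ : ℕ)
  | add (x y z : Ctr κ)
  | sub (x y z : Ctr κ)
  | test (x : Ctr κ) (b : Bool) (y : Ctr κ) (t : ℕ)

structure LinProgram (κ : ℕ) where
  len : ℕ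
  instr : ℕ → LinInstr κ

namespace LinProgram

variable {κ : ℕ} (p : LinProgram κ)

abbrev Cfg (κ : ℕ) := ℕ × (Ctr κ → ℤ)

def step (c : Cfg κ) : Cfg κ :=
  if c.1 < p.len then
    match p.instr c.1 with
    | .add x y z => (c.1 + 1, Function.update c.2 x (c.2 y + c.2 z))
    | .sub x y z => (c.1 + 1, Function.update c.2 x (c.2 y - c.2 z))
    | .test _ _ _ t => (if c.2 .left ≥ c.2 .right then min t p.len else c.1 + 1, c.2)
  else c

/-- The condition on the reachable configurations of a simple program. -/
def Good (c : Cfg κ) : Prop :=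
  (∀ x, 0 ≤ c.2 x) ∧ ∀ x b y t, p.instr c.1 = .test x b y t →
    c.2 .left = (if b then 640 else 64) * c.2 x ∧ c.2 .right = 64 * c.2 y ∧
      ∀ z, z ≠ .left → z ≠ .right → c.2 z ≤ |c.2 .left - c.2 .right|

def toCPInstr : LinInstr κ → CPInstr (4 + κ) (p.len + 1)
  | .add x y z => .add x.toFin y.toFin z.toFin
  | .sub x y z => .sub x.toFin y.toFin z.toFin
  | .test _ _ _ t => .test (Ctr.left (κ := κ)).toFin (Ctr.right (κ := κ)).toFin
      ⟨min t p.len, by omega⟩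

def toCP (init : Ctr κ → ℕ) : CounterProgram where
  n := 4 + κ
  len := p.len
  instr q := p.toCPInstr (p.instr q)
  init i := init (Ctr.ofFin i)

variable {p}

theorem ofFin_toFin (x : Ctr κ) : Ctr.ofFin x.toFin = x := Ctr.equivFin.left_inv x

theorem comp_ofFin_update (v : Ctr κ → ℤ) (x : Ctr κ) (a : ℤ) :
    (fun i => Function.update v x a (Ctr.ofFin i)) =
      Function.update (fun i => v (Ctr.ofFin i)) x.toFin a := by
  funext i
  obtain ⟨y, rfl⟩ : ∃ y : Ctr κ, y.toFin = i := Ctr.equivFin.surjective i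
  by_cases h : y = x
  · subst h; simp [ofFin_toFin]
  · have : y.toFin ≠ x.toFin := fun h' => h (Ctr.equivFin.injective h')
    simp [ofFin_toFin, h, this]

theorem toCP_step {init : Ctr κ → ℕ} (c : Cfg κ) (d : (p.toCP init).Cfg) (h1 : (d.pc : ℕ) = c.1)
    (h2 : d.val = fun i => c.2 (Ctr.ofFin i)) :
    (((p.toCP init).step d).pc : ℕ) = (p.step c).1 ∧
      ((p.toCP init).step d).val = fun i => (p.step c).2 (Ctr.ofFin i) := by
  obtain ⟨q, v⟩ := d
  obtain ⟨a, u⟩ := c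
  simp only at h1 h2
  subst h1 h2
  by_cases hq : (q : ℕ) < p.len
  · have hq' : (q : ℕ) < (p.toCP init).len := hq
    simp only [CounterProgram.step, hq', dif_pos, step, hq, if_true]
    have e : (p.toCP init).instr ⟨q, hq'⟩ = p.toCPInstr (p.instr q) := rfl
    rw [e]
    cases p.instr q with
    | add x y z =>
      simp only [toCPInstr, ofFin_toFin, comp_ofFin_update]
      exact ⟨rfl, rfl⟩
    | sub x y z =>
      simp only [toCPInstr, ofFin_toFin, comp_ofFin_update]
      exact ⟨rfl, rfl⟩
    | test x b y t =>
      simp only [toCPInstr, ofFin_toFin]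
      refine ⟨?_, rfl⟩
      by_cases hv : u .left ≥ u .right <;> simp only [hv, if_true, if_false] <;> rfl
  · have hq' : ¬ (q : ℕ) < (p.toCP init).len := hq
    simp only [CounterProgram.step, hq', step, hq, dif_neg, not_false_eq_true, if_false]
    exact ⟨trivial, rfl⟩

theorem toCP_iterate_step (init : Ctr κ → ℕ) (k : ℕ) :
    (((p.toCP init).step^[k] (p.toCP init).initCfg).pc : ℕ) =
        (p.step^[k] (0, fun x => (init x : ℤ))).1 ∧
      ((p.toCP init).step^[k] (p.toCP init).initCfg).val =
        fun i => (p.step^[k] (0, fun x => (init x : ℤ))).2 (Ctr.ofFin i) := by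
  induction k with
  | zero => exact ⟨rfl, rfl⟩
  | succ k ih =>
    rw [Function.iterate_succ_apply', Function.iterate_succ_apply']
    exact toCP_step _ _ ih.1 ih.2

/-- The annotation `x`, `b`, `y` of a test supplies the counters and factors that simplicity asks
for. They depend on the instruction alone, as the order of quantifiers demands. -/
theorem isSimple_toCP {init : Ctr κ → ℕ}
    (h : ∀ k, p.Good (p.step^[k] (0, fun x => (init x : ℤ)))) : (p.toCP init).IsSimple := by
  constructor
  · rintro _ ⟨k, rfl⟩ i
    rw [(toCP_iterate_step init k).2]
    exact (h k).1 _
  · intro q i j t hq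
    change p.toCPInstr (p.instr q) = _ at hq
    cases hi : p.instr q with
    | add x y z => rw [hi] at hq; cases hq
    | sub x y z => rw [hi] at hq; cases hq
    | test x b y t' =>
      rw [hi] at hq
      injection hq with h1 h2 h3
      refine ⟨(Ctr.left (κ := κ)).toFin, (Ctr.right (κ := κ)).toFin, rfl, rfl, Or.inl h1.symm,
        Or.inr h2.symm, x.toFin, y.toFin, if b then 640 else 64, 64, ?_, by simp, ?_⟩
      · cases b <;> simp
      · rintro _ ⟨k, rfl⟩ hpc
        obtain ⟨h4, h5⟩ := toCP_iterate_step (p := p) init k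
        rw [hpc] at h4
        obtain ⟨h6, h7, h8⟩ := (h k).2 x b y t' (by rw [← h4]; exact hi)
        rw [h5]
        simp only [ofFin_toFin]
        refine ⟨h6, h7, fun i hi => h8 _ ?_ ?_⟩
        · intro h
          obtain ⟨y, rfl⟩ : ∃ y : Ctr κ, y.toFin = i := Ctr.equivFin.surjective i
          rw [ofFin_toFin] at h
          subst h
          simp [Ctr.toFin] at hi
        · intro h
          obtain ⟨y, rfl⟩ : ∃ y : Ctr κ, y.toFin = i := Ctr.equivFin.surjective i
          rw [ofFin_toFin] at h
          subst h
          simp [Ctr.toFin] at hi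

theorem haltsWithin_toCP {init : Ctr κ → ℕ} {N : ℕ} : (p.toCP init).HaltsWithin N ↔
    ∃ k ≤ N, (p.step^[k] (0, fun x => (init x : ℤ))).1 = p.len := by
  refine exists_congr fun k => and_congr_right fun _ => ?_
  rw [← (toCP_iterate_step init k).1, Fin.ext_iff]
  rfl

variable (p) in
/-- `n` steps lead from `c` to `c'`, through good configurations before the end of the program. -/
def Path (n : ℕ) (c c' : Cfg κ) : Prop :=
  p.step^[n] c = c' ∧ ∀ i < n, p.Good (p.step^[i] c) ∧ (p.step^[i] c).1 < p.len

theorem Path.refl (c : Cfg κ) : p.Path 0 c c := ⟨rfl, by simp⟩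

theorem Path.single {c c' : Cfg κ} (h1 : p.Good c) (h2 : c.1 < p.len) (h3 : p.step c = c') :
    p.Path 1 c c' := by
  refine ⟨h3, fun i hi => ?_⟩
  obtain rfl : i = 0 := by omega
  exact ⟨h1, h2⟩

theorem Path.trans {m n : ℕ} {c c' c'' : Cfg κ} (h1 : p.Path m c c') (h2 : p.Path n c' c'') :
    p.Path (m + n) c c'' := by
  refine ⟨by rw [add_comm, Function.iterate_add_apply, h1.1, h2.1], fun i hi => ?_⟩
  rcases lt_or_ge i m with h | h
  · exact h1.2 i h
  · obtain ⟨j, rfl⟩ := Nat.exists_eq_add_of_le' h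
    rw [Function.iterate_add_apply, h1.1]
    exact h2.2 j (by omega)

variable (p) in
/-- The instructions `l` are at the address `a`. -/
def At (a : ℕ) (l : List (LinInstr κ)) : Prop :=
  ∀ j (h : j < l.length), p.instr (a + j) = l[j] ∧ a + j < p.len

theorem At.append {a : ℕ} {l l' : List (LinInstr κ)} (h : p.At a (l ++ l')) :
    p.At a l ∧ p.At (a + l.length) l' := by
  refine ⟨fun j hj => ?_, fun j hj => ?_⟩
  · have := h j (by simp; omega)
    rwa [List.getElem_append_left hj] at this
  · have := h (l.length + j) (by simp; omega)
    rw [List.getElem_append_right (by omega)] at this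
    simpa [add_assoc] using this

theorem At.cons {a : ℕ} {x : LinInstr κ} {l : List (LinInstr κ)} (h : p.At a (x :: l)) :
    (p.instr a = x ∧ a < p.len) ∧ p.At (a + 1) l :=
  ⟨h 0 (by simp), (At.append (l := [x]) h).2⟩

abbrev AddList (κ : ℕ) := List (Ctr κ × Ctr κ × Ctr κ)

def AddList.toInstrs (l : AddList κ) : List (LinInstr κ) :=
  l.map fun t => .add t.1 t.2.1 t.2.2

def AddList.exec : AddList κ → (Ctr κ → ℤ) → Ctr κ → ℤ
  | [], v => v
  | t :: l, v => AddList.exec l (Function.update v t.1 (v t.2.1 + v t.2.2))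

theorem AddList.exec_append (l l' : AddList κ) (v : Ctr κ → ℤ) :
    AddList.exec (l ++ l') v = AddList.exec l' (AddList.exec l v) := by
  induction l generalizing v with
  | nil => rfl
  | cons t l ih => simp only [List.cons_append, AddList.exec, ih]

theorem AddList.exec_replicate (x : Ctr κ) (n : ℕ) (v : Ctr κ → ℤ) :
    AddList.exec (List.replicate n (x, x, x)) v = Function.update v x (2 ^ n * v x) := by
  induction n generalizing v with
  | zero => simp [AddList.exec]
  | succ n ih =>
    rw [List.replicate_succ, AddList.exec, ih]
    simp
    ring_nf

theorem AddList.exec_nonneg {l : AddList κ} {v : Ctr κ → ℤ} (h : ∀ x, 0 ≤ v x) (x : Ctr κ) :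
    0 ≤ AddList.exec l v x := by
  induction l generalizing v with
  | nil => exact h x
  | cons t l ih =>
    refine ih fun y => ?_
    by_cases hy : y = t.1
    · subst hy; simpa using add_nonneg (h _) (h _)
    · simpa [hy] using h y

theorem At.path_adds {a : ℕ} {l : AddList κ} (h : p.At a l.toInstrs) {v : Ctr κ → ℤ}
    (h0 : ∀ x, 0 ≤ v x) : p.Path l.length (a, v) (a + l.length, l.exec v) := by
  induction l generalizing a v with
  | nil => exact Path.refl _
  | cons t l ih =>
    obtain ⟨⟨h1, h2⟩, h3⟩ := h.cons
    have e : p.step (a, v) = (a + 1, AddList.exec [t] v) := by simp [step, h1, h2, AddList.exec]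
    have := (Path.single (p := p) (c := (a, v)) ⟨h0, by simp [h1]⟩ h2 e).trans
      (ih h3 (AddList.exec_nonneg h0))
    rw [add_assoc, add_comm 1] at this
    rw [List.length_cons, add_comm l.length 1]
    rw [add_comm 1]
    exact this

theorem path_test {a : ℕ} {x y : Ctr κ} {b : Bool} {t : ℕ} (ha : a < p.len)
    (h : p.instr a = .test x b y t) (ht : t ≤ p.len) {v : Ctr κ → ℤ} (h0 : ∀ x, 0 ≤ v x)
    (h1 : v .left = (if b then 640 else 64) * v x) (h2 : v .right = 64 * v y)
    (h3 : ∀ z, z ≠ .left → z ≠ .right → v z ≤ |v .left - v .right|) :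
    p.Path 1 (a, v) (if v .right ≤ v .left then t else a + 1, v) := by
  refine Path.single ⟨h0, ?_⟩ ha ?_
  · intro x' b' y' t' h'
    rw [h] at h'
    injection h' with e1 e2 e3 e4
    subst e1 e2 e3 e4
    exact ⟨h1, h2, h3⟩
  · simp [step, ha, h, ht]

/-- Load `left = 64 scale`, `right = 64 zero`. -/
def jumpPre : AddList κ :=
  (.left, .scale, .scale) :: (List.replicate 5 (.left, .left, .left) ++ [(.right, .zero, .zero)])

/-- The comparison `64 · scale ≥ 64 · 0` always succeeds, and its two sides differ by `64 · scale`,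
which dominates the remaining counters. -/
def jump (t : ℕ) : List (LinInstr κ) :=
  AddList.toInstrs jumpPre ++ [.test .scale false .zero t]

theorem exec_jumpPre {v : Ctr κ → ℤ} (hz : v .zero = 0) : AddList.exec jumpPre v =
    Function.update (Function.update v .left (64 * v .scale)) .right 0 := by
  simp only [jumpPre, AddList.exec, AddList.exec_append, AddList.exec_replicate]
  simp [hz]
  ring_nf

theorem At.path_jump {a t : ℕ} (h : p.At a (jump t)) (ht : t ≤ p.len) {v : Ctr κ → ℤ}
    (h0 : ∀ x, 0 ≤ v x) (hz : v .zero = 0)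
    (hs : ∀ z, z ≠ .left → z ≠ .right → v z ≤ 64 * v .scale) :
    p.Path 8 (a, v)
      (t, Function.update (Function.update v .left (64 * v .scale)) .right 0) := by
  obtain ⟨h1, h2⟩ := h.append
  have e := exec_jumpPre hz
  have p1 := h1.path_adds h0
  have n1 := AddList.exec_nonneg (l := jumpPre) h0
  obtain ⟨⟨h3, h4⟩, -⟩ := h2.cons
  rw [e] at p1 n1
  have p2 := path_test h4 h3 ht n1 (by simp) (by simp [hz]) fun z hz1 hz2 => by
    have := hs z hz1 hz2
    have h5 := h0 .scale
    rw [Function.update_of_ne hz2, Function.update_of_ne hz1, Function.update_self,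
      Function.update_of_ne (by simp), Function.update_self, abs_of_nonneg (by linarith)]
    linarith
  rw [if_pos (by simpa using h0 .scale)] at p2
  exact p1.trans p2

end LinProgram

/-! ### Bit-stack machines and their translation into blocks of instructions -/

/-- Instructions of a machine with `κ` stacks of bits: popping from the empty stack reads `false`. -/
inductive BitOp (κ : ℕ) (S : Type)
  | push (k : Fin κ) (b : Bool) (t : S)
  | pop (k : Fin κ) (t₀ t₁ : S)
  | jump (t : S)

namespace BitOp

/-- The next state, and the new stacks. -/
def apply {κ : ℕ} {S : Type} (s : Fin κ → List Bool) : BitOp κ S → S × (Fin κ → List Bool)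
  | push k b t => (t, Function.update s k (b :: s k))
  | pop k t₀ t₁ => (if (s k).headD false then t₁ else t₀, Function.update s k (s k).tail)
  | jump t => (t, s)

end BitOp

/-- A machine with `κ` stacks of bits and `size` states, which halts in the extra state. -/
structure BitMachine (κ : ℕ) where
  size : ℕ
  op : Fin size → BitOp κ (Fin (size + 1))

namespace BitMachine

variable {κ : ℕ} (M : BitMachine κ)

abbrev Cfg := Fin (M.size + 1) × (Fin κ → List Bool)

def step (c : M.Cfg) : M.Cfg :=
  if h : (c.1 : ℕ) < M.size then (M.op ⟨c.1, h⟩).apply c.2 else c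

open LinProgram

/-- Multiply a counter by `8`. -/
def octuple (x : Ctr κ) : AddList κ := List.replicate 3 (x, x, x)

/-- Load `left = 4 scale`. -/
def loadFour : AddList κ := [(.left, .scale, .scale), (.left, .left, .left)]

/-- Multiply all stacks except the stack `k` by `8`. -/
def octupleOthers (k : Fin κ) : AddList κ :=
  ((List.finRange κ).filter (· ≠ k)).flatMap fun j => octuple (.stack j)

/-- The old scale is loaded before it is multiplied. The pushed stack itself is not multiplied, so
relative to the new scale its old contents move down by one digit. -/
def pushAdds (k : Fin κ) (b : Bool) : AddList κ :=
  (if b then loadFour ++ [(.stack k, .stack k, .left)] else []) ++ (octuple .scale ++ octupleOthers k)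

/-- Load `left = 640 (stack k)`, `right = 64 scale`. -/
def popAdds (k : Fin κ) : AddList κ :=
  [(.left, .stack k, .stack k), (.left, .left, .left), (.left, .left, .stack k)] ++
    (List.replicate 7 (.left, .left, .left) ++
      (.right, .scale, .scale) :: List.replicate 5 (.right, .right, .right))

/-- The block of instructions for an operation at the address `a`; `f` is the address of a state. -/
def block {S : Type} (a : ℕ) (f : S → ℕ) : BitOp κ S → List (LinInstr κ)
  | .push k b t => (pushAdds k b).toInstrs ++ LinProgram.jump (f t)
  | .pop k t₀ t₁ =>
    -- The branch for `true` begins after 16 additions, the test, 3 doublings and a jump of length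
    -- 8, that is, at offset 28.
    (popAdds k).toInstrs ++ .test (.stack k) true .scale (a + 28) ::
      ((octuple (.stack k)).toInstrs ++ (LinProgram.jump (f t₀) ++
        ((octuple (.stack k) ++ loadFour).toInstrs ++ .sub (.stack k) (.stack k) .left ::
          LinProgram.jump (f t₁))))
  | .jump t => LinProgram.jump (f t)

/-- A common length that is not tight. The padding is never executed, since each block leaves by a
jump. -/
def blockLen (κ : ℕ) : ℕ := 3 * κ + 60

theorem length_block_le {S : Type} (a : ℕ) (f : S → ℕ) (o : BitOp κ S) :
    (block a f o).length ≤ blockLen κ := by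
  cases o with
  | push k b t =>
    have h : (octupleOthers k).length ≤ 3 * κ := by
      simp only [octupleOthers, octuple, List.length_flatMap, List.length_replicate]
      have := List.length_filter_le (· ≠ k) (List.finRange κ)
      simp at this ⊢
      omega
    cases b <;> simp [block, pushAdds, AddList.toInstrs, LinProgram.jump, octuple, loadFour,
      jumpPre, blockLen] <;> omega
  | pop k t₀ t₁ => simp [block, popAdds, AddList.toInstrs, LinProgram.jump, octuple, loadFour,
      jumpPre, blockLen]
  | jump t => simp [block, AddList.toInstrs, LinProgram.jump, jumpPre, blockLen]

/-- The program that simulates the machine; the block of the state `q` starts at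
`q * blockLen κ`. -/
def toLin : LinProgram κ where
  len := M.size * blockLen κ
  instr a := if h : a / blockLen κ < M.size then
      (block (a / blockLen κ * blockLen κ) (fun t : Fin (M.size + 1) => t * blockLen κ) (M.op ⟨_, h⟩)).getD
        (a % blockLen κ) (.add .zero .zero .zero)
    else .add .zero .zero .zero

theorem at_block (q : Fin M.size) : M.toLin.At (q * blockLen κ)
    (block (q * blockLen κ) (fun t : Fin (M.size + 1) => t * blockLen κ) (M.op q)) := by
  intro j hj
  have h1 := hj.trans_le (length_block_le _ _ _)
  have h2 : (q * blockLen κ + j) / blockLen κ = q := by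
    rw [mul_comm, Nat.mul_add_div (by omega), Nat.div_eq_of_lt h1, add_zero]
  have h3 : (q * blockLen κ + j) % blockLen κ = j := by
    rw [mul_comm, Nat.mul_add_mod, Nat.mod_eq_of_lt h1]
  constructor
  · simp only [toLin, h2, h3, q.2, dif_pos]
    simp [hj]
  · calc q * blockLen κ + j < (q + 1) * blockLen κ := by rw [add_mul]; omega
      _ ≤ _ := Nat.mul_le_mul_right _ q.2

/-- The number `x` represents the list of bits at the scale `m`. -/
def Enc (m : ℤ) : List Bool → ℤ → Prop
  | [], x => x = 0
  | b :: l, x => Enc m l (8 * x - if b then 4 * m else 0)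

/-- The extreme case is a stack of `true` bits only, where `4/8 + 4/64 + ⋯ = 4/7`. The gap between
the two possible top bits rests on this bound. -/
theorem Enc.bounds {m : ℤ} (hm : 0 ≤ m) {l : List Bool} {x : ℤ} (h : Enc m l x) :
    0 ≤ x ∧ 7 * x ≤ 4 * m := by
  induction l generalizing x with
  | nil => simp only [Enc] at h; subst h; omega
  | cons b l ih => have := ih h; cases b <;> simp at this <;> omega

theorem Enc.scale {m : ℤ} {l : List Bool} {x : ℤ} (h : Enc m l x) : Enc (8 * m) l (8 * x) := by
  induction l generalizing x with
  | nil => simp only [Enc] at h ⊢; omega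
  | cons b l ih =>
    have := ih h
    simp only [Enc]
    convert this using 1
    cases b <;> simp
    ring

/-- By `Enc.scale` the old list is represented by `8 * x` at the scale `8 * m`, and this is what is
left of `x + 4 * m` or of `x` once the first digit is removed. -/
theorem Enc.push {m : ℤ} {l : List Bool} {x : ℤ} (h : Enc m l x) (b : Bool) :
    Enc (8 * m) (b :: l) (x + if b then 4 * m else 0) := by
  have := h.scale
  simp only [Enc]
  convert this using 1
  cases b <;> simp
  ring

theorem Enc.pop {m : ℤ} {l : List Bool} {x : ℤ} (h : Enc m l x) :
    Enc m l.tail (8 * x - if l.headD false then 4 * m else 0) := by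
  cases l with
  | nil => simp only [Enc] at h; subst h; simp [Enc]
  | cons b l => exact h

/-- The values of the counters represent the stacks. -/
structure Represents (s : Fin κ → List Bool) (v : Ctr κ → ℤ) : Prop where
  left : 0 ≤ v .left
  right : 0 ≤ v .right
  scale : 0 < v .scale
  zero : v .zero = 0
  stack : ∀ k, Enc (v .scale) (s k) (v (.stack k))

namespace Represents

variable {s : Fin κ → List Bool} {v : Ctr κ → ℤ}

theorem nonneg (h : Represents s v) (x : Ctr κ) : 0 ≤ v x := by
  cases x with
  | left => exact h.left
  | right => exact h.right
  | scale => exact h.scale.le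
  | zero => exact h.zero.ge
  | stack k => exact ((h.stack k).bounds h.scale.le).1

theorem le_scale (h : Represents s v) {x : Ctr κ} (h1 : x ≠ .left) (h2 : x ≠ .right) :
    v x ≤ v .scale := by
  cases x with
  | left => exact absurd rfl h1
  | right => exact absurd rfl h2
  | scale => exact le_rfl
  | zero => rw [h.zero]; exact h.scale.le
  | stack k => have := (h.stack k).bounds h.scale.le; have := h.scale; omega

theorem of_eq (h : Represents s v) {v' : Ctr κ → ℤ} (h1 : 0 ≤ v' .left) (h2 : 0 ≤ v' .right)
    (h3 : ∀ x, x ≠ .left → x ≠ .right → v' x = v x) : Represents s v' where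
  left := h1
  right := h2
  scale := by rw [h3 _ (by simp) (by simp)]; exact h.scale
  zero := by rw [h3 _ (by simp) (by simp)]; exact h.zero
  stack k := by
    rw [h3 _ (by simp) (by simp), h3 _ (by simp) (by simp)]
    exact h.stack k

theorem path_jump (h : Represents s v) {p : LinProgram κ} {a t : ℕ}
    (ha : p.At a (LinProgram.jump t)) (ht : t ≤ p.len) :
    ∃ v', p.Path 8 (a, v) (t, v') ∧ Represents s v' := by
  refine ⟨_, ha.path_jump ht h.nonneg h.zero fun z h1 h2 => ?_, h.of_eq ?_ ?_ fun x h1 h2 => ?_⟩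
  · have := h.le_scale h1 h2
    have := h.scale
    omega
  · simpa using h.scale.le
  · simp
  · simp [h1, h2]

end Represents

section
variable {s : Fin κ → List Bool} {v : Ctr κ → ℤ} {p : LinProgram κ}

theorem exec_octupleOthers (k : Fin κ) (v : Ctr κ → ℤ) :
    AddList.exec (octupleOthers k) v = fun x => match x with
      | .stack j => if j = k then v (.stack j) else 8 * v (.stack j)
      | x => v x := by
  have key : ∀ l : List (Fin κ), l.Nodup → ∀ v : Ctr κ → ℤ,
      AddList.exec (l.flatMap fun j => octuple (.stack j)) v = fun x => match x with
        | .stack j => if j ∈ l then 8 * v (.stack j) else v (.stack j)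
        | x => v x := by
    intro l hl
    induction l with
    | nil => intro v; funext x; cases x <;> simp [AddList.exec]
    | cons j l ih =>
      intro v
      obtain ⟨h1, h2⟩ := List.nodup_cons.1 hl
      rw [List.flatMap_cons, AddList.exec_append, ih h2, octuple, AddList.exec_replicate]
      funext x
      cases x with
      | stack i =>
        by_cases hi : i = j
        · subst hi; simp [h1]
        · simp [hi]
      | _ => simp
  rw [octupleOthers, key _ ((List.nodup_finRange κ).filter _)]
  funext x
  cases x with
  | stack j => by_cases h : j = k <;> simp [h]
  | _ => rfl

theorem Represents.exec_pushAdds (h : Represents s v) (k : Fin κ) (b : Bool) :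
    Represents (Function.update s k (b :: s k)) (AddList.exec (pushAdds k b) v) := by
  have h1 := h.scale
  have h2 := h.left
  have h3 := h.right
  have h4 := h.zero
  constructor
  · exact AddList.exec_nonneg h.nonneg _
  · exact AddList.exec_nonneg h.nonneg _
  · cases b <;> simp [pushAdds, exec_octupleOthers, octuple,
      AddList.exec, loadFour, h1]
  · cases b <;> simp [pushAdds, exec_octupleOthers, octuple,
      AddList.exec, loadFour, h4]
  · intro j
    by_cases hj : j = k
    · subst hj
      have := (h.stack j).push b
      rw [Function.update_self]
      convert this using 1
      · cases b <;> simp [pushAdds, exec_octupleOthers, octuple,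
          AddList.exec, loadFour] <;> ring
      · cases b <;> simp [pushAdds, exec_octupleOthers, octuple,
          AddList.exec, loadFour]
        ring
    · have := (h.stack j).scale
      rw [Function.update_of_ne hj]
      convert this using 1
      · cases b <;> simp [pushAdds, exec_octupleOthers, octuple,
          AddList.exec, loadFour] <;> ring
      · cases b <;> simp [pushAdds, exec_octupleOthers, octuple,
          AddList.exec, loadFour, hj]

theorem exec_popAdds (k : Fin κ) (v : Ctr κ → ℤ) : AddList.exec (popAdds k) v =
    Function.update (Function.update v .left (640 * v (.stack k))) .right (64 * v .scale) := by
  simp only [popAdds, AddList.exec_append, AddList.exec, AddList.exec_replicate, List.cons_append,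
    List.nil_append]
  funext x
  cases x <;> simp <;> ring

theorem exec_octuple_loadFour (k : Fin κ) (v : Ctr κ → ℤ) :
    AddList.exec (octuple (.stack k) ++ loadFour) v =
    Function.update (Function.update v (.stack k) (8 * v (.stack k))) .left (4 * v .scale) := by
  simp only [octuple, loadFour, AddList.exec_append, AddList.exec, AddList.exec_replicate]
  funext x
  by_cases hx : x = .left
  · subst hx; simp; try ring
  · simp [hx]

/-- Running the block of a push operation. -/
theorem Represents.path_push {S : Type} (h : Represents s v) {a : ℕ} {f : S → ℕ} {k : Fin κ}
    {b : Bool} {t : S} (ha : p.At a (block a f (.push k b t))) (ht : f t ≤ p.len) :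
    ∃ n v', 0 < n ∧ n ≤ blockLen κ ∧ p.Path n (a, v) (f t, v') ∧
      Represents (Function.update s k (b :: s k)) v' := by
  have hl := length_block_le a f (.push k b t : BitOp κ S)
  obtain ⟨h1, h2⟩ := ha.append
  have p1 := h1.path_adds h.nonneg
  have h3 := h.exec_pushAdds k b
  simp only [AddList.toInstrs, List.length_map] at h2
  obtain ⟨v', p2, h4⟩ := h3.path_jump h2 ht
  refine ⟨_, v', ?_, ?_, p1.trans p2, h4⟩
  · omega
  · simpa [block, AddList.toInstrs, LinProgram.jump, jumpPre] using hl

theorem Represents.pop (h : Represents s v) (k : Fin κ) {v' : Ctr κ → ℤ} (h1 : 0 ≤ v' .left)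
    (h2 : 0 ≤ v' .right) (h3 : v' (.stack k) =
      8 * v (.stack k) - if (s k).headD false then 4 * v .scale else 0)
    (h4 : ∀ x, x ≠ .left → x ≠ .right → x ≠ .stack k → v' x = v x) :
    Represents (Function.update s k (s k).tail) v' where
  left := h1
  right := h2
  scale := by rw [h4 _ (by simp) (by simp) (by simp)]; exact h.scale
  zero := by rw [h4 _ (by simp) (by simp) (by simp)]; exact h.zero
  stack j := by
    rw [h4 .scale (by simp) (by simp) (by simp)]
    by_cases hj : j = k
    · subst hj
      rw [Function.update_self, h3]
      exact (h.stack j).pop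
    · rw [Function.update_of_ne hj, h4 _ (by simp) (by simp) (by simpa using hj)]
      exact h.stack j

/-- Running the block of a pop operation. -/
theorem Represents.path_pop {S : Type} (h : Represents s v) {a : ℕ} {f : S → ℕ} {k : Fin κ}
    {t₀ t₁ : S} (ha : p.At a (block a f (.pop k t₀ t₁))) (ht₀ : f t₀ ≤ p.len)
    (ht₁ : f t₁ ≤ p.len) :
    ∃ n v', 0 < n ∧ n ≤ blockLen κ ∧
      p.Path n (a, v) (f (if (s k).headD false then t₁ else t₀), v') ∧
      Represents (Function.update s k (s k).tail) v' := by
  obtain ⟨h1, h2⟩ := ha.append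
  have p1 := h1.path_adds h.nonneg
  have n1 := AddList.exec_nonneg (l := popAdds k) h.nonneg
  rw [show (popAdds k).toInstrs.length = 16 from rfl] at h2
  obtain ⟨⟨h3, h4⟩, h5⟩ := h2.cons
  obtain ⟨h6, h7⟩ := h5.append
  rw [show (octuple (Ctr.stack k)).toInstrs.length = 3 from rfl] at h7
  obtain ⟨h8, h9⟩ := h7.append
  rw [show (LinProgram.jump (κ := κ) (f t₀)).length = 8 from rfl] at h9
  obtain ⟨h10, h11⟩ := h9.append
  rw [show (AddList.toInstrs (octuple (Ctr.stack k) ++ loadFour)).length = 5 from rfl] at h11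
  obtain ⟨⟨h12, h13⟩, h14⟩ := h11.cons
  have hsc := h.scale
  have hp := (h.stack k).pop
  have hpb := hp.bounds hsc.le
  have hkb := (h.stack k).bounds hsc.le
  rw [show (popAdds k).length = 16 from rfl, exec_popAdds] at p1
  rw [exec_popAdds] at n1
  have p2 := path_test h4 h3 (by omega) n1 (by simp) (by simp) fun z hz1 hz2 => by
    have := h.le_scale hz1 hz2
    rw [Function.update_of_ne hz2, Function.update_of_ne hz1, Function.update_self,
      Function.update_of_ne (by simp), Function.update_self]
    -- If the top bit is `true`, then `8x ≥ 4m`, so `640x - 64m ≥ 256m`. Otherwise `56x ≤ 4m`, so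
    -- `64m - 640x > 18m`. Other counters are at most `m`.
    split at hpb
    · rw [abs_of_nonneg] <;> omega
    · rw [abs_of_nonpos] <;> omega
  simp only [Function.update_self, Function.update_of_ne (show Ctr.left ≠ .right by simp)] at p2
  have p12 := p1.trans p2
  set v₁ := Function.update (Function.update v .left (640 * v (.stack k))) .right (64 * v .scale)
    with hv₁
  have hv₁' : ∀ x, x ≠ .left → x ≠ .right → v₁ x = v x := fun x h1 h2 => by simp [hv₁, h1, h2]
  have hsc₁ := hv₁' .scale (by simp) (by simp)
  have hk₁ := hv₁' (.stack k) (by simp) (by simp)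
  by_cases hb : (s k).headD false = true
  · rw [if_pos hb] at hp hpb
    rw [if_pos (by omega)] at p12
    simp only [hb, if_true]
    have p3 := h10.path_adds n1
    have n3 := AddList.exec_nonneg (l := octuple (Ctr.stack k) ++ loadFour) n1
    rw [show List.length (octuple (Ctr.stack k) ++ loadFour) = 5 from rfl] at p3
    rw [exec_octuple_loadFour, hsc₁, hk₁] at p3 n3
    set v₂ := Function.update (Function.update v₁ (.stack k) (8 * v (.stack k))) .left
      (4 * v .scale) with hv₂
    have p4 : p.Path 1 (a + 16 + 1 + 3 + 8 + 5, v₂) (a + 16 + 1 + 3 + 8 + 5 + 1,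
        Function.update v₂ (.stack k) (8 * v (.stack k) - 4 * v .scale)) := by
      refine Path.single ⟨n3, by simp [h12]⟩ h13 ?_
      rw [LinProgram.step, if_pos h13]
      simp [h12, hv₂]
    have hr : Represents (Function.update s k (s k).tail)
        (Function.update v₂ (.stack k) (8 * v (.stack k) - 4 * v .scale)) := by
      refine h.pop k (by simpa [hv₂] using hsc.le) (by simpa [hv₂] using n1 .right)
        (by rw [if_pos hb]; simp) ?_
      intro x hx1 hx2 hx3
      rw [Function.update_of_ne hx3, hv₂, Function.update_of_ne hx1, Function.update_of_ne hx3,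
        hv₁' x hx1 hx2]
    obtain ⟨v', p5, h15⟩ := hr.path_jump h14 ht₁
    exact ⟨_, v', by norm_num, by simp [blockLen], ((p12.trans p3).trans p4).trans p5, h15⟩
  · rw [if_neg hb] at hp hpb
    rw [if_neg (by omega)] at p12
    rw [if_neg hb]
    have p3 := h6.path_adds n1
    rw [show (octuple (Ctr.stack k)).length = 3 from rfl, octuple, AddList.exec_replicate,
      hk₁] at p3
    have hr : Represents (Function.update s k (s k).tail)
        (Function.update v₁ (.stack k) (2 ^ 3 * v (.stack k))) := by
      refine h.pop k (by simpa using n1 .left) (by simpa using n1 .right)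
        (by rw [if_neg hb]; simp) ?_
      intro x hx1 hx2 hx3
      rw [Function.update_of_ne hx3, hv₁' x hx1 hx2]
    obtain ⟨v', p4, h15⟩ := hr.path_jump h8 ht₀
    exact ⟨_, v', by norm_num, by simp [blockLen], (p12.trans p3).trans p4, h15⟩

theorem exists_path_step {c : M.Cfg} (hc : (c.1 : ℕ) < M.size) (h : Represents c.2 v) :
    ∃ n v', 0 < n ∧ n ≤ blockLen κ ∧ M.toLin.Path n (c.1 * blockLen κ, v)
      ((M.step c).1 * blockLen κ, v') ∧ Represents (M.step c).2 v' := by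
  have hle : ∀ t : Fin (M.size + 1), t * blockLen κ ≤ M.toLin.len := fun t =>
    Nat.mul_le_mul_right _ (Nat.lt_succ_iff.1 t.2)
  have ha := M.at_block ⟨c.1, hc⟩
  unfold step
  simp only [hc, dif_pos]
  cases ho : M.op ⟨c.1, hc⟩ with
  | push k b t =>
    rw [ho] at ha
    exact h.path_push ha (hle t)
  | pop k t₀ t₁ =>
    rw [ho] at ha
    exact h.path_pop ha (hle t₀) (hle t₁)
  | jump t =>
    rw [ho] at ha
    obtain ⟨v', h1, h2⟩ := h.path_jump ha (hle t)
    exact ⟨8, v', by norm_num, by simp [blockLen], h1, h2⟩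

/-- The upper bound on `n` gives the time bound for accepting runs. The lower bound shows that a
machine that never halts yields arbitrarily long paths. -/
theorem exists_path_iterate {c : M.Cfg} (h : Represents c.2 v) (j : ℕ)
    (hj : ∀ i < j, ((M.step^[i] c).1 : ℕ) < M.size) :
    ∃ n v', j ≤ n ∧ n ≤ j * blockLen κ ∧ M.toLin.Path n (c.1 * blockLen κ, v)
      ((M.step^[j] c).1 * blockLen κ, v') ∧ Represents (M.step^[j] c).2 v' := by
  induction j with
  | zero => exact ⟨0, v, le_rfl, Nat.zero_le _, LinProgram.Path.refl _, h⟩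
  | succ j ih =>
    obtain ⟨n, v₁, h1, h2, h3, h4⟩ := ih fun i hi => hj i (by omega)
    obtain ⟨n', v', h5, h6, h7, h8⟩ := M.exists_path_step (hj j (by omega)) h4
    rw [Function.iterate_succ_apply']
    exact ⟨n + n', v', by omega, by rw [add_mul]; omega, h3.trans h7, h8⟩

end

section
variable {s : Fin κ → List Bool} {init : Ctr κ → ℕ}

/-- The counter program that simulates the machine. -/
def toCP (init : Ctr κ → ℕ) : CounterProgram := M.toLin.toCP init

/-- Paths visit good configurations only. If the machine halts, the path reaches the end of the
program, where the configuration is fixed and no test stands; otherwise every step of the program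
lies on some path. -/
theorem isSimple_toCP (h : Represents s fun x => (init x : ℤ)) : (M.toCP init).IsSimple := by
  classical
  refine LinProgram.isSimple_toCP fun k => ?_
  by_cases hM : ∃ j, ¬ ((M.step^[j] (0, s)).1 : ℕ) < M.size
  · obtain ⟨n, v', h1, h2, h3, h4⟩ := M.exists_path_iterate (c := (0, s)) h (Nat.find hM)
      fun i hi => not_not.1 (Nat.find_min hM hi)
    have h5 := Nat.find_spec hM
    generalize M.step^[Nat.find hM] (0, s) = d at *
    simp only [Fin.val_zero, zero_mul] at h3
    rcases lt_or_ge k n with hk | hk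
    · exact (h3.2 k hk).1
    · obtain ⟨i, rfl⟩ := Nat.exists_eq_add_of_le' hk
      have h6 : (d.1 : ℕ) = M.size := by omega
      have h7 : M.toLin.step (d.1 * blockLen κ, v') = (d.1 * blockLen κ, v') := by
        simp [LinProgram.step, toLin, h6]
      rw [Function.iterate_add_apply, h3.1, Function.iterate_fixed h7]
      refine ⟨h4.nonneg, fun x b y t ht => ?_⟩
      have h8 : ¬ d.1 * blockLen κ / blockLen κ < M.size := by
        rw [Nat.mul_div_cancel _ (by simp [blockLen])]; exact h5
      simp [toLin, h8] at ht
  · push Not at hM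
    obtain ⟨n, v', h1, h2, h3, h4⟩ := M.exists_path_iterate (c := (0, s)) h (k + 1) fun i _ => hM i
    simp only [Fin.val_zero, zero_mul] at h3
    exact (h3.2 k (by omega)).1

theorem haltsWithin_toCP (h : Represents s fun x => (init x : ℤ)) {N T : ℕ}
    (hN : T * blockLen κ ≤ N) (hT : (M.step^[T] (0, s)).1 = Fin.last M.size) :
    (M.toCP init).HaltsWithin N := by
  classical
  have hM : ∃ j, (M.step^[j] (0, s)).1 = Fin.last M.size := ⟨T, hT⟩
  obtain ⟨n, v', h1, h2, h3, h4⟩ := M.exists_path_iterate (c := (0, s)) h (Nat.find hM)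
    fun i hi => Fin.val_lt_last (Nat.find_min hM hi)
  refine LinProgram.haltsWithin_toCP.2 ⟨n, ?_, ?_⟩
  · exact h2.trans ((Nat.mul_le_mul_right _ (Nat.find_min' hM hT)).trans hN)
  · simp only [Fin.val_zero, zero_mul] at h3
    rw [h3.1, Nat.find_spec hM]
    rfl

theorem not_haltsWithin_toCP (h : Represents s fun x => (init x : ℤ)) (N : ℕ)
    (hM : ∀ j, (M.step^[j] (0, s)).1 ≠ Fin.last M.size) : ¬ (M.toCP init).HaltsWithin N := by
  rintro hN
  obtain ⟨k, -, hk⟩ := LinProgram.haltsWithin_toCP.1 hN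
  obtain ⟨n, v', h1, h2, h3, h4⟩ := M.exists_path_iterate (c := (0, s)) h (k + 1)
    fun i _ => Fin.val_lt_last (hM i)
  simp only [Fin.val_zero, zero_mul] at h3
  exact absurd hk (h3.2 k (by omega)).2.ne

end

end BitMachine

/-! ## Simulation of multi-stack machines by bit-stack machines -/

namespace BitOp

variable {κ : ℕ} {S S' : Type}

def map (f : S → S') : BitOp κ S → BitOp κ S'
  | push k b t => push k b (f t)
  | pop k t₀ t₁ => pop k (f t₀) (f t₁)
  | jump t => jump (f t)

def All (P : S → Prop) : BitOp κ S → Prop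
  | push _ _ t => P t
  | pop _ t₀ t₁ => P t₀ ∧ P t₁
  | jump t => P t

theorem apply_map (f : S → S') (s : Fin κ → List Bool) (o : BitOp κ S) :
    (o.map f).apply s = Prod.map f id (o.apply s) := by
  cases o with
  | pop k t₀ t₁ => simp only [map, apply]; split <;> rfl
  | _ => rfl

theorem All.apply {P : S → Prop} {o : BitOp κ S} (h : o.All P) (s : Fin κ → List Bool) :
    P (o.apply s).1 := by
  cases o with
  | pop k t₀ t₁ =>
    simp only [BitOp.apply]
    split
    · exact h.2
    · exact h.1
  | _ => exact h

/-- A step of a machine with states `S` and a halting state `none`. -/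
def step (op : S → BitOp κ (Option S)) (c : Option S × (Fin κ → List Bool)) :
    Option S × (Fin κ → List Bool) :=
  match c.1 with
  | none => c
  | some q => (op q).apply c.2

theorem step_iterate_none (op : S → BitOp κ (Option S)) (s : Fin κ → List Bool) (j : ℕ) :
    (step op)^[j] (none, s) = (none, s) :=
  Function.iterate_fixed rfl j

theorem exists_bitMachine {F : Finset S} {q₀ : S} (h₀ : q₀ ∈ F) (op : S → BitOp κ (Option S))
    (hF : ∀ q ∈ F, (op q).All fun t => ∀ r ∈ t, r ∈ F) :
    ∃ M : BitMachine κ, ∀ s j, (M.step^[j] (0, s)).1 = Fin.last M.size ↔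
      ((step op)^[j] (some q₀, s)).1 = none := by
  classical
  have hpos : 0 < F.card := Finset.card_pos.2 ⟨_, h₀⟩
  let z : Fin F.card := ⟨0, hpos⟩
  -- The transposition gives the initial state the number `0`, at which a `BitMachine` is started.
  let g : F ≃ Fin F.card := F.equivFin.trans (Equiv.swap (F.equivFin ⟨q₀, h₀⟩) z)
  have hg : g ⟨q₀, h₀⟩ = z := by simp [g]
  let f : Option S → Fin (F.card + 1) := fun t => match t with
    | none => Fin.last _
    | some r => if h : r ∈ F then (g ⟨r, h⟩).castSucc else Fin.last _
  let M : BitMachine κ := ⟨F.card, fun i => (op (g.symm i)).map f⟩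
  have hstep : ∀ c : Option S × (Fin κ → List Bool), (∀ r ∈ c.1, r ∈ F) →
      M.step (Prod.map f id c) = Prod.map f id (step op c) ∧ ∀ r ∈ (step op c).1, r ∈ F := by
    rintro ⟨_ | q, s⟩ hc
    · refine ⟨?_, hc⟩
      simp [BitMachine.step, step, f, M]
    · have hq : q ∈ F := hc q rfl
      refine ⟨?_, (hF q hq).apply s⟩
      have e1 : (Prod.map f id (some q, s) : M.Cfg) = ((g ⟨q, hq⟩).castSucc, s) := by
        simp [f, hq]
      have e2 : ((g ⟨q, hq⟩).castSucc : ℕ) < M.size := (g ⟨q, hq⟩).2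
      rw [e1, BitMachine.step, dif_pos e2]
      simp only [M, step, Fin.val_castSucc, Fin.eta, Equiv.symm_apply_apply, apply_map]
  refine ⟨M, fun s j => ?_⟩
  have key : M.step^[j] (0, s) = Prod.map f id ((step op)^[j] (some q₀, s)) ∧
      ∀ r ∈ ((step op)^[j] (some q₀, s)).1, r ∈ F := by
    induction j with
    | zero =>
      refine ⟨?_, by simpa using h₀⟩
      simp only [Function.iterate_zero, id, Prod.map, f, h₀, dif_pos, hg]
      rfl
    | succ j ih =>
      rw [Function.iterate_succ_apply', Function.iterate_succ_apply', ih.1]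
      exact hstep _ ih.2
  rw [key.1]
  generalize (step op)^[j] (some q₀, s) = c at key
  obtain ⟨_ | q, s'⟩ := c
  · simp [f, M]
  · have hq : q ∈ F := key.2 q rfl
    simp only [Prod.map, f, hq, dif_pos, reduceCtorEq, iff_false]
    exact (g ⟨q, hq⟩).castSucc_lt_last.ne

end BitOp

namespace StackSim

open Turing TM2

inductive Tag
  | run | put | emit | read | chk | rej
  deriving DecidableEq

instance : Fintype Tag where
  elems := {.run, .put, .emit, .read, .chk, .rej}
  complete t := by cases t <;> simp

variable {K : Type} {Γ : K → Type} {Λ σ : Type} {κ : ℕ}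

open Classical in
/-- A symbol is coded by a positive number, by its place in a list of symbols. -/
noncomputable def symCode (used : List (Σ k, Γ k)) (a : Σ k, Γ k) : ℕ := used.idxOf a + 1

open Classical in
noncomputable def decode (used : List (Σ k, Γ k)) (k : K) (n : ℕ) : Option (Γ k) :=
  if h : ∃ a, (⟨k, a⟩ : Σ k, Γ k) ∈ used ∧ symCode used ⟨k, a⟩ = n then some h.choose else none

theorem symCode_le (used : List (Σ k, Γ k)) (a : Σ k, Γ k) : symCode used a ≤ used.length + 1 := by
  classical exact Nat.succ_le_succ List.idxOf_le_length

theorem symCode_inj {used : List (Σ k, Γ k)} {a b : Σ k, Γ k} (ha : a ∈ used)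
    (h : symCode used a = symCode used b) : a = b := by
  classical exact (List.idxOf_inj ha).1 (Nat.succ_injective h)

/-- Symbol codes are positive, so reading no `true` at all can only mean that the stack is empty. -/
theorem decode_zero (used : List (Σ k, Γ k)) (k : K) : decode used k 0 = none := by
  simp [decode, symCode]

theorem decode_symCode {used : List (Σ k, Γ k)} {k : K} {a : Γ k}
    (h : (⟨k, a⟩ : Σ k, Γ k) ∈ used) : decode used k (symCode used ⟨k, a⟩) = some a := by
  have h' : ∃ b, (⟨k, b⟩ : Σ k, Γ k) ∈ used ∧ symCode used ⟨k, b⟩ = symCode used ⟨k, a⟩ :=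
    ⟨a, h, rfl⟩
  rw [decode, dif_pos h']
  have := symCode_inj h'.choose_spec.1 h'.choose_spec.2
  simpa using this

theorem symCode_of_decode {used : List (Σ k, Γ k)} {k : K} {n : ℕ} {a : Γ k}
    (h : decode used k n = some a) : symCode used ⟨k, a⟩ = n := by
  unfold decode at h
  split at h
  · rename_i h'
    obtain rfl := Option.some_injective _ h
    exact h'.choose_spec.2
  · simp at h

/-- The bits that code a stack. -/
noncomputable def enc (used : List (Σ k, Γ k)) (k : K) (l : List (Γ k)) : List Bool :=
  l.flatMap fun a => List.replicate (symCode used ⟨k, a⟩) true ++ [false]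

variable (e : K ≃ Fin κ) (used : List (Σ k, Γ k)) (m : Λ → Stmt Γ Λ σ) (k₁ : K) (acc : ℕ)

/-- The operations of the simulator. After the machine has halted, the top of the stack `k₁` is
compared with the symbol with code `acc`. -/
noncomputable def op : Tag × Stmt Γ Λ σ × σ × ℕ → BitOp κ (Option (Tag × Stmt Γ Λ σ × σ × ℕ))
  | (.run, .push k f q, v, _) => .push (e k) false (some (.emit, .push k f q, v, symCode used ⟨k, f v⟩))
  | (.run, .peek k f q, v, _) => .jump (some (.read, .peek k f q, v, 0))
  | (.run, .pop k f q, v, _) => .jump (some (.read, .pop k f q, v, 0))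
  | (.run, .load a q, v, _) => .jump (some (.run, q, a v, 0))
  | (.run, .branch f q₁ q₂, v, _) => .jump (some (.run, cond (f v) q₁ q₂, v, 0))
  | (.run, .goto f, v, _) => .jump (some (.run, m (f v), v, 0))
  | (.run, .halt, v, _) => .jump (some (.chk, .halt, v, 0))
  | (.put, .peek k f q, v, n) => .push (e k) false (some (.emit, .peek k f q, v, n))
  | (.emit, .push _ _ q, v, 0) => .jump (some (.run, q, v, 0))
  | (.emit, .push k f q, v, n + 1) => .push (e k) true (some (.emit, .push k f q, v, n))
  | (.emit, .peek _ _ q, v, 0) => .jump (some (.run, q, v, 0))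
  | (.emit, .peek k f q, v, n + 1) => .push (e k) true (some (.emit, .peek k f q, v, n))
  -- The symbol is read destructively and then written back, unless the stack was empty. The minimum
  -- only keeps the set of states finite; it has no effect while codes of used symbols are read.
  | (.read, .peek k f q, v, n) =>
    .pop (e k) (some (if n = 0 then (.run, q, f v none, 0)
      else (.put, .peek k f q, f v (decode used k n), n)))
      (some (.read, .peek k f q, v, min (n + 1) (used.length + 1)))
  | (.read, .pop k f q, v, n) =>
    .pop (e k) (some (.run, q, f v (decode used k n), 0))
      (some (.read, .pop k f q, v, min (n + 1) (used.length + 1)))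
  | (.chk, q, v, n) =>
    .pop (e k₁) (if n = acc then none else some (.rej, q, v, n))
      (some (.chk, q, v, min (n + 1) (used.length + 1)))
  | r => .jump (some r)

/-- The symbols that a statement may push. -/
noncomputable def pushes [Fintype σ] : Stmt Γ Λ σ → List (Σ k, Γ k)
  | .push k f q => (Finset.univ : Finset σ).toList.map (fun v => ⟨k, f v⟩) ++ pushes q
  | .peek _ _ q => pushes q
  | .pop _ _ q => pushes q
  | .load _ q => pushes q
  | .branch _ q₁ q₂ => pushes q₁ ++ pushes q₂
  | .goto _ => []
  | .halt => []

/-- A bound for the number of steps that simulate a statement. -/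
def weight (C : ℕ) : Stmt Γ Λ σ → ℕ
  -- The constant fits a peek: 1 step to begin, at most `C + 1` to read, 2 for the separator, and at
  -- most `C + 2` to write back.
  | .push _ _ q => weight C q + (2 * C + 6)
  | .peek _ _ q => weight C q + (2 * C + 6)
  | .pop _ _ q => weight C q + (2 * C + 6)
  | .load _ q => weight C q + 1
  | .branch _ q₁ q₂ => weight C q₁ + weight C q₂ + 1
  | .goto _ => 1
  | .halt => 1

/-- The configuration of the simulator for a configuration of the machine. -/
noncomputable def corr (c : TM2.Cfg Γ Λ σ) :
    Option (Tag × Stmt Γ Λ σ × σ × ℕ) × (Fin κ → List Bool) :=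
  (some (match c.l with
    | some l => (.run, m l, c.var, 0)
    | none => (.chk, .halt, c.var, 0)), fun i => enc used (e.symm i) (c.stk (e.symm i)))

/-- All symbols on the stacks are used. -/
def Used (S : ∀ k, List (Γ k)) : Prop := ∀ k, ∀ a ∈ S k, (⟨k, a⟩ : Σ k, Γ k) ∈ used

open BitOp

/-- `j ≤ n` steps lead from `c` to `c'`. -/
def Within {S : Type} (o : S → BitOp κ (Option S)) (n : ℕ) (c c' : Option S × (Fin κ → List Bool)) :
    Prop := ∃ j ≤ n, (BitOp.step o)^[j] c = c'

section
variable {S : Type} {o : S → BitOp κ (Option S)} {c c' c'' : Option S × (Fin κ → List Bool)}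

theorem Within.refl (n : ℕ) : Within o n c c := ⟨0, Nat.zero_le _, rfl⟩

theorem Within.trans {n n' : ℕ} (h : Within o n c c') (h' : Within o n' c' c'') :
    Within o (n + n') c c'' := by
  obtain ⟨j, hj, rfl⟩ := h
  obtain ⟨j', hj', rfl⟩ := h'
  exact ⟨j' + j, by omega, Function.iterate_add_apply _ _ _ _⟩

theorem Within.mono {n n' : ℕ} (h : Within o n c c') (hn : n ≤ n') : Within o n' c c' := by
  obtain ⟨j, hj, h⟩ := h
  exact ⟨j, hj.trans hn, h⟩

theorem Within.trans_eq {n : ℕ} (h : Within o n c c') (h' : c' = c'') : Within o n c c'' := h' ▸ h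

/-- A halted configuration would stay halted, so reaching a fixed configuration that is not halted
excludes halting before it as well as after it. -/
theorem Within.iterate_ne_none {n : ℕ} (h : Within o n c c') (hf : BitOp.step o c' = c')
    (hne : c'.1 ≠ none) (i : ℕ) : ((BitOp.step o)^[i] c).1 ≠ none := by
  obtain ⟨j, -, hj⟩ := h
  rcases le_total i j with hij | hij
  · obtain ⟨d, rfl⟩ := Nat.exists_eq_add_of_le' hij
    rintro hi
    rw [Function.iterate_add_apply] at hj
    have h3 := BitOp.step_iterate_none o ((BitOp.step o)^[i] c).2 d
    rw [← hi, Prod.mk.eta, hj] at h3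
    exact hne (h3 ▸ hi)
  · obtain ⟨d, rfl⟩ := Nat.exists_eq_add_of_le' hij
    rw [Function.iterate_add_apply, hj, Function.iterate_fixed hf]
    exact hne

theorem Within.head {n : ℕ} (h : Within o n (BitOp.step o c) c') : Within o (n + 1) c c' := by
  obtain ⟨j, hj, rfl⟩ := h
  exact ⟨j + 1, by omega, rfl⟩

end

/-- The states of the simulator carry statements, which need not form a finite type; this exhibits a
finite set of states that is never left. -/
theorem closed {F : Finset (Stmt Γ Λ σ)} [Fintype σ] (hm : ∀ l, m l ∈ F)
    (hF : ∀ q ∈ F, stmts₁ q ⊆ F) :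
    ∀ r ∈ (Finset.univ : Finset Tag) ×ˢ F ×ˢ (Finset.univ : Finset σ) ×ˢ
      Finset.range (used.length + 2), (op e used m k₁ acc r).All fun t => ∀ r' ∈ t,
        r' ∈ (Finset.univ : Finset Tag) ×ˢ F ×ˢ (Finset.univ : Finset σ) ×ˢ
          Finset.range (used.length + 2) := by
  classical
  rintro ⟨t, q, v, n⟩ hr
  simp only [Finset.mem_product, Finset.mem_univ, true_and, Finset.mem_range] at hr
  obtain ⟨hq, hn⟩ := hr
  have hmin : min (n + 1) (used.length + 1) < used.length + 2 := by omega
  have hc := fun a => Nat.lt_succ_of_le (symCode_le used a)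
  have mk : ∀ (t : Tag) (q' : Stmt Γ Λ σ) (v : σ) (n : ℕ), q' ∈ F → n < used.length + 2 →
      ∀ r ∈ some (t, q', v, n), r ∈ (Finset.univ : Finset Tag) ×ˢ F ×ˢ (Finset.univ : Finset σ) ×ˢ
        Finset.range (used.length + 2) := by
    rintro t q' v n h1 h2 r ⟨⟩
    simp [h1, h2]
  have hchk : (BitOp.pop (e k₁) (if n = acc then none else some (.rej, q, v, n))
      (some (.chk, q, v, min (n + 1) (used.length + 1)))).All fun t => ∀ r' ∈ t,
        r' ∈ (Finset.univ : Finset Tag) ×ˢ F ×ˢ (Finset.univ : Finset σ) ×ˢ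
          Finset.range (used.length + 2) := by
    refine ⟨?_, mk _ _ _ _ hq hmin⟩
    split
    · simp
    · exact mk _ _ _ _ hq hn
  have hsub : ∀ q' ∈ stmts₁ q, q' ∈ F := fun q' h => hF q hq h
  cases q with
  | push k f q =>
    have h1 : q ∈ F := hsub _ (by simp [stmts₁, stmts₁_self])
    cases t with
    | emit => cases n with
      | zero => exact mk _ _ _ _ h1 (by omega)
      | succ n => exact mk _ _ _ _ hq (by omega)
    | run => exact mk _ _ _ _ hq (hc _)
    | chk => exact hchk
    | _ => exact mk _ _ _ _ hq hn
  | peek k f q =>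
    have h1 : q ∈ F := hsub _ (by simp [stmts₁, stmts₁_self])
    cases t with
    | emit => cases n with
      | zero => exact mk _ _ _ _ h1 (by omega)
      | succ n => exact mk _ _ _ _ hq (by omega)
    | run => exact mk _ _ _ _ hq (by omega)
    | read =>
      refine ⟨?_, mk _ _ _ _ hq hmin⟩
      split
      · exact mk _ _ _ _ h1 (by omega)
      · exact mk _ _ _ _ hq hn
    | chk => exact hchk
    | _ => exact mk _ _ _ _ hq hn
  | pop k f q =>
    have h1 : q ∈ F := hsub _ (by simp [stmts₁, stmts₁_self])
    cases t with
    | run => exact mk _ _ _ _ hq (by omega)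
    | read => exact ⟨mk _ _ _ _ h1 (by omega), mk _ _ _ _ hq hmin⟩
    | chk => exact hchk
    | _ => exact mk _ _ _ _ hq hn
  | load a q =>
    have h1 : q ∈ F := hsub _ (by simp [stmts₁, stmts₁_self])
    cases t with
    | run => exact mk _ _ _ _ h1 (by omega)
    | chk => exact hchk
    | _ => exact mk _ _ _ _ hq hn
  | branch f q₁ q₂ =>
    have h1 : cond (f v) q₁ q₂ ∈ F := by
      cases f v <;> exact hsub _ (by simp [stmts₁, stmts₁_self])
    cases t with
    | run => exact mk _ _ _ _ h1 (by omega)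
    | chk => exact hchk
    | _ => exact mk _ _ _ _ hq hn
  | goto f =>
    cases t with
    | run => exact mk _ _ _ _ (hm _) (by omega)
    | chk => exact hchk
    | _ => exact mk _ _ _ _ hq hn
  | halt =>
    cases t with
    | run => exact mk _ _ _ _ hq (by omega)
    | chk => exact hchk
    | _ => exact mk _ _ _ _ hq hn

section
variable {e used m k₁ acc} {s : Fin κ → List Bool}

theorem within_emit_push (k : K) (f : σ → Γ k) (q : Stmt Γ Λ σ) (v : σ) (n : ℕ) :
    Within (op e used m k₁ acc) (n + 1) (some (.emit, .push k f q, v, n), s)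
      (some (.run, q, v, 0), Function.update s (e k) (List.replicate n true ++ s (e k))) := by
  induction n generalizing s with
  | zero => exact ⟨1, le_rfl, by simp [BitOp.step, op, BitOp.apply]⟩
  | succ n ih =>
    refine Within.head ((ih (s := Function.update s (e k) (true :: s (e k)))).trans_eq ?_)
    simp [List.replicate_succ']

theorem within_emit_peek (k : K) (f : σ → Option (Γ k) → σ) (q : Stmt Γ Λ σ) (v : σ) (n : ℕ) :
    Within (op e used m k₁ acc) (n + 1) (some (.emit, .peek k f q, v, n), s)
      (some (.run, q, v, 0), Function.update s (e k) (List.replicate n true ++ s (e k))) := by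
  induction n generalizing s with
  | zero => exact ⟨1, le_rfl, by simp [BitOp.step, op, BitOp.apply]⟩
  | succ n ih =>
    refine Within.head ((ih (s := Function.update s (e k) (true :: s (e k)))).trans_eq ?_)
    simp [List.replicate_succ']

/-- The hypothesis `h` captures what reading for a pop, reading for a peek and the final check have
in common. -/
theorem within_read (k : K) (q' : Tag × Stmt Γ Λ σ) (v : σ) (n i : ℕ) (r : List Bool)
    (hn : n + i ≤ used.length + 1) (hs : s (e k) = List.replicate i true ++ r)
    (h : ∀ n, ∃ t, op e used m k₁ acc (q'.1, q'.2, v, n) =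
      .pop (e k) t (some (q'.1, q'.2, v, min (n + 1) (used.length + 1)))) :
    Within (op e used m k₁ acc) i (some (q'.1, q'.2, v, n), s)
      (some (q'.1, q'.2, v, n + i), Function.update s (e k) r) := by
  induction i generalizing s n with
  | zero => exact ⟨0, le_rfl, by simp [show s (e k) = r by simpa using hs]⟩
  | succ i ih =>
    obtain ⟨t, ht⟩ := h n
    have e1 : BitOp.step (op e used m k₁ acc) (some (q'.1, q'.2, v, n), s) =
        (some (q'.1, q'.2, v, n + 1),
          Function.update s (e k) (List.replicate i true ++ r)) := by
      simp [BitOp.step, ht, BitOp.apply, hs, List.replicate_succ]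
      omega
    refine Within.head ?_
    rw [e1]
    have := ih (s := Function.update s (e k) (List.replicate i true ++ r)) (n + 1) (by omega)
      (by simp)
    refine this.trans_eq ?_
    simp
    omega

variable (e used) in
/-- The bits that code all stacks. -/
noncomputable def encAll (S : ∀ k, List (Γ k)) (i : Fin κ) : List Bool :=
  enc used (e.symm i) (S (e.symm i))

theorem encAll_apply (S : ∀ k, List (Γ k)) (k : K) : encAll e used S (e k) = enc used k (S k) := by
  rw [encAll]
  generalize h : e.symm (e k) = k'
  obtain rfl : k = k' := by simpa using h
  rfl

theorem encAll_update [DecidableEq K] (S : ∀ k, List (Γ k)) (k : K) (l : List (Γ k)) :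
    encAll e used (Function.update S k l) =
      Function.update (encAll e used S) (e k) (enc used k l) := by
  funext i
  obtain ⟨j, rfl⟩ := e.surjective i
  by_cases h : j = k
  · subst h; simp [encAll_apply]
  · simp [encAll_apply, h]

theorem enc_cons (k : K) (a : Γ k) (l : List (Γ k)) :
    enc used k (a :: l) = List.replicate (symCode used ⟨k, a⟩) true ++ false :: enc used k l := by
  simp [enc]

theorem Used.update [DecidableEq K] {S : ∀ k, List (Γ k)} (h : Used used S) {k : K}
    {l : List (Γ k)} (hl : ∀ a ∈ l, (⟨k, a⟩ : Σ k, Γ k) ∈ used) :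
    Used used (Function.update S k l) := by
  intro j a ha
  by_cases hj : j = k
  · subst hj
    exact hl a (by simpa using ha)
  · exact h j a (by simpa [hj] using ha)

/-- Reading the symbol on top of a stack. -/
theorem within_read_top (k : K) (q' : Tag × Stmt Γ Λ σ) (v : σ) {S : ∀ k, List (Γ k)}
    (hS : Used used S)
    (h : ∀ n, ∃ t, op e used m k₁ acc (q'.1, q'.2, v, n) =
      .pop (e k) t (some (q'.1, q'.2, v, min (n + 1) (used.length + 1)))) :
    ∃ n ≤ used.length + 1, (n = 0 → S k = []) ∧ decode used k n = (S k).head? ∧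
      Within (op e used m k₁ acc) (used.length + 1) (some (q'.1, q'.2, v, 0), encAll e used S)
        (some (q'.1, q'.2, v, n), Function.update (encAll e used S) (e k)
          (if n = 0 then [] else false :: enc used k (S k).tail)) ∧
      enc used k (S k) = if n = 0 then [] else
        List.replicate n true ++ false :: enc used k (S k).tail := by
  cases hk : S k with
  | nil =>
    refine ⟨0, Nat.zero_le _, fun _ => rfl, by simp [decode_zero], ⟨0, Nat.zero_le _, ?_⟩, by simp [enc]⟩
    have : encAll e used S (e k) = [] := by rw [encAll_apply, hk]; rfl
    simp [← this]
  | cons a l =>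
    have ha : (⟨k, a⟩ : Σ k, Γ k) ∈ used := hS k a (by simp [hk])
    have h0 : symCode used ⟨k, a⟩ ≠ 0 := by simp [symCode]
    have h1 := symCode_le used ⟨k, a⟩
    refine ⟨symCode used ⟨k, a⟩, h1, fun h => absurd h h0, by simp [decode_symCode ha], ?_, by simp [h0, enc_cons]⟩
    have := within_read (acc := acc) (m := m) (k₁ := k₁) (s := encAll e used S) k q' v 0
      (symCode used ⟨k, a⟩)
      (false :: enc used k l) (by omega) (by rw [encAll_apply, hk, enc_cons]) h
    rw [zero_add] at this
    simpa [h0] using this.mono h1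

theorem within_stmt [DecidableEq K] [Fintype σ] (q : Stmt Γ Λ σ) (hq : pushes q ⊆ used) (v : σ)
    {S : ∀ k, List (Γ k)} (hS : Used used S) :
    Within (op e used m k₁ acc) (weight used.length q) (some (.run, q, v, 0), encAll e used S)
      (corr e used m (stepAux q v S)) ∧ Used used (stepAux q v S).stk := by
  induction q generalizing v S with
  | push k f q ih =>
    simp only [pushes, List.append_subset] at hq
    have ha : (⟨k, f v⟩ : Σ k, Γ k) ∈ used := hq.1 (by simp)
    obtain ⟨h1, h2⟩ := ih hq.2 v (hS.update (k := k) (l := f v :: S k) (by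
      rintro a (_ | ⟨_, h⟩)
      · exact ha
      · exact hS k a h))
    refine ⟨?_, h2⟩
    have e1 := within_emit_push (e := e) (used := used) (m := m) (k₁ := k₁) (acc := acc)
      (s := Function.update (encAll e used S) (e k) (false :: encAll e used S (e k)))
      k f q v (symCode used ⟨k, f v⟩)
    rw [Function.update_self, Function.update_idem, encAll_apply, ← enc_cons, ← encAll_update] at e1
    have e2 : Within (op e used m k₁ acc) (symCode used ⟨k, f v⟩ + 1 + 1)
        (some (.run, .push k f q, v, 0), encAll e used S)
        (some (.run, q, v, 0), encAll e used (Function.update S k (f v :: S k))) :=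
      Within.head (by
        simp only [BitOp.step, op, BitOp.apply]
        rw [encAll_apply]
        exact e1)
    refine (e2.trans h1).mono ?_
    have := symCode_le used ⟨k, f v⟩
    simp only [weight]
    omega
  | peek k f q ih =>
    obtain ⟨n, hn, hn0, hd, hw, he⟩ := within_read_top (e := e) (m := m) (k₁ := k₁) (acc := acc)
      k (.read, .peek k f q) v hS (fun n => ⟨_, rfl⟩)
    obtain ⟨h1, h2⟩ := ih hq (f v (S k).head?) hS
    refine ⟨?_, h2⟩
    have e2 : Within (op e used m k₁ acc) (1 + (used.length + 1))
        (some (.run, .peek k f q, v, 0), encAll e used S) _ :=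
      Within.trans ⟨1, le_rfl, rfl⟩ hw
    by_cases h0 : n = 0
    · subst h0
      have hk := hn0 rfl
      have e3 := (e2.trans (n' := 1) ⟨1, le_rfl, ?_⟩).trans h1
      · exact e3.mono (by simp only [weight]; omega)
      · have h3 : encAll e used S (e k) = [] := by rw [encAll_apply, hk]; rfl
        simp only [BitOp.step, op, BitOp.apply, Function.iterate_one, if_true, Function.update_self,
          Function.update_idem, List.headD_nil, List.tail_nil, hk, List.head?_nil,
          Bool.false_eq_true, if_false]
        rw [← h3, Function.update_eq_self]
    · have e3 := within_emit_peek (e := e) (used := used) (m := m) (k₁ := k₁) (acc := acc)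
        (s := Function.update (encAll e used S) (e k) (false :: enc used k (S k).tail))
        k f q (f v (S k).head?) n
      rw [if_neg h0] at he
      rw [Function.update_self, Function.update_idem, ← he, ← encAll_apply (e := e),
        Function.update_eq_self] at e3
      have e4 := ((e2.trans (n' := 2) ⟨2, le_rfl, ?_⟩).trans e3).trans h1
      · exact e4.mono (by simp only [weight]; omega)
      · simp [BitOp.step, op, BitOp.apply, h0, hd]
  | pop k f q ih =>
    obtain ⟨n, hn, hn0, hd, hw, he⟩ := within_read_top (e := e) (m := m) (k₁ := k₁) (acc := acc)
      k (.read, .pop k f q) v hS (fun n => ⟨_, rfl⟩)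
    obtain ⟨h1, h2⟩ := ih hq (f v (S k).head?) (hS.update (k := k) (l := (S k).tail) (fun a h =>
      hS k a (List.mem_of_mem_tail h)))
    refine ⟨?_, h2⟩
    have e2 : Within (op e used m k₁ acc) (1 + (used.length + 1))
        (some (.run, .pop k f q, v, 0), encAll e used S) _ :=
      Within.trans ⟨1, le_rfl, rfl⟩ hw
    have e3 := (e2.trans (n' := 1) ⟨1, le_rfl, ?_⟩).trans h1
    · exact e3.mono (by simp only [weight]; omega)
    · by_cases h0 : n = 0
      · subst h0
        have hk := hn0 rfl
        simp [BitOp.step, op, BitOp.apply, hk, decode_zero, encAll_update, enc]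
      · simp [BitOp.step, op, BitOp.apply, h0, hd, encAll_update]
  | load a q ih =>
    obtain ⟨h1, h2⟩ := ih hq (a v) hS
    exact ⟨Within.head h1, h2⟩
  | branch f q₁ q₂ ih₁ ih₂ =>
    simp only [pushes, List.append_subset] at hq
    simp only [stepAux, weight]
    cases hf : f v with
    | true =>
      obtain ⟨h1, h2⟩ := ih₁ hq.1 v hS
      refine ⟨Within.head (Within.mono (n := weight used.length q₁) ?_ (by omega)), h2⟩
      simpa [BitOp.step, op, BitOp.apply, hf] using h1
    | false =>
      obtain ⟨h1, h2⟩ := ih₂ hq.2 v hS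
      refine ⟨Within.head (Within.mono (n := weight used.length q₂) ?_ (by omega)), h2⟩
      simpa [BitOp.step, op, BitOp.apply, hf] using h1
  | goto f => exact ⟨⟨1, le_rfl, rfl⟩, hS⟩
  | halt => exact ⟨⟨1, le_rfl, rfl⟩, hS⟩

theorem within_chk {S : ∀ k, List (Γ k)} (hS : Used used S) (v : σ) :
    ∃ n, decode used k₁ n = (S k₁).head? ∧ ∃ s', Within (op e used m k₁ acc) (used.length + 2)
      (some (.chk, .halt, v, 0), encAll e used S)
        (if n = acc then none else some (.rej, .halt, v, n), s') := by
  obtain ⟨n, -, -, hd, hw, -⟩ := within_read_top (e := e) (m := m) (k₁ := k₁) (acc := acc)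
      k₁ (.chk, .halt) v hS (fun n => ⟨_, rfl⟩)
  refine ⟨n, hd, _, hw.trans (n' := 1) ⟨1, le_rfl, Prod.ext ?_ rfl⟩⟩
  by_cases h0 : n = 0 <;> simp [BitOp.step, op, BitOp.apply, h0]

end

theorem _root_.Turing.initList_stk (tm : FinTM2) (l : List (tm.Γ tm.k₀)) :
    (initList tm l).stk = Function.update (fun _ => []) tm.k₀ l := by
  funext k
  by_cases h : k = tm.k₀
  · subst h; simp [initList]
  · simp [initList, h]

theorem _root_.Turing.haltList_stk (tm : FinTM2) (l : List (tm.Γ tm.k₁)) :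
    (haltList tm l).stk tm.k₁ = l := by
  simp [haltList]

/-- A machine that decides a language is simulated by a bit-stack machine, which accepts by
halting and otherwise runs forever. -/
theorem exists_bitMachine {Γ : Type} {f : List Γ → Bool}
    (M : TM2ComputableInTime (id : List Γ → List Γ) Computability.encodeBool f) :
    ∃ (κ : ℕ) (B : BitMachine κ) (i : Fin κ) (code : Γ → List Bool) (C : ℕ),
      (∀ a, ∃ t, code a = true :: t) ∧ ∀ w,
      (f w = true → ∃ j ≤ C * M.time w.length + C,
        (B.step^[j] (0, Function.update (fun _ => []) i (w.flatMap code))).1 = Fin.last B.size) ∧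
      (f w = false → ∀ j,
        (B.step^[j] (0, Function.update (fun _ => []) i (w.flatMap code))).1 ≠ Fin.last B.size) := by
  classical
  obtain ⟨⟨tm, inA, outA⟩, time, hout⟩ := M
  have := tm.kFin
  have := tm.ΛFin
  have := tm.σFin
  have := tm.Γk₀Fin
  let e := Fintype.equivFin tm.K
  -- Only the input alphabet is assumed finite. Still, finitely many symbols can occur, since what a
  -- statement pushes is a function of the finite internal state. The accepting symbol is listed so
  -- that its code identifies it.
  let used : List (Σ k, tm.Γ k) := ⟨tm.k₁, outA.symm true⟩ ::
    ((Finset.univ : Finset (tm.Γ tm.k₀)).toList.map (fun a => ⟨tm.k₀, a⟩) ++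
      (Finset.univ : Finset tm.Λ).toList.flatMap fun l => pushes (tm.m l))
  let acc := symCode used ⟨tm.k₁, outA.symm true⟩
  let F : Finset (Stmt tm.Γ tm.Λ tm.σ) := Finset.univ.biUnion fun l => stmts₁ (tm.m l)
  have hF : ∀ q ∈ F, stmts₁ q ⊆ F := by
    intro q hq q' hq'
    obtain ⟨l, -, hl⟩ := Finset.mem_biUnion.1 hq
    exact Finset.mem_biUnion.2 ⟨l, Finset.mem_univ _, stmts₁_trans hl hq'⟩
  have hm : ∀ l, tm.m l ∈ F := fun l =>
    Finset.mem_biUnion.2 ⟨l, Finset.mem_univ _, stmts₁_self⟩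
  obtain ⟨B, hB⟩ := BitOp.exists_bitMachine (q₀ := (Tag.run, tm.m tm.main, tm.initialState, 0))
    (by simp [hm]) _ (closed e used tm.m tm.k₁ acc hm hF)
  let W := Finset.univ.sup fun l => weight used.length (tm.m l)
  have hpush : ∀ l, pushes (tm.m l) ⊆ used := fun l a ha =>
    List.mem_cons_of_mem _ (List.mem_append_right _ (List.mem_flatMap.2 ⟨l, by simp, ha⟩))
  have hsim : ∀ c₀ : TM2.Cfg tm.Γ tm.Λ tm.σ, Used used c₀.stk → ∀ n c,
      (flip bind (TM2.step tm.m))^[n] (some c₀) = some c →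
      Within (op e used tm.m tm.k₁ acc) (n * W) (corr e used tm.m c₀) (corr e used tm.m c) ∧
        Used used c.stk := by
    intro c₀ h0 n
    induction n with
    | zero =>
      rintro c hc
      obtain rfl : c₀ = c := by simpa using hc
      exact ⟨Within.refl _, h0⟩
    | succ n ih =>
      intro c hc
      rw [Function.iterate_succ_apply'] at hc
      obtain ⟨c', hc', hs⟩ := Option.bind_eq_some_iff.1 hc
      obtain ⟨h1, h2⟩ := ih c' hc'
      obtain ⟨_ | l, v, S⟩ := c'
      · simp [TM2.step] at hs
      · obtain rfl : stepAux (tm.m l) v S = c := by simpa [TM2.step] using hs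
        obtain ⟨h3, h4⟩ := within_stmt (e := e) (m := tm.m) (k₁ := tm.k₁) (acc := acc)
          (tm.m l) (hpush l) v h2
        refine ⟨(h1.trans h3).mono ?_, h4⟩
        have : weight used.length (tm.m l) ≤ W :=
          Finset.le_sup (f := fun l => weight used.length (tm.m l)) (Finset.mem_univ l)
        rw [add_mul]
        omega
  refine ⟨_, B, e tm.k₀, fun a => enc used tm.k₀ [inA.symm a], W + used.length + 2,
    fun a => ⟨_, by simp [enc, symCode, List.replicate_succ]; rfl⟩, fun w => ?_⟩
  have hinit : encAll e used (initList tm (w.map inA.symm)).stk = Function.update (fun _ => [])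
      (e tm.k₀) (w.flatMap fun a => enc used tm.k₀ [inA.symm a]) := by
    rw [initList_stk, encAll_update]
    congr 1
    simp [enc, List.flatMap_map]
  obtain ⟨⟨n, hn⟩, hle⟩ := hout w
  simp only [id] at hle
  obtain ⟨h1, h2⟩ := hsim _ (by
    intro k a ha
    rw [initList_stk] at ha
    by_cases hk : k = tm.k₀
    · subst hk
      simp [used]
    · simp [hk] at ha) n _ hn
  obtain ⟨n', hd, s', hw⟩ := within_chk (e := e) (m := tm.m) (k₁ := tm.k₁) (acc := acc) h2
    tm.initialState
  rw [haltList_stk] at hd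
  obtain ⟨j, hj, hjs⟩ := h1.trans hw
  have hstart : corr e used tm.m (initList tm (w.map inA.symm)) =
      (some (Tag.run, tm.m tm.main, tm.initialState, 0), Function.update (fun _ => [])
      (e tm.k₀) (w.flatMap fun a => enc used tm.k₀ [inA.symm a])) := by
    rw [← hinit]
    rfl
  simp only [hB, ← hstart]
  have hsym : ∀ b, f w = b → (n' = acc ↔ b = true) := by
    rintro b rfl
    have h3 : (⟨tm.k₁, outA.symm (f w)⟩ : Σ k, tm.Γ k) ∈ used :=
      h2 tm.k₁ _ (by rw [haltList_stk]; simp [Computability.encodeBool])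
    have h4 : n' = symCode used ⟨tm.k₁, outA.symm (f w)⟩ := (symCode_of_decode hd).symm
    rw [h4]
    constructor
    · intro h
      have := symCode_inj h3 h
      simpa using this
    · intro h
      rw [h]
  refine ⟨fun hf => ⟨j, ?_, ?_⟩, fun hf i hi => ?_⟩
  · refine hj.trans ?_
    have := Nat.mul_le_mul_right W hle
    nlinarith
  · exact (congrArg Prod.fst hjs).trans (if_pos ((hsym _ hf).2 rfl))
  · have hne : n' ≠ acc := fun h => by simpa using (hsym _ hf).1 h
    rw [hB, ← hstart] at hi
    rw [if_neg hne] at hw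
    exact (h1.trans hw).iterate_ne_none rfl (by simp) i hi

end StackSim

/-! ## The lower bound -/

theorem bval_append (u v : List Bool) : bval (u ++ v) = bval u + 2 ^ u.length * bval v := by
  induction u with
  | nil => simp [bval]
  | cons b u ih => simp only [List.cons_append, bval, ih, List.length_cons, pow_succ]; ring

/-- A bit list is the canonical numeral of its value if its most significant bit is `true`. -/
theorem encodeNat_bval (u : List Bool) :
    Computability.encodeNat (bval (u ++ [true])) = u ++ [true] := by
  obtain ⟨p, hp⟩ : ∃ p, Computability.encodePosNum p = u ++ [true] := by
    induction u with
    | nil => exact ⟨.one, rfl⟩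
    | cons b u ih =>
      obtain ⟨p, hp⟩ := ih
      cases b
      · exact ⟨p.bit0, by simp [Computability.encodePosNum, hp]⟩
      · exact ⟨p.bit1, by simp [Computability.encodePosNum, hp]⟩
  rw [← hp, bval_encodePosNum, Computability.encodeNat]
  exact congrArg Computability.encodeNum (Num.of_to_nat (.pos p))

theorem encodeNat_two_pow (k : ℕ) :
    Computability.encodeNat (2 ^ k) = List.replicate k false ++ [true] := by
  rw [← encodeNat_bval, bval_append]
  have : bval (List.replicate k false) = 0 := by
    induction k with
    | zero => rfl
    | succ k ih => simp [List.replicate_succ, bval, ih]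
  simp [this, bval]

namespace BitMachine

/-- The bits of the number that represents the list `l` at the scale `8 ^ l.length`. -/
def stackBits (l : List Bool) : List Bool := l.reverse.flatMap fun b => [false, false, b]

/-- The bits `false, false, b` are the octal digit `4` or `0`, least significant bit first. The top
of the stack is the most significant digit, whence the reversal. -/
theorem enc_stackBits (l : List Bool) : Enc (8 ^ l.length) l (bval (stackBits l)) := by
  induction l with
  | nil => rfl
  | cons b l ih =>
    have h := ih.scale
    have h2 : (stackBits l).length = 3 * l.length := by
      simp [stackBits, mul_comm]
    have h3 : stackBits (b :: l) = stackBits l ++ [false, false, b] := by simp [stackBits]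
    rw [Enc, h3, bval_append, h2, pow_mul, List.length_cons, pow_succ, mul_comm _ (8 : ℤ)]
    convert h using 1
    cases b <;> simp [bval]
    ring

/-- This is why every letter is coded by a word beginning with `true`: the number of the input stack
then has no superfluous leading zeros, and its numeral can be written letter by letter. -/
theorem encodeNat_bval_stackBits {l : List Bool} (hl : l = [] ∨ ∃ t, l = true :: t) :
    Computability.encodeNat (bval (stackBits l)) = stackBits l := by
  rcases hl with rfl | ⟨t, rfl⟩
  · rfl
  · have : stackBits (true :: t) = (stackBits t ++ [false, false]) ++ [true] := by simp [stackBits]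
    rw [this, encodeNat_bval]

variable {κ : ℕ} (B : BitMachine κ) (i : Fin κ)

/-- Initial values that represent the list `l` on the stack `i`. -/
def initValue (l : List Bool) : Ctr κ → ℕ
  | .scale => 8 ^ l.length
  | .stack j => if j = i then bval (stackBits l) else 0
  | _ => 0

theorem represents_initValue (l : List Bool) :
    Represents (Function.update (fun _ => []) i l) fun x => (initValue i l x : ℤ) where
  left := le_rfl
  right := le_rfl
  scale := by simp [initValue]
  zero := rfl
  stack j := by
    by_cases hj : j = i
    · subst hj
      simpa [initValue] using enc_stackBits l
    · simp [initValue, hj, Enc]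

theorem exists_ofFn_ite (i : Fin κ) : ∃ u v : List ℕ, ∀ s,
    (List.ofFn fun j : Fin κ => if j = i then s else 0) = u ++ s :: v := by
  obtain ⟨a, b, h⟩ := List.append_of_mem (List.mem_finRange i)
  have hn := List.nodup_finRange κ
  rw [h, List.nodup_append] at hn
  obtain ⟨-, h2, h3⟩ := hn
  refine ⟨a.map fun _ => 0, b.map fun _ => 0, fun s => ?_⟩
  rw [List.ofFn_eq_map, h, List.map_append, List.map_cons, if_pos rfl]
  congr 1
  · exact List.map_congr_left fun x hx => if_neg (h3 x hx i (by simp))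
  · congr 1
    exact List.map_congr_left fun x hx => if_neg fun (e : x = i) => (List.nodup_cons.1 h2).1 (e ▸ hx)

/-- The shape of the word of an instance. -/
theorem exists_encode_eq : ∃ u₁ u₂ u₃ : List CPSym, ∀ l N,
    (⟨B.toCP (initValue i l), N⟩ : BTInstance).encode =
      (Computability.encodeNat N).map CPSym.bit ++ (u₁ ++
        ((Computability.encodeNat (8 ^ l.length)).map CPSym.bit ++ (u₂ ++
          ((Computability.encodeNat (bval (stackBits l))).map CPSym.bit ++ u₃)))) := by
  obtain ⟨u, v, huv⟩ := exists_ofFn_ite i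
  refine ⟨.comma :: (encodeNatSym (4 + κ) ++ encodeNatSym (B.toLin.len + 1) ++ [.comma, .comma]),
    .comma :: .comma :: u.flatMap encodeNatSym, .comma :: (v.flatMap encodeNatSym ++
      (List.ofFn fun q : Fin B.toLin.len => B.toLin.toCPInstr (B.toLin.instr q)).flatMap
        CPInstr.encode), fun l N => ?_⟩
  have h : List.ofFn (B.toCP (initValue i l)).init =
      [0, 0, 8 ^ l.length, 0] ++ (u ++ bval (stackBits l) :: v) := by
    rw [← huv]
    change List.ofFn (fun j : Fin (4 + κ) => initValue i l (Ctr.ofFin j)) = _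
    rw [List.ofFn_add]
    congr 1
    congr 1
    funext j
    simp [Ctr.ofFin, initValue]
  have h0 : Computability.encodeNat 0 = [] := rfl
  rw [BTInstance.encode, h]
  simp only [encodeNatSym, List.flatMap_append, List.flatMap_cons,
    List.append_assoc, List.cons_append, List.nil_append, h0, List.map_nil]
  rfl

end BitMachine

/-! ### Writing the instance in polynomial time -/

namespace Code

open SExp

section
variable {A : Type}

/-- Prepend a fixed word. -/
def prepend (u : List A) (c : Code A) : Code A := u.foldr (fun a c => pair (const a) c) c

theorem size_eval_prepend (u : List A) (c : Code A) (x : SExp A) :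
    (eval (prepend u c) x).size = (eval c x).size + 2 * u.length := by
  induction u with
  | nil => rfl
  | cons a u ih =>
    change (node (atom a) (eval (prepend u c) x)).size = _
    rw [SExp.size, ih, SExp.size, List.length_cons]
    omega

theorem PolyTime.prepend (u : List A) {c : Code A} (hc : PolyTime c) : PolyTime (prepend u c) := by
  induction u with
  | nil => exact hc
  | cons a u ih => exact (PolyTime.const a).pair ih

variable [Inhabited A]

theorem eval_prepend (u : List A) {c : Code A} {x : SExp A} {v : List A}
    (h : eval c x = word _root_.id v) : eval (prepend u c) x = word _root_.id (u ++ v) := by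
  induction u with
  | nil => exact h
  | cons a u ih =>
    rw [List.cons_append, word_cons, ← ih]
    rfl

theorem exists_prependBy {Γ : Type} [Fintype Γ] {e : Γ → A} (he : e.Injective) (g : Γ → List A) :
    ∃ c : Code A, PolyTime c ∧ (∃ n, ∀ y s, (eval c (node y s)).size ≤ y.size + s.size + n) ∧
      ∀ a v, eval c (node (atom (e a)) (word _root_.id v)) = word _root_.id (g a ++ v) := by
  classical
  have key : ∀ l : List Γ, ∃ c : Code A, PolyTime c ∧
      (∃ n, ∀ y s, (eval c (node y s)).size ≤ y.size + s.size + n) ∧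
      ∀ a ∈ l, ∀ v, eval c (node (atom (e a)) (word _root_.id v)) = word _root_.id (g a ++ v) := by
    intro l
    induction l with
    | nil => exact ⟨tl, .tl, ⟨0, fun y s => by simp⟩, by simp⟩
    | cons b l ih =>
      obtain ⟨c, hc, ⟨n, hn⟩, h⟩ := ih
      refine ⟨cond (fun x => x = e b) hd (prepend (g b) tl) c,
        PolyTime.cond .hd (.prepend _ .tl) hc, ⟨n + 2 * (g b).length, fun y s => ?_⟩,
        fun a ha v => ?_⟩
      · have := hn y s
        rw [eval_cond]
        split
        · rw [size_eval_prepend, eval_tl, tl_node]; omega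
        · omega
      · rw [eval_cond, eval_hd, hd_node, test_atom]
        by_cases hab : a = b
        · subst hab
          rw [if_pos (by simp)]
          exact eval_prepend _ rfl
        · rw [if_neg (by simpa using fun h => hab (he h))]
          exact h a (List.mem_of_ne_of_mem hab ha) v
  obtain ⟨c, hc, hn, h⟩ := key Finset.univ.toList
  exact ⟨c, hc, hn, fun a => h a (by simp)⟩

/-- Prepend the words of all symbols of a given word. -/
theorem exists_prependAll {Γ : Type} [Fintype Γ] {e : Γ → A} (he : e.Injective) (g : Γ → List A) :
    ∃ c : Code A, PolyTime c ∧ ∀ w v, eval c (node (word e w) (word _root_.id v)) =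
      word _root_.id (w.reverse.flatMap g ++ v) := by
  obtain ⟨c, hc, ⟨n, hn⟩, h⟩ := exists_prependBy he g
  refine ⟨foldl c, hc.foldl n hn, fun w v => ?_⟩
  rw [word, eval_foldl]
  induction w generalizing v with
  | nil => rfl
  | cons a w ih =>
    rw [List.map_cons, List.foldl_cons, h, ih]
    simp

def mulUnary : Code A :=
  comp tl (comp (iter (pair hd extend)) (pair hd (pair tl (const default))))

theorem eval_mulUnary (l m : SExp A) : eval mulUnary (node l m) = unary (l.len * m.len) := by
  have key : ∀ k, (eval (pair hd extend))^[k] (node m (atom default)) =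
      node m (unary (k * m.len)) := by
    intro k
    induction k with
    | zero => rw [zero_mul]; rfl
    | succ k ih =>
      rw [Function.iterate_succ_apply', ih, eval_pair, eval_extend_unary, Nat.succ_mul, add_comm]
      rfl
  simp only [mulUnary, eval_comp, eval_pair, eval_hd, eval_tl, hd_node, tl_node, eval_const,
    eval_iter, key]

theorem PolyTime.mulUnary : PolyTime (mulUnary : Code A) := by
  have h : PolyTime (Code.iter (Code.pair Code.hd (Code.extend : Code A))) :=
    (PolyTime.hd.pair .extend).iter_of_le_add (fun a => a.hd.size) (Polynomial.X + 2)
      (fun a => a.size_hd_le) (fun a => le_rfl) (fun a => by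
        simp only [Polynomial.eval_add, Polynomial.eval_X, Polynomial.eval_ofNat]
        cases a with
        | atom a => simp [Code.extend, SExp.size, eval]
        | node x y =>
          have := size_extend x y
          have := x.two_mul_len_lt
          rw [eval_pair, SExp.size, SExp.size, eval_hd, hd_node]
          omega)
  exact PolyTime.tl.comp (h.comp (PolyTime.hd.pair (PolyTime.tl.pair (.const _))))

/-- The exponent of the step bound `2 ^ q.eval |w|` is needed in unary, being the number of zeros in
its binary numeral. -/
theorem exists_unary (q : Polynomial ℕ) :
    ∃ c : Code A, PolyTime c ∧ ∀ x, eval c x = unary (q.eval x.len) := by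
  induction q using Polynomial.induction_on with
  | C a =>
    refine ⟨prepend (List.replicate a default) (const default), .prepend _ (.const _), fun x => ?_⟩
    rw [eval_prepend (v := []) _ rfl]
    simp [unary, word]
  | add p q hp hq =>
    obtain ⟨c, hc, h⟩ := hp
    obtain ⟨d, hd, h'⟩ := hq
    refine ⟨comp extend (pair c d), PolyTime.extend.comp (hc.pair hd), fun x => ?_⟩
    rw [eval_comp, eval_pair, h, h', eval_extend_unary, len_unary, Polynomial.eval_add]
  | monomial n a h =>
    obtain ⟨c, hc, h⟩ := h
    refine ⟨comp mulUnary (pair c id), PolyTime.mulUnary.comp (hc.pair .id), fun x => ?_⟩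
    rw [eval_comp, eval_pair, h, eval_mulUnary, len_unary, eval_id]
    simp [pow_succ, mul_assoc]

theorem word_unary (k : ℕ) : (unary k : SExp A) = word (fun _ : Unit => default)
    (List.replicate k ()) := by
  simp [unary, word]

end

theorem flatMap_triple {A B : Type} (x : A) (l : List B) :
    (l.reverse.flatMap fun _ => [x, x, x]) = List.replicate (3 * l.length) x := by
  rw [List.eq_replicate_iff]
  constructor
  · simp [mul_comm]
  · simp

open BitMachine in
/-- The instances `(B.toCP (initValue i l), 2 ^ q |w|)`, where `l` codes `w`, are computed in
polynomial time. -/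
theorem exists_computes_instance {Γ : Type} [Fintype Γ] {κ : ℕ} (B : BitMachine κ) (i : Fin κ)
    {code : Γ → List Bool} (hcode : ∀ a, ∃ t, code a = true :: t) (q : Polynomial ℕ) :
    ∃ c : Code (Γ ⊕ CPSym), PolyTime c ∧ ∀ w, eval c (word Sum.inl w) = word Sum.inr
      (⟨B.toCP (initValue i (w.flatMap code)), 2 ^ q.eval w.length⟩ : BTInstance).encode := by
  obtain ⟨u₁, u₂, u₃, hu⟩ := exists_encode_eq B i
  have hinj : (Sum.inl : Γ → Γ ⊕ CPSym).Injective := Sum.inl_injective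
  obtain ⟨c₁, hc₁, h₁⟩ := exists_prependAll hinj fun a =>
    (code a).reverse.flatMap fun b => [Sum.inr (.bit false), .inr (.bit false), .inr (.bit b)]
  obtain ⟨c₂, hc₂, h₂⟩ := exists_prependAll hinj fun a =>
    (code a).reverse.flatMap fun _ =>
      [Sum.inr (CPSym.bit false), .inr (.bit false), .inr (.bit false)]
  obtain ⟨c₃, hc₃, h₃⟩ := exists_prependAll (Γ := Unit) (A := Γ ⊕ CPSym) (e := fun _ => default)
    (fun _ _ _ => rfl) fun _ => [Sum.inr (CPSym.bit false)]
  obtain ⟨d, hd, h⟩ := exists_unary (A := Γ ⊕ CPSym) q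
  -- The word is assembled from its end. The leading `true` in the first two fixed parts completes
  -- the numeral of a power of two, whose zeros are prepended afterwards.
  refine ⟨comp c₃ (pair d (prepend (Sum.inr (.bit true) :: u₁.map Sum.inr) (comp c₂ (pair id
    (prepend (Sum.inr (.bit true) :: u₂.map Sum.inr) (comp c₁ (pair id
      (prepend (u₃.map Sum.inr) (const default))))))))), ?_, fun w => ?_⟩
  · exact hc₃.comp (hd.pair (.prepend _ (hc₂.comp (PolyTime.id.pair (.prepend _ (hc₁.comp
      (PolyTime.id.pair (.prepend _ (.const _)))))))))
  · have e₁ := fun x : SExp (Γ ⊕ CPSym) => eval_prepend (u₃.map Sum.inr) (c := const default)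
      (x := x) (v := []) rfl
    have hlen : (word Sum.inl w : SExp (Γ ⊕ CPSym)).len = w.length := by simp [word]
    have hl : w.flatMap code = [] ∨ ∃ t, w.flatMap code = true :: t := by
      cases w with
      | nil => exact .inl rfl
      | cons a w =>
        obtain ⟨t, ht⟩ := hcode a
        exact .inr ⟨t ++ w.flatMap code, by simp [ht]⟩
    have hpow : 8 ^ (w.flatMap code).length = 2 ^ (3 * (w.flatMap code).length) := by
      rw [pow_mul]; norm_num
    rw [hu, hpow, encodeNat_two_pow, encodeNat_two_pow, encodeNat_bval_stackBits hl]
    have e₂ : eval (comp c₁ (pair id (prepend (u₃.map Sum.inr) (const default))))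
        (word Sum.inl w) = word _root_.id (((stackBits (w.flatMap code)).map CPSym.bit ++ u₃).map
          Sum.inr) := by
      rw [eval_comp, eval_pair, e₁, eval_id, h₁]
      simp [stackBits, List.reverse_flatMap, List.flatMap_assoc, List.map_flatMap,
        Function.comp_def]
    generalize comp c₁ (pair id (prepend (u₃.map Sum.inr) (const default))) = d₁ at e₂ ⊢
    have e₃ : eval (comp c₂ (pair id (prepend (Sum.inr (.bit true) :: u₂.map Sum.inr) d₁)))
        (word Sum.inl w) = word _root_.id (((List.replicate (3 * (w.flatMap code).length) false ++
          [true]).map CPSym.bit ++ (u₂ ++ ((stackBits (w.flatMap code)).map CPSym.bit ++ u₃))).map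
            Sum.inr) := by
      have hr : (w.reverse.flatMap fun a => (code a).reverse.flatMap fun _ =>
          [(Sum.inr (CPSym.bit false) : Γ ⊕ CPSym), .inr (.bit false), .inr (.bit false)]) =
            List.replicate (3 * (w.flatMap code).length) (Sum.inr (.bit false)) := by
        rw [← flatMap_triple, List.reverse_flatMap, List.flatMap_assoc]
        simp
      rw [eval_comp, eval_pair, eval_prepend _ e₂, eval_id, h₂, hr]
      simp
    generalize comp c₂ (pair id (prepend (Sum.inr (.bit true) :: u₂.map Sum.inr) d₁)) = d₂ at e₃ ⊢
    rw [eval_comp, eval_pair, eval_prepend _ e₃, h, word_unary, h₃, hlen]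
    simp [word, List.flatMap_replicate, Function.comp_def]

end Code

namespace CounterProgram

theorem expHard_simpleBoundedTermination : simpleBoundedTermination.EXPHard := by
  rintro Γ _ L ⟨f, M, p, hL, hp⟩
  obtain ⟨κ, B, i, code, C, hcode, hB⟩ := StackSim.exists_bitMachine M
  -- An accepting run takes at most `C * 2 ^ p + C ≤ 2 * C * 2 ^ p` machine steps, each costing at
  -- most `blockLen κ`; the constant factor is absorbed into the exponent by `a < 2 ^ a`.
  obtain ⟨q, hq⟩ : ∃ q : Polynomial ℕ, q = p + Polynomial.C (2 * C * BitMachine.blockLen κ) :=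
    ⟨_, rfl⟩
  have hrep : ∀ w : List Γ, BitMachine.Represents
      (Function.update (fun _ => []) i (w.flatMap code)) fun x =>
        (BitMachine.initValue i (w.flatMap code) x : ℤ) := fun w =>
    BitMachine.represents_initValue i _
  obtain ⟨c, ⟨P, hP⟩, hc⟩ := Code.exists_computes_instance B i hcode q
  obtain ⟨g, hg⟩ : ∃ g : List Γ → {I : BTInstance // I.prog.IsSimple}, ∀ w, (g w).1 =
      ⟨B.toCP (BitMachine.initValue i (w.flatMap code)), 2 ^ q.eval w.length⟩ :=
    ⟨fun w => ⟨⟨_, _⟩, B.isSimple_toCP (hrep w)⟩, fun _ => rfl⟩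
  refine ⟨g, ?_, fun w => ?_⟩
  · let T : Polynomial ℕ := 5 * Polynomial.X + 6 + 2 * P.comp (2 * Polynomial.X + 1)
    obtain ⟨M', hM'⟩ := Code.computableInTime (ea := (id : List Γ → List Γ))
      (Δ := CPSym)
      (eb := fun I : {I : BTInstance // I.prog.IsSimple} => I.1.encode) c Sum.inl Sum.inr Sum.inr_injective
      (f := g) (fun w => (hc w).trans (congrArg (fun I : BTInstance => SExp.word Sum.inr I.encode)
        (hg w).symm))
      (fun n => T.eval n) (fun w => by
        have := hP (SExp.word Sum.inl w)
        rw [SExp.size_word] at this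
        simp only [T, Polynomial.eval_add, Polynomial.eval_mul, Polynomial.eval_comp,
          Polynomial.eval_X, Polynomial.eval_ofNat, Polynomial.eval_one, id]
        omega)
    exact ⟨⟨M'.toTM2ComputableAux, T, fun w => by
      have := M'.outputsFun w
      rwa [hM'] at this⟩⟩
  · rw [hL]
    change _ ↔ (g w).1.prog.HaltsWithin (g w).1.N
    rw [hg]
    constructor
    · intro hw
      obtain ⟨j, hj, hacc⟩ := (hB w).1 hw
      refine B.haltsWithin_toCP (hrep w) ?_ hacc
      have h1 := hp w.length
      have h2 : 2 * C * BitMachine.blockLen κ < 2 ^ (2 * C * BitMachine.blockLen κ) :=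
        Nat.lt_two_pow_self
      have h3 : 1 ≤ 2 ^ p.eval w.length := Nat.one_le_two_pow
      simp only [hq, Polynomial.eval_add, Polynomial.eval_C, pow_add]
      calc j * BitMachine.blockLen κ
          ≤ (C * 2 ^ p.eval w.length + C * 2 ^ p.eval w.length) * BitMachine.blockLen κ := by
            refine Nat.mul_le_mul_right _ (hj.trans (Nat.add_le_add (Nat.mul_le_mul_left _ h1) ?_))
            exact Nat.le_mul_of_pos_right _ h3
        _ = 2 ^ p.eval w.length * (2 * C * BitMachine.blockLen κ) := by ring
        _ ≤ _ := Nat.mul_le_mul_left _ h2.le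
    · intro h
      by_contra hw
      exact B.not_haltsWithin_toCP (hrep w) _ ((hB w).2 (by simpa using hw)) h

end CounterProgram

theorem mainTheorem3 : simpleBoundedTermination.EXPComplete :=
  ⟨CounterProgram.memEXP_simpleBoundedTermination, CounterProgram.expHard_simpleBoundedTermination⟩
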